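/- For a field $K$ and $f,g,h\in K[x_1,\ldots,x_n]^n$ write $f=g\circ h$ if $f_i=g_i(h_1,\ldots,h_n)$ for all $i$; such a decomposition is called degree proper if $d_f=d_g\,d_h$, where the degree of a tuple is the maximum of the total degrees of its components. An algorithm is a probabilistic program for an algebraic random access machine over $K$: it adds, subtracts and compares natural numbers (used for addressing and control), performs field operations and equality tests in $K$, and draws random elements of $K$, each at unit cost; the program depends neither on $K$ nor on $n$. Forms are given by the tables of their coefficients. Theorem. There are one such program and polynomials $T,Q\in\mathbb{N}[z]$ with the following properties for all $n\ge 5$. (1) Let $K$ be any field and let $f\in K[x_1,\ldots,x_n]^n$ consist of homogeneous polynomials of degree four. On input $f$, whatever its random choices are, the program halts after at most $T(n)$ steps. It then either reports failure or outputs $g,h\in K[x_1,\ldots,x_n]^n$ consisting of quadratic forms such that $f=g\circ h$ is a degree proper decomposition. (2) Let $K$ be of characteristic zero. There is a proper algebraic subset $Z$ of the space $K^{n^2(n+1)}$ of the coefficients of pairs $(g,h)$ of $n$-tuples of quadratic forms in $x_1,\ldots,x_n$ (namely the zero set of a nonzero polynomial) such that, for every $(g,h)\notin Z$, the program on input $f=g\circ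 h$ outputs a degree proper decomposition of $f$ into quadratic forms with probability one, i.e. for all values of its (at most $T(n)$) random elements outside the zero set of some nonzero polynomial. (3) Let $K=\mathbb{F}_q$. If the coefficients of the $n$-tuples $g,h$ of quadratic forms and the random elements drawn by the program are independent and uniformly distributed in $\mathbb{F}_q$, then on input $f=g\circ h$ the program outputs a degree proper decomposition of $f$ into quadratic forms with probability at least $1-Q(n)/q$. This is close to one when $q$ is sufficiently large. -/

import Mathlib

universe u

namespace FDP

open MvPolynomial

/-! ## Functional decompositions -/

/-- The functional composition `g ∘ h = (g₁(h₁,…,hₙ), …, gₙ(h₁,…,hₙ))`. -/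
noncomputable def compose {K : Type u} [Field K] {n : ℕ}
    (g h : Fin n → MvPolynomial (Fin n) K) : Fin n → MvPolynomial (Fin n) K :=
  fun i => bind₁ h (g i)

/-- The degree of a tuple of polynomials: the maximum of the total degrees. -/
noncomputable def tupleDegree {K : Type u} [Field K] {n : ℕ}
    (f : Fin n → MvPolynomial (Fin n) K) : ℕ :=
  Finset.univ.sup fun i => (f i).totalDegree

/-- `f = g ∘ h` and `deg f = deg g * deg h`. -/
def IsDegreeProperDecomposition {K : Type u} [Field K] {n : ℕ}
    (f g h : Fin n → MvPolynomial (Fin n) K) : Prop :=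
  f = compose g h ∧ tupleDegree f = tupleDegree g * tupleDegree h

/-- A degree proper decomposition whose two factors consist of quadratic forms.  (The requirement
on the factors rules out the trivial degree proper decompositions of `f` with a linear factor.) -/
def IsQuadraticDecomposition {K : Type u} [Field K] {n : ℕ}
    (f g h : Fin n → MvPolynomial (Fin n) K) : Prop :=
  IsDegreeProperDecomposition f g h ∧
    (∀ i, (g i).IsHomogeneous 2) ∧ (∀ i, (h i).IsHomogeneous 2)

/-- The quadratic form `∑_{a ≤ b} c_{ab} x_a x_b`, the unordered pair `s(a, b)` standing for the
monomial `x_a x_b`. -/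
noncomputable def quadForm {K : Type u} [Field K] {n : ℕ} (c : Sym2 (Fin n) → K) :
    MvPolynomial (Fin n) K :=
  ∑ s : Sym2 (Fin n), C (c s) * (s.map X).mul

/-- Index set of the coefficients of a pair `(g, h)` of `n`-tuples of quadratic forms in `n`
variables: `(0, i, s)` belongs to `g i` and `(1, i, s)` to `h i`.  The coefficient space is
`CoeffIdx n → K`, of dimension `n² (n + 1)`. -/
abbrev CoeffIdx (n : ℕ) : Type := Fin 2 × Fin n × Sym2 (Fin n)

/-- The tuple `g` of the pair `(g, h)` with coefficient vector `v`. -/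
noncomputable def leftFactor {K : Type u} [Field K] {n : ℕ} (v : CoeffIdx n → K) :
    Fin n → MvPolynomial (Fin n) K :=
  fun i => quadForm fun s => v (0, i, s)

/-- The tuple `h` of the pair `(g, h)` with coefficient vector `v`. -/
noncomputable def rightFactor {K : Type u} [Field K] {n : ℕ} (v : CoeffIdx n → K) :
    Fin n → MvPolynomial (Fin n) K :=
  fun i => quadForm fun s => v (1, i, s)

/-! ## Probabilistic algebraic random access machines

Programs are finite objects that do not depend on the field or on the size of the input.  They work
on two kinds of memory cells, one kind holding natural numbers (used for addressing and control) and
one kind holding field elements.  Every cell has an address consisting of the number of an array and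
a list of indices.  Available at unit cost are addition and truncated subtraction of natural
numbers, the four field operations, drawing a random field element, and comparisons.
-/

/-- A reference to a cell, as it occurs in a program: the number of an array, and the numbers of the
natural number variables that hold the indices. -/
structure Ref where
  arr : ℕ
  idx : List ℕ

/-- Elementary instructions; the first argument is the destination. -/
inductive Instr where
  | natConst (d : Ref) (c : ℕ)
  | natAdd (d a b : Ref)
  | natSub (d a b : Ref)
  | fieldZero (d : Ref)
  | fieldOne (d : Ref)
  | fieldAdd (d a b : Ref)
  | fieldSub (d a b : Ref)
  | fieldMul (d a b : Ref)
  | fieldDiv (d a b : Ref)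
  | sample (d : Ref)

/-- Elementary tests. -/
inductive Cond where
  | natEq (a b : Ref)
  | natLt (a b : Ref)
  | fieldEq (a b : Ref)

/-- Programs. -/
inductive Prog where
  | skip
  | instr (c : Instr)
  | seq (p q : Prog)
  | ite (b : Cond) (p q : Prog)
  | loop (b : Cond) (p : Prog)

/-- A state of the machine: the contents of the cells, and the part of the random tape that has not
been read yet. -/
structure State (K : Type u) where
  nat : ℕ → List ℕ → ℕ
  field : ℕ → List ℕ → K
  tape : ℕ → K

namespace State

variable {K : Type u}

/-- The current values of the index variables of a reference; the natural number variable `v` is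
the cell of the array `v` with the empty list of indices. -/
def idx (σ : State K) (r : Ref) : List ℕ :=
  r.idx.map fun v => σ.nat v []

def getNat (σ : State K) (r : Ref) : ℕ :=
  σ.nat r.arr (σ.idx r)

def getField (σ : State K) (r : Ref) : K :=
  σ.field r.arr (σ.idx r)

def setNat (σ : State K) (r : Ref) (x : ℕ) : State K :=
  { σ with nat := fun a l => if a = r.arr ∧ l = σ.idx r then x else σ.nat a l }

def setField (σ : State K) (r : Ref) (x : K) : State K :=
  { σ with field := fun a l => if a = r.arr ∧ l = σ.idx r then x else σ.field a l }

end State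

/-- The effect of an elementary instruction.  Division by zero yields zero. -/
def Instr.exec {K : Type u} [Field K] (σ : State K) : Instr → State K
  | natConst d c => σ.setNat d c
  | natAdd d a b => σ.setNat d (σ.getNat a + σ.getNat b)
  | natSub d a b => σ.setNat d (σ.getNat a - σ.getNat b)
  | fieldZero d => σ.setField d 0
  | fieldOne d => σ.setField d 1
  | fieldAdd d a b => σ.setField d (σ.getField a + σ.getField b)
  | fieldSub d a b => σ.setField d (σ.getField a - σ.getField b)
  | fieldMul d a b => σ.setField d (σ.getField a * σ.getField b)
  | fieldDiv d a b => σ.setField d (σ.getField a / σ.getField b)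
  | sample d => { σ.setField d (σ.tape 0) with tape := fun k => σ.tape (k + 1) }

def Cond.Holds {K : Type u} (σ : State K) : Cond → Prop
  | natEq a b => σ.getNat a = σ.getNat b
  | natLt a b => σ.getNat a < σ.getNat b
  | fieldEq a b => σ.getField a = σ.getField b

/-- `Exec p σ t τ`: the program `p`, started in the state `σ`, halts after `t` steps in the state
`τ`.  Every elementary instruction and every test counts as one step. -/
inductive Exec {K : Type u} [Field K] : Prog → State K → ℕ → State K → Prop
  | skip (σ : State K) : Exec .skip σ 0 σ
  | instr (c : Instr) (σ : State K) : Exec (.instr c) σ 1 (c.exec σ)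
  | seq {p q : Prog} {σ τ υ : State K} {s t : ℕ} :
      Exec p σ s τ → Exec q τ t υ → Exec (.seq p q) σ (s + t) υ
  | iteTrue {b : Cond} {p q : Prog} {σ τ : State K} {t : ℕ} :
      b.Holds σ → Exec p σ t τ → Exec (.ite b p q) σ (t + 1) τ
  | iteFalse {b : Cond} {p q : Prog} {σ τ : State K} {t : ℕ} :
      ¬ b.Holds σ → Exec q σ t τ → Exec (.ite b p q) σ (t + 1) τ
  | loopTrue {b : Cond} {p : Prog} {σ τ υ : State K} {s t : ℕ} :
      b.Holds σ → Exec p σ s τ → Exec (.loop b p) τ t υ → Exec (.loop b p) σ (s + t + 1) υ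
  | loopFalse {b : Cond} {p : Prog} {σ : State K} :
      ¬ b.Holds σ → Exec (.loop b p) σ 1 σ

/-- For a fixed content of the random tape, a program has at most one halting computation. -/
theorem Exec.deterministic {K : Type u} [Field K] {p : Prog} {σ τ τ' : State K} {t t' : ℕ}
    (h : Exec p σ t τ) (h' : Exec p σ t' τ') : t = t' ∧ τ = τ' := by
  induction h generalizing t' τ' with
  | skip σ => cases h'; exact ⟨rfl, rfl⟩
  | instr c σ => cases h'; exact ⟨rfl, rfl⟩
  | seq _ _ ih₁ ih₂ =>
    cases h' with
    | seq a b =>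
      obtain ⟨rfl, rfl⟩ := ih₁ a
      obtain ⟨rfl, rfl⟩ := ih₂ b
      exact ⟨rfl, rfl⟩
  | iteTrue hb _ ih =>
    cases h' with
    | iteTrue _ a => obtain ⟨rfl, rfl⟩ := ih a; exact ⟨rfl, rfl⟩
    | iteFalse hb' _ => exact absurd hb hb'
  | iteFalse hb _ ih =>
    cases h' with
    | iteTrue hb' _ => exact absurd hb' hb
    | iteFalse _ a => obtain ⟨rfl, rfl⟩ := ih a; exact ⟨rfl, rfl⟩
  | loopTrue hb _ _ ih₁ ih₂ =>
    cases h' with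
    | loopTrue _ a b =>
      obtain ⟨rfl, rfl⟩ := ih₁ a
      obtain ⟨rfl, rfl⟩ := ih₂ b
      exact ⟨rfl, rfl⟩
    | loopFalse hb' => exact absurd hb hb'
  | loopFalse hb =>
    cases h' with
    | loopTrue hb' _ _ => exact absurd hb' hb
    | loopFalse _ => exact ⟨rfl, rfl⟩

/-! ## Input and output -/

/-- The coefficient table of a tuple of quartic forms: the entry `[i, a, b, c, d]` is the coefficient
of the monomial `x_a x_b x_c x_d` in `f_i`. -/
noncomputable def quarticTable {K : Type u} [Field K] {n : ℕ}
    (f : Fin n → MvPolynomial (Fin n) K) : List ℕ → K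
  | [i, a, b, c, d] =>
    if hyp : i < n ∧ a < n ∧ b < n ∧ c < n ∧ d < n then
      (f ⟨i, hyp.1⟩).coeff
        (Finsupp.single ⟨a, hyp.2.1⟩ 1 + Finsupp.single ⟨b, hyp.2.2.1⟩ 1 +
          Finsupp.single ⟨c, hyp.2.2.2.1⟩ 1 + Finsupp.single ⟨d, hyp.2.2.2.2⟩ 1)
    else 0
  | _ => 0

/-- The initial state on input `f` with random tape `ρ`: the natural number variable `0` holds `n`,
the field array `0` holds the coefficients of `f`, and all other cells are zero. -/
noncomputable def initState {K : Type u} [Field K] {n : ℕ}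
    (f : Fin n → MvPolynomial (Fin n) K) (ρ : ℕ → K) : State K where
  nat := fun a l => if a = 0 ∧ l = [] then n else 0
  field := fun a l => if a = 0 then quarticTable f l else 0
  tape := ρ

/-- A halting state in which the natural number variable `1` holds `1` announces a decomposition;
every other halting state announces failure. -/
def Announces {K : Type u} (τ : State K) : Prop :=
  τ.nat 1 [] = 1

/-- The tuple of quadratic forms written in the field array `m`: the coefficient of `x_a x_b`,
`a ≤ b`, in the `i`-th form is the entry `[i, a, b]`. -/
noncomputable def readForms {K : Type u} [Field K] (n m : ℕ) (τ : State K) :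
    Fin n → MvPolynomial (Fin n) K :=
  fun i => quadForm fun s => τ.field m [i, s.inf, s.sup]

/-- The left factor `g` in the output is read off from the field array `1`. -/
noncomputable def outputLeft {K : Type u} [Field K] (n : ℕ) (τ : State K) :
    Fin n → MvPolynomial (Fin n) K :=
  readForms n 1 τ

/-- The right factor `h` in the output is read off from the field array `2`. -/
noncomputable def outputRight {K : Type u} [Field K] (n : ℕ) (τ : State K) :
    Fin n → MvPolynomial (Fin n) K :=
  readForms n 2 τ

/-- A finite random tape, continued by zeros. -/
def extendTape {K : Type u} [Field K] {m : ℕ} (r : Fin m → K) : ℕ → K :=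
  fun k => if hk : k < m then r ⟨k, hk⟩ else 0

/-- On input `f` and with the random elements `r`, the program halts and outputs a decomposition
of `f`. -/
def Succeeds {K : Type u} [Field K] {n m : ℕ} (A : Prog)
    (f : Fin n → MvPolynomial (Fin n) K) (r : Fin m → K) : Prop :=
  ∃ (t : ℕ) (τ : State K), Exec A (initState f (extendTape r)) t τ ∧ Announces τ ∧
    IsQuadraticDecomposition f (outputLeft n τ) (outputRight n τ)

/-- The probability that the program, using at most `m` random elements, decomposes
`g ∘ h`, where the coefficients of the `n`-tuples of quadratic forms `g` and `h` and the random
elements are independent and uniformly distributed over the finite field `K`. -/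
noncomputable def successProb (K : Type u) [Field K] (n m : ℕ) (A : Prog) : ℝ :=
  (Nat.card {ω : (CoeffIdx n → K) × (Fin m → K) //
      Succeeds A (compose (leftFactor ω.1) (rightFactor ω.1)) ω.2} : ℝ) /
    (Nat.card ((CoeffIdx n → K) × (Fin m → K)) : ℝ)

end FDP

/-!
If `f = g ∘ h`, then by the chain rule all partial derivatives of the `f_i` lie in the space `V`
spanned by the products `x_k h_m`. For a generic pair `(g, h)` they span `V`, and the quadratic
forms `q` with all `x_k q` in `V` are the linear combinations of the `h_m`. Hence linear algebra
recovers from `f` first `V` and then the span of the `h_m`; any basis of this span is a right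
factor, and the left factor solves one more linear system. Solvability of that system certifies the
answer, so no wrong decomposition is ever announced, and no random elements are needed.

Genericity amounts to the injectivity of two matrices whose entries are polynomials in the
coefficients of `(g, h)`. Injectivity at a single pair gives a polynomial that is not identically
zero and off whose zeros the matrix is injective; explicit pairs are given over every field, and the
zeros over a finite field are counted by the Schwartz–Zippel lemma.
-/

namespace FDP

-- The memory of the program: variables, which are arrays of natural numbers used at the empty index
-- list only, then tables of natural numbers, then arrays of field elements.
local notation "sizeVar" => 0
local notation "flagVar" => 1
local notation "stepVar" => 2
local notation "iVar" => 3
local notation "jVar" => 4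
local notation "kVar" => 5
local notation "aVar" => 6
local notation "bVar" => 7
local notation "cVar" => 8
local notation "dVar" => 9
local notation "lVar" => 10
local notation "mVar" => 11
local notation "rowVar" => 12
local notation "colVar" => 13
local notation "pivotVar" => 14
local notation "countVar" => 15
local notation "functionalVar" => 16
local notation "indexVar" => 17
local notation "pairVar" => 18
local notation "pVar" => 19
local notation "qVar" => 20
local notation "rVar" => 21
local notation "sVar" => 22
local notation "keyVar" => 23
local notation "productKeyVar" => 24
local notation "sizeSqVar" => 25
local notation "sizeCubeVar" => 26
local notation "relationSizeVar" => 27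
local notation "zeroVar" => 28
local notation "powerVar" => 29

local notation "multTable" => 30
local notation "sqMultTable" => 31
local notation "powTable" => 32

local notation "inputArr" => 0
local notation "leftArr" => 1
local notation "rightArr" => 2
local notation "equationArr" => 3
local notation "valueArr" => 4
local notation "pivotArr" => 5
local notation "zeroArr" => 6
local notation "productArr" => 7
local notation "quotientArr" => 8
local notation "sumArr" => 9
local notation "annihilatorArr" => 10
local notation "quotientFormArr" => 11
local notation "relationArr" => 12

/-! ### Bounded loops -/

/-- Commands whose only loops are counting loops: `rep v u p` runs `p` with the natural number
variable `v` equal to `0, 1, …` as long as it is below the value of the variable `u`. They have a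
denotation by structural recursion, and their running time is bounded syntactically. -/
inductive Cmd where
  | skip
  | instr (c : Instr)
  | seq (p q : Cmd)
  | ite (b : Cond) (p q : Cmd)
  | rep (v u : ℕ) (p : Cmd)

/-- The natural number arrays an instruction writes to. -/
@[simp] def Instr.natWrites : Instr → List ℕ
  | natConst d _ => [d.arr]
  | natAdd d _ _ => [d.arr]
  | natSub d _ _ => [d.arr]
  | _ => []

/-- The field arrays an instruction writes to. -/
@[simp] def Instr.fieldWrites : Instr → List ℕ
  | fieldZero d => [d.arr]
  | fieldOne d => [d.arr]
  | fieldAdd d _ _ => [d.arr]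
  | fieldSub d _ _ => [d.arr]
  | fieldMul d _ _ => [d.arr]
  | fieldDiv d _ _ => [d.arr]
  | sample d => [d.arr]
  | _ => []

namespace Cmd

/-- The reference to the natural number variable, or to the single field cell, number `v`. -/
abbrev var (v : ℕ) : Ref := ⟨v, []⟩

/-- The program that increments the counter `v`; `stepVar` serves as a scratch cell. -/
def incr (v : ℕ) : Prog :=
  .seq (.instr (.natConst (var stepVar) 1)) (.instr (.natAdd (var v) (var v) (var stepVar)))

/-- The translation of commands into programs. -/
def compile : Cmd → Prog
  | skip => .skip
  | instr c => .instr c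
  | seq p q => .seq p.compile q.compile
  | ite b p q => .ite b p.compile q.compile
  | rep v u p =>
    .seq (.instr (.natConst (var v) 0))
      (.loop (.natLt (var v) (var u)) (.seq p.compile (incr v)))

/-- The natural number arrays a command writes to. -/
@[simp] def natWrites : Cmd → List ℕ
  | skip => []
  | instr c => c.natWrites
  | seq p q => p.natWrites ++ q.natWrites
  | ite _ p q => p.natWrites ++ q.natWrites
  | rep v _ p => v :: stepVar :: p.natWrites

/-- The field arrays a command writes to. -/
@[simp] def fieldWrites : Cmd → List ℕ
  | skip => []
  | instr c => c.fieldWrites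
  | seq p q => p.fieldWrites ++ q.fieldWrites
  | ite _ p q => p.fieldWrites ++ q.fieldWrites
  | rep _ _ p => p.fieldWrites

/-- The variables that bound the loops of a command. -/
def bounds : Cmd → List ℕ
  | skip => []
  | instr _ => []
  | seq p q => p.bounds ++ q.bounds
  | ite _ p q => p.bounds ++ q.bounds
  | rep _ u p => u :: p.bounds

/-- No loop body changes the counter of its loop. -/
def CountersSafe : Cmd → Prop
  | skip => True
  | instr _ => True
  | seq p q => p.CountersSafe ∧ q.CountersSafe
  | ite _ p q => p.CountersSafe ∧ q.CountersSafe
  | rep v _ p => v ≠ stepVar ∧ v ∉ p.natWrites ∧ p.CountersSafe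

instance decidableCountersSafe : (c : Cmd) → Decidable c.CountersSafe
  | skip => .isTrue trivial
  | instr _ => .isTrue trivial
  | seq p q =>
    have := decidableCountersSafe p
    have := decidableCountersSafe q
    inferInstanceAs (Decidable (_ ∧ _))
  | ite _ p q =>
    have := decidableCountersSafe p
    have := decidableCountersSafe q
    inferInstanceAs (Decidable (_ ∧ _))
  | rep _ _ p =>
    have := decidableCountersSafe p
    inferInstanceAs (Decidable (_ ∧ _ ∧ _))

/-- A bound for the running time of a command, as a polynomial in a bound for its loop bounds. -/
noncomputable def costPoly : Cmd → Polynomial ℕ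
  | skip => 0
  | instr _ => 1
  | seq p q => p.costPoly + q.costPoly
  | ite _ p q => p.costPoly + q.costPoly + 1
  | rep _ _ p => 2 + Polynomial.X * (p.costPoly + 3)

section Frame

variable {K : Type u} {c d : Cmd} {σ τ υ : State K}

/-- `τ` differs from `σ` only in arrays the command `c` writes to. -/
structure Frame (c : Cmd) (σ τ : State K) : Prop where
  nat : ∀ a, a ∉ c.natWrites → τ.nat a = σ.nat a
  field : ∀ a, a ∉ c.fieldWrites → τ.field a = σ.field a

theorem Frame.refl (c : Cmd) (σ : State K) : Frame c σ σ := ⟨fun _ _ => rfl, fun _ _ => rfl⟩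

theorem Frame.trans (h : Frame c σ τ) (h' : Frame c τ υ) : Frame c σ υ :=
  ⟨fun a ha => (h'.nat a ha).trans (h.nat a ha), fun a ha => (h'.field a ha).trans (h.field a ha)⟩

theorem Frame.mono (h : Frame c σ τ) (hn : c.natWrites ⊆ d.natWrites)
    (hf : c.fieldWrites ⊆ d.fieldWrites) : Frame d σ τ :=
  ⟨fun a ha => h.nat a fun h' => ha (hn h'), fun a ha => h.field a fun h' => ha (hf h')⟩

theorem Frame.setNat (h : Frame c σ τ) {r : Ref} {x : ℕ} (hr : r.arr ∈ c.natWrites) :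
    Frame c σ (τ.setNat r x) := by
  refine ⟨fun a ha => ?_, h.field⟩
  have hne : a ≠ r.arr := ne_of_mem_of_not_mem hr ha |>.symm
  rw [← h.nat a ha]
  simp only [State.setNat, hne, false_and, if_false]

end Frame

section Semantics

variable {K : Type u}

/-- The state after `k` rounds of a loop with the counter `v` and the given effect of its body. -/
def loopState (body : State K → State K) (v : ℕ) (σ : State K) : ℕ → State K
  | 0 => σ.setNat (var v) 0
  | k + 1 => ((body (loopState body v σ k)).setNat (var stepVar) 1).setNat (var v) (k + 1)

theorem loopState_nat_counter (body : State K → State K) (v : ℕ) (σ : State K) (k : ℕ) :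
    (loopState body v σ k).nat v [] = k := by
  cases k <;> simp [loopState, State.setNat, State.idx]

variable [Field K]

open Classical in
/-- The state transformation computed by a command. -/
noncomputable def den : Cmd → State K → State K
  | skip, σ => σ
  | instr c, σ => c.exec σ
  | seq p q, σ => q.den (p.den σ)
  | ite b p q, σ => if b.Holds σ then p.den σ else q.den σ
  | rep v u p, σ => loopState p.den v σ (σ.nat u [])

theorem frame_instr (c : Instr) (σ : State K) : Frame (instr c) σ (c.exec σ) := by
  constructor <;> intro a ha <;> funext l <;> cases c <;>
    simp_all [Instr.exec, State.setNat, State.setField, natWrites, fieldWrites, Instr.natWrites,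
      Instr.fieldWrites]

theorem frame_loopState {p : Cmd} (hp : ∀ σ : State K, Frame p σ (p.den σ)) (v u : ℕ)
    (σ : State K) (k : ℕ) : Frame (rep v u p) σ (loopState p.den v σ k) := by
  have hv : v ∈ (rep v u p).natWrites := by simp [natWrites]
  have hstep : stepVar ∈ (rep v u p).natWrites := by simp [natWrites]
  induction k with
  | zero => exact (Frame.refl _ _).setNat hv
  | succ k ih =>
    have body := (hp (loopState p.den v σ k)).mono (d := rep v u p)
      (fun a ha => by simp [natWrites, ha]) (List.Subset.refl _)
    exact ((ih.trans body).setNat hstep).setNat hv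

theorem frame_den (c : Cmd) (σ : State K) : Frame c σ (c.den σ) := by
  induction c generalizing σ with
  | skip => exact Frame.refl _ _
  | instr c => exact frame_instr c σ
  | seq p q ihp ihq =>
    exact ((ihp σ).mono (by simp [natWrites]) (by simp [fieldWrites])).trans
      ((ihq _).mono (by simp [natWrites]) (by simp [fieldWrites]))
  | ite b p q ihp ihq =>
    rw [den]
    split_ifs
    · exact (ihp σ).mono (by simp [natWrites]) (by simp [fieldWrites])
    · exact (ihq σ).mono (by simp [natWrites]) (by simp [fieldWrites])
  | rep v u p ih => exact frame_loopState ih v u σ _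

theorem den_rep_induction {v u : ℕ} {p : Cmd} {σ : State K} (I : ℕ → State K → Prop)
    (stable : ∀ k τ x y, I k τ → I k ((τ.setNat (var stepVar) x).setNat (var v) y))
    (stable₀ : ∀ y, I 0 σ → I 0 (σ.setNat (var v) y)) (init : I 0 σ)
    (step : ∀ k τ, k < σ.nat u [] → τ.nat v [] = k → Frame (rep v u p) σ τ → I k τ →
      I (k + 1) (p.den τ)) :
    I (σ.nat u []) ((rep v u p).den σ) := by
  suffices h : ∀ m ≤ σ.nat u [], I m (loopState p.den v σ m) from h _ le_rfl
  intro m hm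
  induction m with
  | zero => exact stable₀ _ init
  | succ k ih =>
    exact stable _ _ _ _ (step k _ hm (loopState_nat_counter _ _ _ _)
      (frame_loopState (frame_den p) v u σ k) (ih (k.le_succ.trans hm)))

end Semantics

section Compile

variable {K : Type u} [Field K]

theorem exec_incr {v : ℕ} (hv : v ≠ stepVar) (σ : State K) :
    Exec (incr v) σ 2 ((σ.setNat (var stepVar) 1).setNat (var v) (σ.nat v [] + 1)) := by
  have h := Exec.seq (Exec.instr (.natConst (var stepVar) 1) σ)
    (Exec.instr (.natAdd (var v) (var v) (var stepVar)) _)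
  simpa [incr, Instr.exec, State.getNat, State.setNat, State.idx, hv] using h

theorem exec_loop {p : Cmd} {v u : ℕ} {σ : State K} (hv : v ≠ stepVar) (hvp : v ∉ p.natWrites)
    (hu : u ∉ (rep v u p).natWrites) {C : ℕ}
    (body : ∀ k, ∃ t ≤ C, Exec p.compile (loopState p.den v σ k) t
      (p.den (loopState p.den v σ k))) :
    ∀ k ≤ σ.nat u [], ∃ t ≤ 1 + k * (C + 3),
      Exec (.loop (.natLt (var v) (var u)) (.seq p.compile (incr v)))
        (loopState p.den v σ (σ.nat u [] - k)) t (loopState p.den v σ (σ.nat u [])) := by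
  have test : ∀ k, (Cond.natLt (var v) (var u)).Holds (loopState p.den v σ k) ↔
      k < σ.nat u [] := fun k => by
    rw [← (frame_loopState (frame_den p) v u σ k).nat u hu]
    simp only [Cond.Holds, State.getNat, State.idx, List.map_nil, loopState_nat_counter]
  intro k hk
  induction k with
  | zero => exact ⟨1, by simp, .loopFalse (by simp [test])⟩
  | succ k ih =>
    obtain ⟨t, ht, rest⟩ := ih (k.le_succ.trans hk)
    obtain ⟨s, hs, hps⟩ := body (σ.nat u [] - (k + 1))
    have round := Exec.seq hps (exec_incr hv _)
    rw [(frame_den p _).nat v hvp, loopState_nat_counter] at round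
    rw [show σ.nat u [] - k = σ.nat u [] - (k + 1) + 1 by omega] at rest
    refine ⟨s + 2 + t + 1, ?_, .loopTrue ((test _).2 (by omega)) round rest⟩
    rw [add_mul]
    omega

theorem exec_compile (c : Cmd) (hc : c.CountersSafe) (hb : ∀ u ∈ c.bounds, u ∉ c.natWrites)
    (B : ℕ) (σ : State K) (hB : ∀ u ∈ c.bounds, σ.nat u [] ≤ B) :
    ∃ t ≤ c.costPoly.eval B, Exec c.compile σ t (c.den σ) := by
  induction c generalizing σ with
  | skip => exact ⟨0, by simp, .skip σ⟩
  | instr c => exact ⟨1, by simp [costPoly], .instr c σ⟩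
  | seq p q ihp ihq =>
    simp only [bounds, natWrites, List.mem_append, not_or] at hb hB
    obtain ⟨s, hs, hps⟩ := ihp hc.1 (fun u hu => (hb u (.inl hu)).1) σ fun u hu => hB u (.inl hu)
    obtain ⟨t, ht, hqt⟩ := ihq hc.2 (fun u hu => (hb u (.inr hu)).2) (p.den σ) fun u hu => by
      rw [(frame_den p σ).nat u (hb u (.inr hu)).1]
      exact hB u (.inr hu)
    exact ⟨s + t, by simpa [costPoly] using add_le_add hs ht, .seq hps hqt⟩
  | ite b p q ihp ihq =>
    simp only [bounds, natWrites, List.mem_append, not_or] at hb hB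
    obtain ⟨s, hs, hps⟩ := ihp hc.1 (fun u hu => (hb u (.inl hu)).1) σ fun u hu => hB u (.inl hu)
    obtain ⟨t, ht, hqt⟩ := ihq hc.2 (fun u hu => (hb u (.inr hu)).2) σ fun u hu => hB u (.inr hu)
    simp only [costPoly, Polynomial.eval_add, Polynomial.eval_one, den]
    split_ifs with h
    · exact ⟨s + 1, by omega, .iteTrue h hps⟩
    · exact ⟨t + 1, by omega, .iteFalse h hqt⟩
  | rep v u p ih =>
    obtain ⟨hv, hvp, hp⟩ := hc
    have hw : ∀ w ∈ p.bounds, w ∉ (rep v u p).natWrites := fun w h => hb w (by simp [bounds, h])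
    have body := fun k => ih hp (fun w h => by have := hw w h; simp_all [natWrites])
      (loopState p.den v σ k) fun w h => by
        rw [(frame_loopState (frame_den p) v u σ k).nat w (hw w h)]
        exact hB w (by simp [bounds, h])
    obtain ⟨t, ht, he⟩ := exec_loop hv hvp (hb u (by simp [bounds])) body _ le_rfl
    rw [Nat.sub_self] at he
    refine ⟨1 + t, ?_, .seq (.instr _ _) he⟩
    have := Nat.mul_le_mul_right (p.costPoly.eval B + 3) (hB u (by simp [bounds]))
    simp only [costPoly, Polynomial.eval_add, Polynomial.eval_mul, Polynomial.eval_X,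
      Polynomial.eval_ofNat]
    omega

end Compile
end Cmd

local notation:60 p:61 ";;" q:60 => Cmd.seq p q

namespace Cmd

/-- Nested loops with the counters `vs` and the common bound `u`. -/
def reps (vs : List ℕ) (u : ℕ) (p : Cmd) : Cmd :=
  vs.foldr (fun v c => rep v u c) p

@[simp] theorem fieldWrites_reps (vs : List ℕ) (u : ℕ) (p : Cmd) :
    (reps vs u p).fieldWrites = p.fieldWrites := by
  induction vs with
  | nil => rfl
  | cons _ _ ih => exact ih

@[simp] theorem mem_natWrites_reps {vs : List ℕ} {u : ℕ} {p : Cmd} {a : ℕ} :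
    a ∈ (reps vs u p).natWrites ↔ (a ∈ vs ∨ vs ≠ [] ∧ a = stepVar) ∨ a ∈ p.natWrites := by
  induction vs with
  | nil => simp [reps]
  | cons v vs ih =>
    change a ∈ v :: stepVar :: (reps vs u p).natWrites ↔ _
    simp only [List.mem_cons, ih, ne_eq, reduceCtorEq, not_false_eq_true, true_and]
    tauto

/-- The counters of nested loops and their bound are different, and the body changes none of
them. -/
def NestSafe (vs : List ℕ) (u : ℕ) (p : Cmd) : Prop :=
  vs.Nodup ∧ (∀ v ∈ vs, v ≠ stepVar ∧ v ≠ u ∧ v ∉ p.natWrites) ∧ u ≠ stepVar ∧ u ∉ p.natWrites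

instance (vs : List ℕ) (u : ℕ) (p : Cmd) : Decidable (NestSafe vs u p) :=
  inferInstanceAs (Decidable (_ ∧ _))

theorem NestSafe.tail {v u : ℕ} {vs : List ℕ} {p : Cmd} (h : NestSafe (v :: vs) u p) :
    NestSafe vs u p :=
  ⟨h.1.of_cons, fun w hw => h.2.1 w (List.mem_cons_of_mem _ hw), h.2.2⟩

theorem NestSafe.head_notMem_natWrites {v u : ℕ} {vs : List ℕ} {p : Cmd}
    (h : NestSafe (v :: vs) u p) : v ∉ (reps vs u p).natWrites := by
  have := h.2.1 v (by simp)
  have := (List.nodup_cons.1 h.1).1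
  rw [mem_natWrites_reps]
  tauto

theorem NestSafe.bound_notMem_natWrites {u : ℕ} {vs : List ℕ} {p : Cmd} (h : NestSafe vs u p) :
    u ∉ (reps vs u p).natWrites := by
  have hu : u ∉ vs := fun hu => (h.2.1 u hu).2.1 rfl
  have := h.2.2
  rw [mem_natWrites_reps]
  tauto

/-- The lists of length `d` with entries below `m`. -/
def box (m : ℕ) : ℕ → Finset (List ℕ)
  | 0 => {[]}
  | d + 1 => (Finset.range m ×ˢ box m d).image fun x => x.1 :: x.2

theorem mem_box {m d : ℕ} {l : List ℕ} : l ∈ box m d ↔ l.length = d ∧ ∀ x ∈ l, x < m := by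
  induction d generalizing l with
  | zero => simp +contextual [box]
  | succ d ih =>
    cases l with
    | nil => simp [box]
    | cons a l => simp [box, ih]; tauto

theorem cons_mem_box {m d a : ℕ} {l : List ℕ} : a :: l ∈ box m (d + 1) ↔ a < m ∧ l ∈ box m d := by
  simp [box]

theorem sum_box_succ {M : Type*} [AddCommMonoid M] (m d : ℕ) (F : List ℕ → M) :
    ∑ t ∈ box m (d + 1), F t = ∑ a ∈ Finset.range m, ∑ t ∈ box m d, F (a :: t) := by
  rw [box, Finset.sum_image (by rintro ⟨a, s⟩ _ ⟨b, t⟩ _ h; simpa using h),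
    Finset.sum_product]

theorem sum_box_zero {M : Type*} [AddCommMonoid M] (m : ℕ) (F : List ℕ → M) :
    ∑ t ∈ box m 0, F t = F [] := by
  simp [box]

/-- The lists of length `d + 1` whose first entry is below `k` and whose other entries are below
`m`: what a nest of loops has processed after `k` rounds of the outermost loop. -/
def slab (m d k : ℕ) : Finset (List ℕ) :=
  (Finset.range k ×ˢ box m d).image fun x => x.1 :: x.2

theorem slab_zero (m d : ℕ) : slab m d 0 = ∅ := by
  simp [slab]

theorem cons_mem_slab {m d k a : ℕ} {l : List ℕ} : a :: l ∈ slab m d k ↔ a < k ∧ l ∈ box m d := by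
  simp [slab]

theorem slab_succ (m d k : ℕ) : slab m d (k + 1) = slab m d k ∪ (box m d).image (k :: ·) := by
  ext l
  cases l with
  | nil => simp [slab]
  | cons a l => simp [slab, le_iff_lt_or_eq, or_and_right, and_comm, eq_comm]

theorem slab_union_subset_box {m d k : ℕ} (hk : k < m) {P : Finset (List ℕ)} (hP : P ⊆ box m d) :
    slab m d k ∪ P.image (k :: ·) ⊆ box m (d + 1) :=
  Finset.union_subset (Finset.image_subset_image (Finset.product_subset_product_left
      (Finset.range_subset_range.2 hk.le)))
    (Finset.image_subset_iff.2 fun _ hl => cons_mem_box.2 ⟨hk, hP hl⟩)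

section NestedLoops

variable {K : Type u} [Field K] {vs : List ℕ} {u : ℕ} {p : Cmd} {σ : State K}

theorem den_reps_induction (safe : NestSafe vs u p) (I : Finset (List ℕ) → State K → Prop)
    (stable : ∀ P τ v x, v ∈ vs ∨ v = stepVar → I P τ → I P (τ.setNat (var v) x))
    (init : I ∅ σ)
    (step : ∀ t ∈ box (σ.nat u []) vs.length, ∀ P ⊆ box (σ.nat u []) vs.length, t ∉ P → ∀ τ,
      vs.map (fun v => τ.nat v []) = t → Frame (reps vs u p) σ τ → I P τ →
      I (insert t P) (p.den τ)) :
    I (box (σ.nat u []) vs.length) ((reps vs u p).den σ) := by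
  induction vs generalizing σ I with
  | nil => exact step [] (by simp [box]) ∅ (by simp) (by simp) σ rfl (Frame.refl _ _) init
  | cons v vs ih =>
    set m := σ.nat u []
    have stable_tail := fun P τ w x (hw : w ∈ vs ∨ w = stepVar) =>
      stable P τ w x (hw.imp_left (List.mem_cons_of_mem _))
    refine den_rep_induction (fun k => I (slab m vs.length k))
      (fun k τ x y h => stable _ _ _ _ (.inl (by simp)) (stable _ _ _ _ (.inr rfl) h))
      (fun y h => stable _ _ _ _ (.inl (by simp)) h) (by rwa [slab_zero]) ?_
    intro k τ hk hτv hτF hI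
    have hτu : τ.nat u [] = m := congrFun (hτF.nat u safe.bound_notMem_natWrites) []
    rw [slab_succ, ← hτu]
    refine ih safe.tail (fun P => I (slab (τ.nat u []) vs.length k ∪ P.image (k :: ·)))
      (fun P => stable_tail _) (by simpa [hτu] using hI) ?_
    rw [hτu]
    intro t ht P hP htP υ hυ hυF hIυ
    have hυF' : Frame (reps (v :: vs) u p) σ υ :=
      hτF.trans (hυF.mono (fun a ha => .tail _ (.tail _ ha)) (List.Subset.refl _))
    have hυt : (v :: vs).map (fun v => υ.nat v []) = k :: t := by
      rw [List.map_cons, hυ, hυF.nat v safe.head_notMem_natWrites, hτv]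
    have := step (k :: t) (cons_mem_box.2 ⟨hk, ht⟩) _ (slab_union_subset_box hk hP)
      (by simpa [cons_mem_slab] using htP) υ hυt hυF' hIυ
    simpa only [Finset.image_insert, Finset.union_insert] using this

/-- The form of `den_reps_induction` for loops whose rounds do not interact: the round for the
counters `t` turns the property `U t` into `Q t`, and the other rounds preserve both. -/
theorem den_reps_forall (safe : NestSafe vs u p) (U Q : List ℕ → State K → Prop)
    (stable : ∀ t τ v x, v ∈ vs ∨ v = stepVar →
      (U t τ → U t (τ.setNat (var v) x)) ∧ (Q t τ → Q t (τ.setNat (var v) x)))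
    (init : ∀ t ∈ box (σ.nat u []) vs.length, U t σ)
    (step : ∀ t ∈ box (σ.nat u []) vs.length, ∀ τ, vs.map (fun v => τ.nat v []) = t →
      Frame (reps vs u p) σ τ →
        (U t τ → Q t (p.den τ)) ∧ ∀ s ≠ t, (U s τ → U s (p.den τ)) ∧ (Q s τ → Q s (p.den τ))) :
    ∀ t ∈ box (σ.nat u []) vs.length, Q t ((reps vs u p).den σ) := by
  have main := den_reps_induction (σ := σ) safe
    (fun P τ => ∀ t ∈ box (σ.nat u []) vs.length, (t ∈ P → Q t τ) ∧ (t ∉ P → U t τ))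
    (fun P τ v x hv h t ht => ⟨fun htP => (stable t τ v x hv).2 ((h t ht).1 htP),
      fun htP => (stable t τ v x hv).1 ((h t ht).2 htP)⟩)
    (fun t ht => ⟨by simp, fun _ => init t ht⟩) ?_
  · exact fun t ht => (main t ht).1 ht
  intro t ht P _ htP τ hτ hF h s hs
  obtain ⟨new, old⟩ := step t ht τ hτ hF
  rcases eq_or_ne s t with rfl | hst
  · exact ⟨fun _ => new ((h s hs).2 htP), fun hs' => absurd (Finset.mem_insert_self _ _) hs'⟩
  · rw [Finset.mem_insert, or_iff_right hst]
    exact ⟨fun hsP => (old s hst).2 ((h s hs).1 hsP), fun hsP => (old s hst).1 ((h s hs).2 hsP)⟩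

theorem den_reps_sum {M : Type*} [AddCommMonoid M] (safe : NestSafe vs u p) (z : State K → M)
    (F : List ℕ → M)
    (stable : ∀ τ v x, v ∈ vs ∨ v = stepVar → z (τ.setNat (var v) x) = z τ)
    (step : ∀ t ∈ box (σ.nat u []) vs.length, ∀ τ, vs.map (fun v => τ.nat v []) = t →
      Frame (reps vs u p) σ τ → z (p.den τ) = z τ + F t) :
    z ((reps vs u p).den σ) = z σ + ∑ t ∈ box (σ.nat u []) vs.length, F t := by
  refine den_reps_induction (σ := σ) safe (fun P τ => z τ = z σ + ∑ t ∈ P, F t)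
    (fun P τ v x hv h => (stable τ v x hv).trans h) (by simp) ?_
  intro t ht P _ htP τ hτ hF h
  rw [step t ht τ hτ hF, h, Finset.sum_insert htP, add_assoc, add_comm (F t)]

end NestedLoops

end Cmd

/-! ### Linear systems in row echelon form -/

section Elimination

open Finset

variable {K : Type u} [Field K]

/-- The pairing of the first `C` coordinates of two sequences. The program stores vectors in arrays
without a length, so vectors of length `C` are encoded as sequences whose other entries are
ignored. -/
def dot (C : ℕ) (x y : ℕ → K) : K := ∑ c ∈ range C, x c * y c

theorem dot_congr {C : ℕ} {x x' y y' : ℕ → K} (hx : ∀ c < C, x c = x' c)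
    (hy : ∀ c < C, y c = y' c) : dot C x y = dot C x' y' :=
  sum_congr rfl fun c hc => by rw [hx c (mem_range.1 hc), hy c (mem_range.1 hc)]

theorem dot_comm (C : ℕ) (x y : ℕ → K) : dot C x y = dot C y x :=
  sum_congr rfl fun _ _ => mul_comm _ _

theorem dot_eq_zero_of_right {C : ℕ} {x y : ℕ → K} (hy : ∀ c < C, y c = 0) : dot C x y = 0 :=
  sum_eq_zero fun c hc => by rw [hy c (mem_range.1 hc), mul_zero]

theorem dot_sub_smul (C : ℕ) (x y z : ℕ → K) (a : K) :
    dot C x (fun c => y c - a * z c) = dot C x y - a * dot C x z := by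
  simp only [dot, mul_sub, sum_sub_distrib, mul_sum, mul_left_comm]

theorem dot_sum {ι : Type*} (C : ℕ) (x : ℕ → K) (S : Finset ι) (a : ι → K) (N : ι → ℕ → K) :
    dot C x (fun c => ∑ s ∈ S, a s * N s c) = ∑ s ∈ S, a s * dot C x (N s) := by
  simp only [dot, mul_sum, mul_left_comm]
  exact sum_comm

theorem exists_dual_eq_dot (C : ℕ) (φ : (Fin C → K) →ₗ[K] K) :
    ∃ y : ℕ → K, ∀ x : ℕ → K, φ (fun c => x c) = dot C x y := by
  refine ⟨fun c => if hc : c < C then φ (Pi.single ⟨c, hc⟩ 1) else 0, fun x => ?_⟩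
  rw [LinearMap.pi_apply_eq_sum_univ, dot, ← Fin.sum_univ_eq_sum_range (fun c => x c * _)]
  refine sum_congr rfl fun c _ => ?_
  simp only [smul_eq_mul, c.isLt, dite_true]
  congr 2
  ext j
  simp [Pi.single_apply, eq_comm]

/-- `N` represents the space of solutions of the equations `rows` in `C` unknowns: the vectors
`N s`, for `s` in a set `S` of free unknowns, form a basis that is dual to the coordinates in `S`,
and all other `N s` vanish. -/
structure KernelBasis (C : ℕ) (N : ℕ → ℕ → K) (S : Finset ℕ) (rows : Set (ℕ → K)) : Prop where
  sub : S ⊆ range C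
  solves : ∀ x ∈ rows, ∀ s < C, dot C x (N s) = 0
  spans : ∀ y : ℕ → K, (∀ x ∈ rows, dot C x y = 0) → ∀ c < C, y c = ∑ s ∈ S, y s * N s c
  dual : ∀ s ∈ S, ∀ t ∈ S, N s t = if s = t then 1 else 0
  zero : ∀ s < C, s ∉ S → ∀ c < C, N s c = 0

/-- `p` is the last index below `C` at which `v` does not vanish; if there is none, `p` is any index
below `C` after which `v` vanishes. -/
structure IsPivot (C : ℕ) (v : ℕ → K) (p : ℕ) : Prop where
  lt : p < C
  last : ∀ s < C, p < s → v s = 0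
  ne : v p = 0 → ∀ s < C, v s = 0

theorem IsPivot.congr {C : ℕ} {v w : ℕ → K} {p : ℕ} (h : IsPivot C v p)
    (hvw : ∀ s < C, v s = w s) : IsPivot C w p where
  lt := h.lt
  last s hs hps := (hvw s hs).symm.trans (h.last s hs hps)
  ne hp s hs := (hvw s hs).symm.trans (h.ne ((hvw p h.lt).trans hp) s hs)

namespace KernelBasis

theorem initial {C : ℕ} {N : ℕ → ℕ → K} (h : ∀ s < C, ∀ c < C, N s c = if s = c then 1 else 0) :
    KernelBasis C N (range C) ∅ where
  sub := Subset.refl _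
  solves := by simp
  spans y _ c hc := by
    rw [sum_eq_single_of_mem c (mem_range.2 hc)]
    · simp [h c hc c hc]
    · intro s hs hsc
      simp [h s (mem_range.1 hs) c hc, hsc]
  dual s hs t ht := h s (mem_range.1 hs) t (mem_range.1 ht)
  zero s hs hs' := absurd (mem_range.2 hs) hs'

variable {C : ℕ} {N N' : ℕ → ℕ → K} {S : Finset ℕ} {rows : Set (ℕ → K)} {x : ℕ → K} {p : ℕ}

theorem mem_iff (h : KernelBasis C N S rows) {s : ℕ} (hs : s < C) : s ∈ S ↔ N s s ≠ 0 := by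
  constructor
  · intro hS; simp [h.dual s hS s hS]
  · intro hN; by_contra hS; exact hN (h.zero s hs hS s hs)

theorem lt_of_mem (h : KernelBasis C N S rows) {s : ℕ} (hs : s ∈ S) : s < C :=
  mem_range.1 (h.sub hs)

theorem dot_of_notMem (h : KernelBasis C N S rows) (x : ℕ → K) {s : ℕ} (hs : s < C) (hS : s ∉ S) :
    dot C x (N s) = 0 :=
  dot_eq_zero_of_right (h.zero s hs hS)

theorem dot_eq (h : KernelBasis C N S rows) {y : ℕ → K} (hy : ∀ x ∈ rows, dot C x y = 0)
    (x : ℕ → K) : dot C x y = ∑ s ∈ S, y s * dot C x (N s) := by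
  rw [← dot_sum]
  exact dot_congr (fun _ _ => rfl) (h.spans y hy)

theorem congr (h : KernelBasis C N S rows) (hN : ∀ s < C, ∀ c < C, N' s c = N s c) :
    KernelBasis C N' S rows where
  sub := h.sub
  solves z hz s hs := (dot_congr (fun _ _ => rfl) (hN s hs)).trans (h.solves z hz s hs)
  spans y hy c hc := by
    rw [h.spans y hy c hc]
    exact sum_congr rfl fun s hs => by rw [hN s (h.lt_of_mem hs) c hc]
  dual s hs t ht := (hN s (h.lt_of_mem hs) t (h.lt_of_mem ht)).trans (h.dual s hs t ht)
  zero s hs hS c hc := (hN s hs c hc).trans (h.zero s hs hS c hc)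

theorem insert_orthogonal (h : KernelBasis C N S rows) (hx : ∀ s < C, dot C x (N s) = 0) :
    KernelBasis C N S (insert x rows) where
  sub := h.sub
  solves := by
    rintro z (rfl | hz)
    · exact hx
    · exact h.solves z hz
  spans y hy := h.spans y fun z hz => hy z (.inr hz)
  dual := h.dual
  zero := h.zero

theorem sum_mul_pivot (h : KernelBasis C N S rows) (hp : p ∈ S) (hxp : dot C x (N p) ≠ 0)
    {y : ℕ → K} (hy : ∀ z ∈ insert x rows, dot C z y = 0) :
    y p = -∑ s ∈ S.erase p, y s * (dot C x (N s) / dot C x (N p)) := by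
  have hxy : ∑ s ∈ S, y s * dot C x (N s) = 0 := by
    rw [← h.dot_eq (fun z hz => hy z (.inr hz)), hy x (.inl rfl)]
  rw [← add_sum_erase _ _ hp] at hxy
  simp only [← mul_div_assoc, ← sum_div]
  rw [eq_comm, ← neg_div, div_eq_iff hxp]
  exact (eq_neg_of_add_eq_zero_left hxy).symm

theorem eliminate (h : KernelBasis C N S rows) (hp : p < C) (hxp : dot C x (N p) ≠ 0)
    (hN' : ∀ s < C, ∀ c < C, N' s c = N s c - dot C x (N s) / dot C x (N p) * N p c) :
    KernelBasis C N' (S.erase p) (insert x rows) := by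
  have hpS : p ∈ S := by_contra fun hS => hxp (h.dot_of_notMem x hp hS)
  have hdot : ∀ z, ∀ s < C, dot C z (N' s) =
      dot C z (N s) - dot C x (N s) / dot C x (N p) * dot C z (N p) := fun z s hs => by
    rw [← dot_sub_smul]
    exact dot_congr (fun _ _ => rfl) (hN' s hs)
  refine ⟨(erase_subset _ _).trans h.sub, ?_, ?_, ?_, ?_⟩
  · rintro z (rfl | hz) s hs
    · rw [hdot _ s hs, div_mul_cancel₀ _ hxp, sub_self]
    · rw [hdot _ s hs, h.solves z hz s hs, h.solves z hz p hp, mul_zero, sub_zero]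
  · intro y hy c hc
    rw [h.spans y (fun z hz => hy z (.inr hz)) c hc, ← add_sum_erase _ _ hpS,
      h.sum_mul_pivot hpS hxp hy, neg_mul, sum_mul, ← sum_neg_distrib, ← sum_add_distrib]
    refine sum_congr rfl fun s hs => ?_
    rw [hN' s (h.lt_of_mem (mem_of_mem_erase hs)) c hc]
    ring
  · intro s hs t ht
    have hsS := mem_of_mem_erase hs
    have htS := mem_of_mem_erase ht
    rw [hN' s (h.lt_of_mem hsS) t (h.lt_of_mem htS), h.dual s hsS t htS, h.dual p hpS t htS,
      if_neg (ne_of_mem_erase ht).symm, mul_zero, sub_zero]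
  · intro s hs hS c hc
    rw [hN' s hs c hc]
    rcases eq_or_ne s p with rfl | hsp
    · rw [div_self hxp, one_mul, sub_self]
    · have hsS : s ∉ S := fun h' => hS (mem_erase.2 ⟨hsp, h'⟩)
      rw [h.zero s hs hsS c hc, h.dot_of_notMem x hs hsS, zero_div, zero_mul, sub_zero]

open Classical in
theorem absorb (h : KernelBasis C N S rows) (hp : IsPivot C (fun s => dot C x (N s)) p)
    (hN' : ∀ s < C, ∀ c < C, N' s c = N s c - dot C x (N s) / dot C x (N p) * N p c) :
    KernelBasis C N' (if dot C x (N p) = 0 then S else S.erase p) (insert x rows) := by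
  split_ifs with hxp
  · refine (h.congr fun s hs c hc => ?_).insert_orthogonal fun s hs => ?_
    · rw [hN' s hs c hc, hxp, div_zero, zero_mul, sub_zero]
    · rw [dot_congr (y' := N s) (fun _ _ => rfl) fun c hc => by
        rw [hN' s hs c hc, hxp, div_zero, zero_mul, sub_zero]]
      exact hp.ne hxp s hs
  · exact h.eliminate hp.lt hxp hN'

/-- Pivots are chosen as late as possible, so unknowns of which the solutions take independent
values are never eliminated. -/
theorem le_pivot {n : ℕ} (h : KernelBasis C N S rows) (hS : range n ⊆ S)
    (hp : IsPivot C (fun s => dot C x (N s)) p) (hxp : dot C x (N p) ≠ 0) (y : ℕ → ℕ → K)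
    (hy : ∀ i < n, ∀ z ∈ insert x rows, dot C z (y i) = 0)
    (hyn : ∀ i < n, ∀ j < n, y i j = if i = j then 1 else 0) : n ≤ p := by
  by_contra! hlt
  have hxy := h.dot_eq (fun z hz => hy p hlt z (.inr hz)) x
  rw [hy p hlt x (.inl rfl), sum_eq_single_of_mem p (hS (mem_range.2 hlt)), hyn p hlt p hlt,
    if_pos rfl, one_mul] at hxy
  · exact hxp hxy.symm
  · intro s hs hsp
    rcases lt_or_ge s n with hsn | hsn
    · rw [hyn p hlt s hsn, if_neg hsp.symm, zero_mul]
    · rw [hp.last s (h.lt_of_mem hs) (by omega), mul_zero]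

theorem mem_span (h : KernelBasis C N S rows) (t : ℕ → K) (ht : ∀ s < C, dot C (N s) t = 0) :
    (fun c : Fin C => t c) ∈ Submodule.span K ((fun (x : ℕ → K) (c : Fin C) => x c) '' rows) := by
  by_contra hn
  obtain ⟨φ, hφt, hφ⟩ := Submodule.exists_le_ker_of_notMem hn
  obtain ⟨y, hy⟩ := exists_dual_eq_dot C φ
  have hrows : ∀ x ∈ rows, dot C x y = 0 := fun x hx => by
    rw [← hy]
    exact hφ (Submodule.subset_span ⟨x, hx, rfl⟩)
  apply hφt
  rw [hy, h.dot_eq hrows]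
  exact sum_eq_zero fun s hs => by rw [dot_comm, ht s (h.lt_of_mem hs), mul_zero]

end KernelBasis
end Elimination

/-! ### The decomposition program -/

namespace Cmd

/-- The reference to a field cell that is never written and contains zero. -/
abbrev zeroCell : Ref := var zeroArr

/-- The command that copies the field element at `a` to `d`. -/
def copy (d a : Ref) : Cmd := instr (.fieldAdd d a zeroCell)

/-- The command that tabulates the values of the variable `acc`, which starts with `x` and is
updated by `body`, in the array `T`; copying is addition of zero. -/
def tabulate (T acc x : ℕ) (body : Cmd) : Cmd :=
  instr (.natConst (var acc) x) ;;
  rep aVar sizeVar (instr (.natAdd ⟨T, [aVar]⟩ (var acc) (var zeroVar)) ;; body)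

/-- The command that tabulates the multiples of `n` and computes `n²`. -/
def tabulateMult : Cmd :=
  tabulate multTable sizeSqVar 0 (instr (.natAdd (var sizeSqVar) (var sizeSqVar) (var sizeVar)))

/-- The command that tabulates the multiples of `n²` and computes `n³`. -/
def tabulateSqMult : Cmd :=
  tabulate sqMultTable sizeCubeVar 0
    (instr (.natAdd (var sizeCubeVar) (var sizeCubeVar) (var sizeSqVar)))

/-- The command that tabulates the powers of `5`. -/
def tabulatePow : Cmd :=
  tabulate powTable powerVar 1 (
    instr (.natAdd (var keyVar) (var powerVar) (var powerVar)) ;;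
    instr (.natAdd (var keyVar) (var keyVar) (var keyVar)) ;;
    instr (.natAdd (var powerVar) (var keyVar) (var powerVar)))

/-- The preparations of the decomposition program. -/
def setup : Cmd :=
  tabulateMult ;; tabulateSqMult ;;
  instr (.natAdd (var relationSizeVar) (var sizeSqVar) (var sizeVar)) ;; tabulatePow

/-- The command that writes the identity matrix to the field array `A`. -/
def initBasis (A u : ℕ) : Cmd :=
  reps [rowVar, colVar] u (ite (.natEq (var rowVar) (var colVar))
    (instr (.fieldOne ⟨A, [rowVar, colVar]⟩)) (instr (.fieldZero ⟨A, [rowVar, colVar]⟩)))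

/-- The command that pairs the equation with a row of the field array `A`. -/
def pairRow (A u : ℕ) : Cmd :=
  instr (.fieldZero ⟨valueArr, [rowVar]⟩) ;;
  reps [colVar] u (
    instr (.fieldMul (var productArr) ⟨equationArr, [colVar]⟩ ⟨A, [rowVar, colVar]⟩) ;;
    instr (.fieldAdd ⟨valueArr, [rowVar]⟩ ⟨valueArr, [rowVar]⟩ (var productArr)))

/-- The command that finds the last nonzero value. -/
def findPivot (u : ℕ) : Cmd :=
  instr (.natConst (var pivotVar) 0) ;;
  rep rowVar u (ite (.fieldEq ⟨valueArr, [rowVar]⟩ zeroCell) skip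
    (instr (.natAdd (var pivotVar) (var rowVar) (var zeroVar))))

/-- The command that copies the pivot row of the field array `A`. -/
def savePivot (A u : ℕ) : Cmd :=
  reps [colVar] u (copy ⟨pivotArr, [colVar]⟩ ⟨A, [pivotVar, colVar]⟩)

/-- The command that subtracts a multiple of the pivot row from a row of the field array `A`. -/
def eliminateRow (A u : ℕ) : Cmd :=
  instr (.fieldDiv (var quotientArr) ⟨valueArr, [rowVar]⟩ ⟨valueArr, [pivotVar]⟩) ;;
  reps [colVar] u (
    instr (.fieldMul (var productArr) (var quotientArr) ⟨pivotArr, [colVar]⟩) ;;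
    instr (.fieldSub ⟨A, [rowVar, colVar]⟩ ⟨A, [rowVar, colVar]⟩ (var productArr)))

/-- The elimination step that imposes the equation on the space spanned by the rows of the field
array `A`. -/
def absorb (A u : ℕ) : Cmd :=
  reps [rowVar] u (pairRow A u) ;; findPivot u ;; savePivot A u ;;
  reps [rowVar] u (eliminateRow A u)

/-- The command that computes the number with the digits `a`, `b`, `c` in base `n`. -/
def index₃ (a b c : ℕ) : Cmd :=
  instr (.natAdd (var indexVar) ⟨sqMultTable, [a]⟩ ⟨multTable, [b]⟩) ;;
  instr (.natAdd (var indexVar) (var indexVar) (var c))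

/-- The command that adds the field element at `s` to the one at `r` if two variables are equal. -/
def addIfEq (v w : ℕ) (r s : Ref) : Cmd :=
  ite (.natEq (var v) (var w)) (instr (.fieldAdd r r s)) skip

/-- The command that writes a coefficient of a partial derivative of an input form to the equation.
The multiplicity of the variable in a monomial is obtained by repeated addition. -/
def derivativeEntry : Cmd :=
  index₃ aVar bVar cVar ;;
  copy ⟨equationArr, [indexVar]⟩ ⟨inputArr, [iVar, jVar, aVar, bVar, cVar]⟩ ;;
  addIfEq aVar jVar ⟨equationArr, [indexVar]⟩ ⟨inputArr, [iVar, jVar, aVar, bVar, cVar]⟩ ;;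
  addIfEq bVar jVar ⟨equationArr, [indexVar]⟩ ⟨inputArr, [iVar, jVar, aVar, bVar, cVar]⟩ ;;
  addIfEq cVar jVar ⟨equationArr, [indexVar]⟩ ⟨inputArr, [iVar, jVar, aVar, bVar, cVar]⟩

/-- The command that writes the coefficients of a partial derivative of an input form to the
equation. -/
def derivativeRow : Cmd := reps [aVar, bVar, cVar] sizeVar derivativeEntry

/-- The command that computes a basis of the functionals that vanish on the partial derivatives. -/
def annihilator : Cmd :=
  initBasis annihilatorArr sizeCubeVar ;;
  reps [iVar, jVar] sizeVar (derivativeRow ;; absorb annihilatorArr sizeCubeVar)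

/-- The command that adds an entry of a functional on cubic forms to the equation unless one of the
given variables is equal to `kVar`. -/
def addFunctionalUnless (vs : List ℕ) : Cmd :=
  vs.foldr (fun v c => ite (.natEq (var v) (var kVar)) skip c)
    (instr (.fieldAdd ⟨equationArr, [pairVar]⟩ ⟨equationArr, [pairVar]⟩
      ⟨annihilatorArr, [functionalVar, indexVar]⟩))

/-- The command that writes to the equation the value at `x_k x_a x_b` of a functional on cubic
forms, given on products of three variables in arbitrary order. -/
def quotientEntry : Cmd :=
  instr (.natAdd (var pairVar) ⟨multTable, [aVar]⟩ (var bVar)) ;;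
  index₃ kVar aVar bVar ;;
  copy ⟨equationArr, [pairVar]⟩ ⟨annihilatorArr, [functionalVar, indexVar]⟩ ;;
  index₃ aVar kVar bVar ;; addFunctionalUnless [aVar] ;;
  index₃ aVar bVar kVar ;; addFunctionalUnless [aVar, bVar]

/-- The command that writes to the equation the functional that takes a quadratic form `q` to the
value at `x_k q` of a functional on cubic forms. -/
def quotientRow : Cmd := reps [aVar, bVar] sizeVar quotientEntry

/-- The command that selects a vector of the computed basis of functionals. -/
def selectFunctional : Cmd :=
  index₃ iVar jVar lVar ;;
  instr (.natAdd (var functionalVar) (var indexVar) (var zeroVar))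

/-- The command that computes a basis of the quadratic forms whose products with all variables are
combinations of the partial derivatives. -/
def quotient : Cmd :=
  initBasis quotientFormArr sizeSqVar ;;
  reps [iVar, jVar, lVar, kVar] sizeVar (
    (selectFunctional ;; quotientRow) ;; absorb quotientFormArr sizeSqVar)

/-- The command that copies a computed quadratic form to the right factor. -/
def copyForm : Cmd :=
  reps [aVar, bVar] sizeVar (
    instr (.natAdd (var indexVar) ⟨multTable, [aVar]⟩ (var bVar)) ;;
    copy ⟨rightArr, [countVar, aVar, bVar]⟩ ⟨quotientFormArr, [rowVar, indexVar]⟩)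

/-- The command that appends a computed quadratic form to the right factor unless it is zero. -/
def appendForm : Cmd :=
  ite (.fieldEq ⟨quotientFormArr, [rowVar, rowVar]⟩ zeroCell) skip (
    copyForm ;; instr (.natConst (var pairVar) 1) ;;
    instr (.natAdd (var countVar) (var countVar) (var pairVar)))

/-- The command that copies the nonzero basis vectors to the right factor. -/
def extract : Cmd := instr (.natConst (var countVar) 0) ;; rep rowVar sizeSqVar appendForm

/-- The command that writes to `v` the sum of the powers of `5` with the exponents `a`, `b`, `c`,
`d`, which identifies a monomial of degree four. -/
def monomialKey (v a b c d : ℕ) : Cmd :=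
  instr (.natAdd (var v) ⟨powTable, [a]⟩ ⟨powTable, [b]⟩) ;;
  instr (.natAdd (var v) (var v) ⟨powTable, [c]⟩) ;;
  instr (.natAdd (var v) (var v) ⟨powTable, [d]⟩)

/-- The command that adds a summand of a coefficient of the product of two forms of the right
factor. -/
def productTerm : Cmd :=
  ite (.natLt (var qVar) (var pVar)) skip
    (ite (.natLt (var sVar) (var rVar)) skip (
      monomialKey productKeyVar pVar qVar rVar sVar ;;
      ite (.natEq (var productKeyVar) (var keyVar)) (
        instr (.fieldMul (var productArr) ⟨rightArr, [lVar, pVar, qVar]⟩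
          ⟨rightArr, [mVar, rVar, sVar]⟩) ;;
        instr (.fieldAdd (var sumArr) (var sumArr) (var productArr))) skip))

/-- The command that computes a coefficient of the product of two forms of the right factor. -/
def productCoeff : Cmd :=
  instr (.fieldZero (var sumArr)) ;;
  ite (.natLt (var mVar) (var lVar)) skip (reps [pVar, qVar, rVar, sVar] sizeVar productTerm)

/-- The command that computes the index `n + l n + m` of the product of the forms `l` and `m` of the
right factor; the indices below `n` belong to the input forms. -/
def pairIndex : Cmd :=
  instr (.natAdd (var indexVar) (var sizeVar) ⟨multTable, [lVar]⟩) ;;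
  instr (.natAdd (var indexVar) (var indexVar) (var mVar))

/-- The command that writes the coefficients of one monomial in the input forms to the equation. -/
def inputRow : Cmd :=
  reps [iVar] sizeVar (copy ⟨equationArr, [iVar]⟩ ⟨inputArr, [iVar, aVar, bVar, cVar, dVar]⟩)

/-- The command that writes the negative of a coefficient of the product of two forms of the right
factor to the equation. -/
def productEntry : Cmd :=
  productCoeff ;; pairIndex ;; instr (.fieldSub ⟨equationArr, [indexVar]⟩ zeroCell (var sumArr))

/-- The command that writes the coefficients of one monomial in the input forms and in the products
of forms of the right factor to the equation. -/
def compositionRow : Cmd :=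
  monomialKey keyVar aVar bVar cVar dVar ;; inputRow ;; reps [lVar, mVar] sizeVar productEntry

/-- The command that computes a basis of the linear relations between the input forms and the
products of forms of the right factor. -/
def relations : Cmd :=
  initBasis relationArr relationSizeVar ;;
  reps [aVar, bVar, cVar, dVar] sizeVar (compositionRow ;; absorb relationArr relationSizeVar)

/-- The command that reads the left factor off the relations. -/
def writeLeft : Cmd :=
  reps [iVar, lVar, mVar] sizeVar
    (pairIndex ;; copy ⟨leftArr, [iVar, lVar, mVar]⟩ ⟨relationArr, [iVar, indexVar]⟩)

/-- The command that sets the flag if the input is not zero. -/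
def detectInput : Cmd :=
  reps [iVar, aVar, bVar, cVar, dVar] sizeVar
    (ite (.fieldEq ⟨inputArr, [iVar, aVar, bVar, cVar, dVar]⟩ zeroCell) skip
      (instr (.natConst (var flagVar) 1)))

/-- The command that clears the flag unless a left factor has been found. -/
def checkRelations : Cmd :=
  reps [iVar] sizeVar (ite (.fieldEq ⟨relationArr, [iVar, iVar]⟩ zeroCell)
    (instr (.natConst (var flagVar) 0)) skip)

/-- The command that announces success if the input is not zero and a left factor has been
found. -/
def announce : Cmd := detectInput ;; checkRelations

/-- The decomposition program without its preparations. -/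
def main : Cmd :=
  annihilator ;; quotient ;; extract ;; relations ;; writeLeft ;; announce

theorem countersSafe_setup : setup.CountersSafe := by decide

theorem countersSafe_main : main.CountersSafe := by decide

theorem bounds_setup : ∀ u ∈ setup.bounds, u ∉ setup.natWrites := by decide

theorem bounds_main : ∀ u ∈ main.bounds, u ∉ main.natWrites := by decide

section Absorb

open Finset

variable {K : Type u} [Field K]

/-- The vector stored in a field array. -/
def vec (σ : State K) (A : ℕ) : ℕ → K := fun c => σ.field A [c]

/-- The matrix stored in a field array. -/
def mat (σ : State K) (A : ℕ) : ℕ → ℕ → K := fun s c => σ.field A [s, c]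

attribute [local simp] vec mat den Instr.exec State.setField State.setNat State.getField
  State.getNat State.idx Cond.Holds

variable {A u : ℕ}

theorem den_copy {σ : State K} (hz : σ.field zeroArr [] = 0) (d a : Ref) :
    (copy d a).den σ = σ.setField d (σ.getField a) := by
  have hzero : σ.getField zeroCell = 0 := hz
  rw [copy, den, Instr.exec, hzero, add_zero]

theorem mem_box_one {m c : ℕ} : [c] ∈ box m 1 ↔ c < m := by simp [mem_box]

theorem mem_box_two {m c d : ℕ} : [c, d] ∈ box m 2 ↔ c < m ∧ d < m := by simp [mem_box]

theorem den_initBasis (hu : productKeyVar < u) (σ : State K) :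
    ∀ s < σ.nat u [], ∀ c < σ.nat u [],
      mat ((initBasis A u).den σ) A s c = if s = c then 1 else 0 := by
  have main := den_reps_forall (σ := σ) (vs := [rowVar, colVar]) (u := u)
    (p := ite (.natEq (var rowVar) (var colVar)) (instr (.fieldOne ⟨A, [rowVar, colVar]⟩))
      (instr (.fieldZero ⟨A, [rowVar, colVar]⟩)))
    (by simp [NestSafe]; omega) (fun _ _ => True)
    (fun t τ => ∀ s c, t = [s, c] → mat τ A s c = if s = c then 1 else 0)
    (fun _ _ _ _ _ => ⟨id, id⟩) (by simp) ?_
  · exact fun s hs c hc => main [s, c] (mem_box_two.2 ⟨hs, hc⟩) s c rfl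
  · rintro _ - τ rfl -
    by_cases h : τ.nat rowVar [] = τ.nat colVar [] <;> simp +contextual [h]

theorem den_pairRow (hA : sumArr < A) (hu : productKeyVar < u) (σ : State K) (s : ℕ) :
    vec ((pairRow A u).den σ) valueArr s =
      if s = σ.nat rowVar [] then dot (σ.nat u []) (vec σ equationArr) (mat σ A s)
      else vec σ valueArr s := by
  set a := σ.nat rowVar [] with ha
  set τ := (instr (.fieldZero ⟨valueArr, [rowVar]⟩)).den σ with hτ
  have main := den_reps_sum (σ := τ) (vs := [colVar]) (u := u)
    (p := instr (.fieldMul (var productArr) ⟨equationArr, [colVar]⟩ ⟨A, [rowVar, colVar]⟩) ;;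
      instr (.fieldAdd ⟨valueArr, [rowVar]⟩ ⟨valueArr, [rowVar]⟩ (var productArr)))
    (by simp [NestSafe]; omega) (fun υ => vec υ valueArr)
    (fun t => Pi.single a (σ.field equationArr t * σ.field A (a :: t))) (fun _ _ _ _ => rfl) ?_
  · have hnat : τ.nat u [] = σ.nat u [] := rfl
    change vec (den _ τ) valueArr s = _
    rw [main, hnat]
    simp only [List.length_cons, List.length_nil, sum_box_succ, sum_box_zero, Pi.add_apply,
      Finset.sum_apply]
    split_ifs with h <;> simp [hτ, dot, h, ← ha]
  · rintro _ - υ rfl hF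
    have hrow : υ.nat rowVar = σ.nat rowVar := hF.nat rowVar (by simp)
    have heq : υ.field equationArr = σ.field equationArr := by
      rw [hF.field equationArr (by simp)]; simp [hτ]
    have hAσ : υ.field A = σ.field A := by
      rw [hF.field A (by simp; omega)]
      simp [hτ, show A ≠ valueArr by omega]
    ext s
    by_cases h : s = a
    · simp [hrow, heq, hAσ, h, ← ha, mul_comm]
    · simp [hrow, h, ← ha]

theorem den_pairRows (hA : sumArr < A) (hu : productKeyVar < u) (σ : State K) :
    ∀ s < σ.nat u [], vec ((reps [rowVar] u (pairRow A u)).den σ) valueArr s =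
      dot (σ.nat u []) (vec σ equationArr) (mat σ A s) := by
  have main := den_reps_forall (σ := σ) (vs := [rowVar]) (u := u) (p := pairRow A u)
    (by simp [NestSafe, pairRow]; omega) (fun _ _ => True)
    (fun t τ => ∀ s, t = [s] →
      vec τ valueArr s = dot (σ.nat u []) (vec σ equationArr) (mat σ A s))
    (fun _ _ _ _ _ => ⟨id, id⟩) (by simp) ?_
  · exact fun s hs => main [s] (mem_box_one.2 hs) s rfl
  · rintro _ - τ rfl hF
    have hu' : τ.nat u = σ.nat u := hF.nat u (by simp [pairRow]; omega)
    have heq : vec τ equationArr = vec σ equationArr := by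
      unfold vec; rw [hF.field equationArr (by simp [pairRow])]
    have hmat : mat τ A = mat σ A := by
      unfold mat; rw [hF.field A (by simp [pairRow]; omega)]
    have hpair := den_pairRow hA hu τ
    rw [hu', heq, hmat] at hpair
    refine ⟨fun _ s hs => ?_, fun t ht => ⟨id, fun h s hs => ?_⟩⟩
    · rw [hpair, if_pos (by simpa using hs.symm)]
    · rw [hpair, if_neg (by rintro rfl; exact ht hs), h s hs]

theorem den_findPivot (hu : productKeyVar < u) (σ : State K) (hz : σ.field zeroArr [] = 0)
    (hz' : σ.nat zeroVar [] = 0) (hpos : 0 < σ.nat u []) :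
    IsPivot (σ.nat u []) (vec σ valueArr) (((findPivot u).den σ).nat pivotVar []) := by
  set τ := (instr (.natConst (var pivotVar) 0)).den σ with hτ
  have hτu : τ.nat u [] = σ.nat u [] := by simp [hτ, show u ≠ pivotVar by omega]
  let I : ℕ → State K → Prop := fun k υ =>
    (υ.nat pivotVar [] < k ∨ υ.nat pivotVar [] = 0) ∧
    (∀ s < k, υ.nat pivotVar [] < s → vec σ valueArr s = 0) ∧
    (vec σ valueArr (υ.nat pivotVar []) = 0 → ∀ s < k, vec σ valueArr s = 0)
  have main : I (τ.nat u []) ((findPivot u).den σ) := by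
    refine den_rep_induction (σ := τ) I (fun k υ x y h => by simpa [I] using h)
      (fun y h => by simpa [I] using h) (by simp [I, hτ]) ?_
    rintro k υ - hk hF ⟨hlt, hlast, hne⟩
    have hvalue : υ.field valueArr = σ.field valueArr := hF.field valueArr (by simp)
    have hzero : υ.field zeroArr [] = 0 := (congrFun (hF.field zeroArr (by simp)) []).trans hz
    have hzero' : υ.nat zeroVar [] = 0 := by
      rw [hF.nat zeroVar (by simp)]; simpa [hτ] using hz'
    by_cases h : σ.field valueArr [k] = 0
    · simp only [I, den, Cond.Holds, State.getField, State.idx, List.map_cons, List.map_nil,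
        hk, hvalue, hzero, h, if_true]
      refine ⟨by omega, fun s hs hp => ?_, fun hp s hs => ?_⟩ <;>
        rcases Nat.lt_succ_iff_lt_or_eq.1 hs with hs | rfl
      exacts [hlast s hs hp, h, hne hp s hs, h]
    · have hpivot : ((ite (.fieldEq ⟨valueArr, [rowVar]⟩ zeroCell) skip
          (instr (.natAdd (var pivotVar) (var rowVar) (var zeroVar)))).den υ).nat pivotVar [] =
            k := by
        simp [hk, hvalue, hzero, h, hzero']
      simp only [I, hpivot]
      exact ⟨.inl (by omega), fun s hs hs' => by omega, fun h' => absurd h' h⟩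
  rw [hτu] at main
  exact ⟨by rcases main.1 with h | h <;> omega, main.2.1, main.2.2⟩

theorem den_savePivot (hA : sumArr < A) (hu : productKeyVar < u) (σ : State K)
    (hz : σ.field zeroArr [] = 0) :
    ∀ c < σ.nat u [],
      vec ((savePivot A u).den σ) pivotArr c = mat σ A (σ.nat pivotVar []) c := by
  have main := den_reps_forall (σ := σ) (vs := [colVar]) (u := u)
    (p := copy ⟨pivotArr, [colVar]⟩ ⟨A, [pivotVar, colVar]⟩)
    (by simp [NestSafe, copy]; omega) (fun _ _ => True)
    (fun t τ => ∀ c, t = [c] → vec τ pivotArr c = mat σ A (σ.nat pivotVar []) c)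
    (fun _ _ _ _ _ => ⟨id, id⟩) (by simp) ?_
  · exact fun c hc => main [c] (mem_box_one.2 hc) c rfl
  · rintro _ - τ rfl hF
    have hpivot : τ.nat pivotVar = σ.nat pivotVar := hF.nat pivotVar (by simp [copy])
    have hAσ : τ.field A = σ.field A := hF.field A (by simp [copy]; omega)
    have hzero : τ.field zeroArr [] = 0 := by rw [hF.field zeroArr (by simp [copy]), hz]
    rw [den_copy hzero]
    simp +contextual [hpivot, hAσ]

theorem den_eliminateRow (hA : sumArr < A) (hu : productKeyVar < u) (σ : State K) (s c : ℕ)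
    (hc : c < σ.nat u []) :
    mat ((eliminateRow A u).den σ) A s c =
      if s = σ.nat rowVar [] then
        mat σ A s c - vec σ valueArr s / vec σ valueArr (σ.nat pivotVar []) * vec σ pivotArr c
      else mat σ A s c := by
  set a := σ.nat rowVar [] with ha
  set b := vec σ valueArr a / vec σ valueArr (σ.nat pivotVar []) with hb
  set τ := (instr (.fieldDiv (var quotientArr) ⟨valueArr, [rowVar]⟩ ⟨valueArr, [pivotVar]⟩)).den σ
    with hτ
  have hA' : A ≠ productArr ∧ A ≠ quotientArr := by omega
  have main := den_reps_forall (σ := τ) (vs := [colVar]) (u := u)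
    (p := instr (.fieldMul (var productArr) (var quotientArr) ⟨pivotArr, [colVar]⟩) ;;
      instr (.fieldSub ⟨A, [rowVar, colVar]⟩ ⟨A, [rowVar, colVar]⟩ (var productArr)))
    (by simp [NestSafe]; omega) (fun t υ => ∀ s c, t = [c] → mat υ A s c = mat σ A s c)
    (fun t υ => ∀ s c, t = [c] →
      mat υ A s c = if s = a then mat σ A s c - b * vec σ pivotArr c else mat σ A s c)
    (fun _ _ _ _ _ => ⟨id, id⟩) (by simp [hτ, hA']) ?_
  · refine (main [c] (mem_box_one.2 hc) s c rfl).trans ?_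
    split_ifs with h
    · rw [hb, h]
    · rfl
  · rintro _ - υ rfl hF
    have hrow : υ.nat rowVar [] = a := congrFun (hF.nat rowVar (by simp)) []
    have hpivot : υ.field pivotArr = σ.field pivotArr := by
      rw [hF.field pivotArr (by simp; omega)]; simp [hτ]
    have hquot : υ.field quotientArr [] = b := by
      rw [hF.field quotientArr (by simp; omega)]; simp [hτ, hb, ha]
    refine ⟨fun h s c hc => ?_, fun t ht => ⟨fun h s c hc => ?_, fun h s c hc => ?_⟩⟩
    all_goals
      have := h s c hc
      by_cases hs : s = a <;> simp_all

theorem den_eliminateRows (hA : sumArr < A) (hu : productKeyVar < u) (σ : State K) :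
    ∀ s < σ.nat u [], ∀ c < σ.nat u [],
      mat ((reps [rowVar] u (eliminateRow A u)).den σ) A s c =
        mat σ A s c - vec σ valueArr s / vec σ valueArr (σ.nat pivotVar []) * vec σ pivotArr c := by
  have main := den_reps_forall (σ := σ) (vs := [rowVar]) (u := u) (p := eliminateRow A u)
    (by simp [NestSafe, eliminateRow]; omega)
    (fun t τ => ∀ s, t = [s] → ∀ c < σ.nat u [], mat τ A s c = mat σ A s c)
    (fun t τ => ∀ s, t = [s] → ∀ c < σ.nat u [], mat τ A s c = mat σ A s c -
      vec σ valueArr s / vec σ valueArr (σ.nat pivotVar []) * vec σ pivotArr c)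
    (fun _ _ _ _ _ => ⟨id, id⟩) (by simp) ?_
  · exact fun s hs => main [s] (mem_box_one.2 hs) s rfl
  · rintro _ - τ rfl hF
    have hu' : τ.nat u = σ.nat u := hF.nat u (by simp [eliminateRow]; omega)
    have hvalue : vec τ valueArr = vec σ valueArr := by
      unfold vec; rw [hF.field valueArr (by simp [eliminateRow]; omega)]
    have hrow : vec τ pivotArr = vec σ pivotArr := by
      unfold vec; rw [hF.field pivotArr (by simp [eliminateRow]; omega)]
    have hpivot : τ.nat pivotVar = σ.nat pivotVar := hF.nat pivotVar (by simp [eliminateRow])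
    have helim := den_eliminateRow hA hu τ
    rw [hu', hvalue, hrow, hpivot] at helim
    refine ⟨fun h s hs c hc => ?_,
      fun t ht => ⟨fun h s hs c hc => ?_, fun h s hs c hc => ?_⟩⟩
    · rw [helim s c hc, if_pos (by simpa using hs.symm), h s hs c hc]
    · rw [helim s c hc, if_neg (by rintro rfl; exact ht hs), h s hs c hc]
    · rw [helim s c hc, if_neg (by rintro rfl; exact ht hs), h s hs c hc]

theorem den_absorb (hA : sumArr < A) (hu : productKeyVar < u) (σ : State K)
    (hz : σ.field zeroArr [] = 0) (hz' : σ.nat zeroVar [] = 0) (hpos : 0 < σ.nat u []) :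
    ∃ p, IsPivot (σ.nat u []) (fun s => dot (σ.nat u []) (vec σ equationArr) (mat σ A s)) p ∧
      ∀ s < σ.nat u [], ∀ c < σ.nat u [], mat ((absorb A u).den σ) A s c =
        mat σ A s c - dot (σ.nat u []) (vec σ equationArr) (mat σ A s) /
          dot (σ.nat u []) (vec σ equationArr) (mat σ A p) * mat σ A p c := by
  set paired := (reps [rowVar] u (pairRow A u)).den σ
  set pivoted := (findPivot u).den paired with hpivoted
  set saved := (savePivot A u).den pivoted with hsaved
  have Fpaired : Frame _ σ paired := frame_den _ σ
  have Fpivoted : Frame _ paired pivoted := frame_den _ paired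
  have Fsaved : Frame _ pivoted saved := frame_den _ pivoted
  have hu₁ : paired.nat u = σ.nat u := Fpaired.nat u (by simp [pairRow]; omega)
  have hu₂ : pivoted.nat u = σ.nat u := by
    rw [Fpivoted.nat u (by simp [findPivot]; omega), hu₁]
  have hu₃ : saved.nat u = σ.nat u := by
    rw [Fsaved.nat u (by simp [savePivot, copy]; omega), hu₂]
  have hpivot : saved.nat pivotVar = pivoted.nat pivotVar :=
    Fsaved.nat pivotVar (by simp [savePivot, copy])
  have hfield : pivoted.field = paired.field :=
    funext fun a => Fpivoted.field a (by simp [findPivot])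
  have hzero : paired.field zeroArr [] = 0 := by
    rw [Fpaired.field zeroArr (by simp [pairRow]), hz]
  have hzero' : paired.nat zeroVar [] = 0 := by
    rw [Fpaired.nat zeroVar (by simp [pairRow]), hz']
  have hrows : mat pivoted A = mat σ A := by
    unfold mat; rw [hfield, Fpaired.field A (by simp [pairRow]; omega)]
  have hrows' : mat saved A = mat σ A := by
    rw [← hrows]; unfold mat; rw [Fsaved.field A (by simp [savePivot, copy]; omega)]
  have hvalues : vec saved valueArr = vec paired valueArr := by
    unfold vec; rw [Fsaved.field valueArr (by simp [savePivot, copy]), hfield]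
  have pairing := den_pairRows hA hu σ
  have pivot := den_findPivot hu paired hzero hzero' (by rwa [hu₁])
  have saving := den_savePivot hA hu pivoted (by rw [hfield, hzero])
  have elimination := den_eliminateRows hA hu saved
  rw [hu₁, ← hpivoted] at pivot
  rw [hu₂, hrows, ← hsaved] at saving
  rw [hu₃, hrows', hvalues, hpivot] at elimination
  refine ⟨pivoted.nat pivotVar [], pivot.congr fun s hs => pairing s hs, fun s hs c hc => ?_⟩
  rw [← pairing s hs, ← pairing _ pivot.lt, ← saving c hc]
  exact elimination s hs c hc

end Absorb

section Environment

open Finset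

variable {K : Type u} [Field K] {n : ℕ} {F : List ℕ → K} {σ τ : State K}

/-- The state contains the input table `F` in `n` variables and the tables written by `setup`. -/
structure Env (n : ℕ) (F : List ℕ → K) (τ : State K) : Prop where
  size : τ.nat sizeVar [] = n
  square : τ.nat sizeSqVar [] = n * n
  cube : τ.nat sizeCubeVar [] = n * (n * n)
  relationSize : τ.nat relationSizeVar [] = n * n + n
  zeroNat : τ.nat zeroVar [] = 0
  mult : ∀ a < n, τ.nat multTable [a] = a * n
  sqMult : ∀ a < n, τ.nat sqMultTable [a] = a * (n * n)
  pow : ∀ a < n, τ.nat powTable [a] = 5 ^ a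
  input : τ.field inputArr = F
  zero : τ.field zeroArr [] = 0

/-- The command writes to none of the arrays that `Env` describes. -/
def KeepsEnv (c : Cmd) : Prop :=
  (∀ a ∈ [sizeVar, sizeSqVar, sizeCubeVar, relationSizeVar, zeroVar, multTable, sqMultTable,
    powTable], a ∉ c.natWrites) ∧ inputArr ∉ c.fieldWrites ∧ zeroArr ∉ c.fieldWrites

instance (c : Cmd) : Decidable c.KeepsEnv := inferInstanceAs (Decidable (_ ∧ _ ∧ _))

theorem KeepsEnv.mono {c d : Cmd} (h : d.KeepsEnv) (hn : c.natWrites ⊆ d.natWrites)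
    (hf : c.fieldWrites ⊆ d.fieldWrites) : c.KeepsEnv :=
  ⟨fun a ha h' => h.1 a ha (hn h'), fun h' => h.2.1 (hf h'), fun h' => h.2.2 (hf h')⟩

theorem Env.of_frame (h : Env n F σ) {c : Cmd} (hF : Frame c σ τ) (hc : c.KeepsEnv) :
    Env n F τ := by
  obtain ⟨hnat, hinput, hzero⟩ := hc
  have hkeep := fun a ha => hF.nat a (hnat a ha)
  simp only [List.mem_cons, List.not_mem_nil, or_false, forall_eq_or_imp, forall_eq] at hkeep
  obtain ⟨hsize, hsquare, hcube, hrel, hzeroNat, hmult, hsqMult, hpow⟩ := hkeep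
  constructor
  · rw [hsize, h.size]
  · rw [hsquare, h.square]
  · rw [hcube, h.cube]
  · rw [hrel, h.relationSize]
  · rw [hzeroNat, h.zeroNat]
  · rw [hmult]; exact h.mult
  · rw [hsqMult]; exact h.sqMult
  · rw [hpow]; exact h.pow
  · rw [hF.field _ hinput, h.input]
  · rw [hF.field _ hzero, h.zero]

theorem den_tabulate {T acc x : ℕ} {body : Cmd} (φ : ℕ → ℕ)
    (hT : T ∉ acc :: aVar :: stepVar :: body.natWrites) (ha : aVar ∉ acc :: body.natWrites)
    (hacc : acc ≠ stepVar) (hn : sizeVar ∉ (tabulate T acc x body).natWrites)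
    (hz : zeroVar ∉ (tabulate T acc x body).natWrites) (hz' : σ.nat zeroVar [] = 0) (hx : φ 0 = x)
    (step : ∀ k τ, Frame (tabulate T acc x body) σ τ → τ.nat acc [] = φ k →
      (body.den τ).nat acc [] = φ (k + 1)) :
    ((tabulate T acc x body).den σ).nat acc [] = φ (σ.nat sizeVar []) ∧
      ∀ a < σ.nat sizeVar [], ((tabulate T acc x body).den σ).nat T [a] = φ a := by
  simp only [List.mem_cons, not_or] at hT ha
  set σ₀ := (instr (.natConst (var acc) x)).den σ with hσ₀
  have hframe₀ : Frame (instr (.natConst (var acc) x)) σ σ₀ := frame_den _ σ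
  have hsize : σ₀.nat sizeVar = σ.nat sizeVar :=
    hframe₀.nat _ fun h => hn (List.mem_append_left _ h)
  have main := den_rep_induction (v := aVar) (u := sizeVar) (σ := σ₀)
    (p := instr (.natAdd ⟨T, [aVar]⟩ (var acc) (var zeroVar)) ;; body)
    (fun k τ => τ.nat acc [] = φ k ∧ ∀ a < k, τ.nat T [a] = φ a)
    (fun k τ x y h => by
      simpa [State.setNat, State.idx, hT, hacc, Ne.symm ha.1] using h)
    (fun y h => by simpa [State.setNat, State.idx, hT, Ne.symm ha.1] using h)
    (by simp [hσ₀, den, Instr.exec, State.setNat, State.idx, hx]) ?_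
  · rwa [hsize] at main
  rintro k τ - hk hF ⟨hτ, htable⟩
  have hframe : Frame (tabulate T acc x body) σ τ :=
    (hframe₀.mono (by simp [tabulate]) (by simp)).trans
      (hF.mono (List.subset_append_right _ _) (List.subset_append_right _ _))
  set υ := (instr (.natAdd ⟨T, [aVar]⟩ (var acc) (var zeroVar))).den τ with hυ
  have hυacc : υ.nat acc [] = φ k := by
    simpa [hυ, den, Instr.exec, State.setNat, State.idx, Ne.symm hT.1] using hτ
  have hυframe : Frame (tabulate T acc x body) σ υ :=
    hframe.trans ((frame_den _ τ).mono (by simp [tabulate]) (by simp))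
  refine ⟨step k υ hυframe hυacc, fun a hak => ?_⟩
  change (body.den υ).nat T [a] = _
  rw [(frame_den body υ).nat T hT.2.2.2]
  rcases eq_or_ne a k with rfl | hne
  · simp [hυ, den, Instr.exec, State.setNat, State.getNat, State.idx, hk, hτ,
      hframe.nat _ hz, hz']
  · simpa [hυ, den, Instr.exec, State.setNat, State.idx, hk, hne] using htable a (by omega)

theorem den_tabulateMult (hn : σ.nat sizeVar [] = n) (hz : σ.nat zeroVar [] = 0) :
    (tabulateMult.den σ).nat sizeSqVar [] = n * n ∧
      ∀ a < n, (tabulateMult.den σ).nat multTable [a] = a * n := by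
  subst hn
  refine den_tabulate (· * σ.nat sizeVar []) (by decide) (by decide) (by decide) (by decide)
    (by decide) hz (zero_mul _) fun k τ hF hτ => ?_
  simp [den, Instr.exec, State.setNat, State.getNat, State.idx, hτ, hF.nat sizeVar (by decide),
    add_mul]

theorem den_tabulateSqMult (hn : σ.nat sizeVar [] = n) (hsq : σ.nat sizeSqVar [] = n * n)
    (hz : σ.nat zeroVar [] = 0) :
    (tabulateSqMult.den σ).nat sizeCubeVar [] = n * (n * n) ∧
      ∀ a < n, (tabulateSqMult.den σ).nat sqMultTable [a] = a * (n * n) := by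
  subst hn
  refine den_tabulate (· * (σ.nat sizeVar [] * σ.nat sizeVar [])) (by decide) (by decide)
    (by decide) (by decide) (by decide) hz (zero_mul _) fun k τ hF hτ => ?_
  simp [den, Instr.exec, State.setNat, State.getNat, State.idx, hτ, hF.nat sizeSqVar (by decide),
    hsq, add_mul]

theorem den_tabulatePow (hn : σ.nat sizeVar [] = n) (hz : σ.nat zeroVar [] = 0) :
    ∀ a < n, (tabulatePow.den σ).nat powTable [a] = 5 ^ a := by
  subst hn
  refine (den_tabulate (5 ^ ·) (by decide) (by decide) (by decide) (by decide) (by decide) hz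
    (pow_zero 5) fun k τ _ hτ => ?_).2
  simp only [den, Instr.exec, State.setNat, State.getNat, State.idx, List.map_nil, hτ,
    pow_succ, and_true, and_self, if_true, if_false, Nat.reduceEqDiff]
  ring

theorem env_setup (f : Fin n → MvPolynomial (Fin n) K) (ρ : ℕ → K) :
    Env n (quarticTable f) (setup.den (initState f ρ)) := by
  set σ := initState f ρ with hσ
  set τ₁ := tabulateMult.den σ
  set τ₂ := tabulateSqMult.den τ₁
  set τ₃ := (instr (.natAdd (var relationSizeVar) (var sizeSqVar) (var sizeVar))).den τ₂
  set τ₄ := setup.den σ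
  have F₁ : Frame _ σ τ₁ := frame_den _ σ
  have F₂ : Frame _ τ₁ τ₂ := frame_den _ τ₁
  have F₃ : Frame _ τ₂ τ₃ := frame_den _ τ₂
  have F₄ : Frame tabulatePow τ₃ τ₄ := frame_den _ τ₃
  have hsize : σ.nat sizeVar [] = n := by simp [hσ, initState]
  have hzero : σ.nat zeroVar [] = 0 := by simp [hσ, initState]
  have hsize₁ : τ₁.nat sizeVar [] = n := by rw [F₁.nat _ (by decide), hsize]
  have hzero₁ : τ₁.nat zeroVar [] = 0 := by rw [F₁.nat _ (by decide), hzero]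
  have hsize₃ : τ₃.nat sizeVar [] = n := by
    rw [F₃.nat _ (by decide), F₂.nat _ (by decide), hsize₁]
  have hzero₃ : τ₃.nat zeroVar [] = 0 := by
    rw [F₃.nat _ (by decide), F₂.nat _ (by decide), hzero₁]
  obtain ⟨square, mult⟩ := den_tabulateMult hsize hzero
  obtain ⟨cube, sqMult⟩ := den_tabulateSqMult hsize₁ square hzero₁
  have hfield : τ₄.field = σ.field :=
    funext fun a => (frame_den setup σ).field a (by simp [setup, tabulateMult, tabulateSqMult,
      tabulatePow, tabulate])
  constructor
  · rw [F₄.nat _ (by decide), hsize₃]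
  · rw [F₄.nat _ (by decide), F₃.nat _ (by decide), F₂.nat _ (by decide), square]
  · rw [F₄.nat _ (by decide), F₃.nat _ (by decide), cube]
  · rw [F₄.nat _ (by decide)]
    change τ₂.nat sizeSqVar [] + τ₂.nat sizeVar [] = _
    rw [F₂.nat _ (by decide), F₂.nat _ (by decide), square, hsize₁]
  · rw [F₄.nat _ (by decide), hzero₃]
  · rw [F₄.nat _ (by decide), F₃.nat _ (by decide), F₂.nat _ (by decide)]; exact mult
  · rw [F₄.nat _ (by decide), F₃.nat _ (by decide)]; exact sqMult
  · exact den_tabulatePow hsize₃ hzero₃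
  · funext l; simp [hfield, hσ, initState]
  · simp [hfield, hσ, initState]

end Environment

section AbsorbLoop

open Finset

variable {K : Type u} [Field K] {n : ℕ} {F : List ℕ → K} {σ : State K} {A u : ℕ}

theorem den_absorb_kernelBasis (hA : sumArr < A) (hu : productKeyVar < u)
    (hz : σ.field zeroArr [] = 0) (hz' : σ.nat zeroVar [] = 0) (hpos : 0 < σ.nat u [])
    {S : Finset ℕ} {rows : Set (ℕ → K)} (h : KernelBasis (σ.nat u []) (mat σ A) S rows) {x : ℕ → K}
    (hx : ∀ c < σ.nat u [], vec σ equationArr c = x c) :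
    ∃ S', KernelBasis (σ.nat u []) (mat ((absorb A u).den σ) A) S' (insert x rows) ∧
      ∀ m, ∀ y : ℕ → ℕ → K, range m ⊆ S →
        (∀ i < m, ∀ z ∈ insert x rows, dot (σ.nat u []) z (y i) = 0) →
        (∀ i < m, ∀ j < m, y i j = if i = j then 1 else 0) → range m ⊆ S' := by
  obtain ⟨p, hp, helim⟩ := den_absorb hA hu σ hz hz' hpos
  have hdot : ∀ s, dot (σ.nat u []) (vec σ equationArr) (mat σ A s) =
      dot (σ.nat u []) x (mat σ A s) := fun s => dot_congr hx fun _ _ => rfl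
  simp only [hdot] at hp helim
  refine ⟨_, h.absorb hp helim, fun m y hm hy hyy => ?_⟩
  split_ifs with hxp
  · exact hm
  · have hmp := h.le_pivot hm hp hxp y hy hyy
    intro i hi
    exact mem_erase.2 ⟨by have := mem_range.1 hi; omega, hm hi⟩

theorem den_absorb_loop (hσ : Env n F σ) (hA : sumArr < A)
    (hu : u ∈ [sizeSqVar, sizeCubeVar, relationSizeVar]) (hpos : 0 < σ.nat u []) {vs : List ℕ}
    {fill : Cmd} (safe : NestSafe vs sizeVar (fill ;; absorb A u))
    (hkeep : (reps vs sizeVar (fill ;; absorb A u)).KeepsEnv) (hfillA : A ∉ fill.fieldWrites)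
    (row : List ℕ → ℕ → K)
    (hfill : ∀ t ∈ box n vs.length, ∀ τ, vs.map (fun v => τ.nat v []) = t →
      Frame (reps vs sizeVar (fill ;; absorb A u)) σ τ →
        ∀ c < σ.nat u [], vec (fill.den τ) equationArr c = row t c)
    (init : KernelBasis (σ.nat u []) (mat σ A) (range (σ.nat u [])) ∅) :
    ∃ S, KernelBasis (σ.nat u []) (mat ((reps vs sizeVar (fill ;; absorb A u)).den σ) A) S
        (row '' (box n vs.length)) ∧
      ∀ m ≤ σ.nat u [], ∀ y : ℕ → ℕ → K,
        (∀ i < m, ∀ t ∈ box n vs.length, dot (σ.nat u []) (row t) (y i) = 0) →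
        (∀ i < m, ∀ j < m, y i j = if i = j then 1 else 0) → range m ⊆ S := by
  have hkeepFill : fill.KeepsEnv :=
    hkeep.mono (fun a ha => mem_natWrites_reps.2 (.inr (List.mem_append_left _ ha)))
      (fun a ha => by simp [ha])
  have hu' : ∀ {c : Cmd}, c.KeepsEnv → u ∉ c.natWrites := fun hc => hc.1 u (by
    simp only [List.mem_cons, List.not_mem_nil, or_false] at hu ⊢; tauto)
  have main := den_reps_induction (σ := σ) safe (fun P τ =>
    ∃ S, KernelBasis (σ.nat u []) (mat τ A) S (row '' P) ∧ ∀ m ≤ σ.nat u [], ∀ y : ℕ → ℕ → K,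
      (∀ i < m, ∀ t ∈ box n vs.length, dot (σ.nat u []) (row t) (y i) = 0) →
      (∀ i < m, ∀ j < m, y i j = if i = j then 1 else 0) → range m ⊆ S)
    (fun _ _ _ _ _ h => h)
    ⟨range (σ.nat u []), by simpa using init, fun m hm _ _ _ => range_subset_range.2 hm⟩ ?_
  · rwa [hσ.size] at main
  rw [hσ.size]
  rintro t ht P hP - τ hτ hF ⟨S, hS, hmS⟩
  have hτu : (fill.den τ).nat u = σ.nat u := by
    rw [(frame_den fill τ).nat u (hu' hkeepFill), hF.nat u (hu' hkeep)]
  have hmat : mat (fill.den τ) A = mat τ A := by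
    unfold mat; rw [(frame_den fill τ).field A hfillA]
  have henv := (hσ.of_frame hF hkeep).of_frame (frame_den fill τ) hkeepFill
  obtain ⟨S', hS', hmS'⟩ := den_absorb_kernelBasis (u := u) hA
    (by simp only [List.mem_cons, List.not_mem_nil, or_false] at hu; omega) henv.zero
    henv.zeroNat (by rwa [hτu]) (by rwa [hτu, hmat]) (by rw [hτu]; exact hfill t ht τ hτ hF)
  rw [hτu] at hS' hmS'
  refine ⟨S', by rw [coe_insert, Set.image_insert_eq]; exact hS', fun m hm y hy hyy =>
    hmS' m y (hmS m hm y hy hyy) (fun i hi z hz => ?_) hyy⟩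
  rcases hz with rfl | ⟨t', ht', rfl⟩
  exacts [hy i hi t ht, hy i hi t' (hP ht')]

end AbsorbLoop

section Digits

variable {n a b c x : ℕ}

theorem index₂_div (hb : b < n) : (a * n + b) / n = a := by
  rw [mul_comm, Nat.mul_add_div (by omega), Nat.div_eq_of_lt hb, add_zero]

theorem index₂_mod (hb : b < n) : (a * n + b) % n = b := by
  rw [mul_comm, Nat.mul_add_mod, Nat.mod_eq_of_lt hb]

theorem index₃_div (hb : b < n) (hc : c < n) :
    (a * (n * n) + b * n + c) / (n * n) = a ∧ (a * (n * n) + b * n + c) / n % n = b ∧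
      (a * (n * n) + b * n + c) % n = c := by
  have h : a * (n * n) + b * n + c = (a * n + b) * n + c := by ring
  rw [h, ← Nat.div_div_eq_div_mul, index₂_div hc, index₂_div hb, index₂_mod hb, index₂_mod hc]
  exact ⟨rfl, rfl, rfl⟩

theorem index₃_lt (ha : a < n) (hb : b < n) (hc : c < n) :
    a * (n * n) + b * n + c < n * (n * n) := by
  have : b * n + c < n * n := by nlinarith
  nlinarith

theorem exists_index₂ (hx : x < n * n) : ∃ a < n, ∃ b < n, x = a * n + b :=
  ⟨x / n, Nat.div_lt_of_lt_mul hx, x % n, Nat.mod_lt _ (Nat.pos_of_lt_mul_left hx),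
    (Nat.div_add_mod' x n).symm⟩

theorem exists_index₃ (hx : x < n * (n * n)) :
    ∃ a < n, ∃ b < n, ∃ c < n, x = a * (n * n) + b * n + c := by
  have hxn : x / n < n * n := Nat.div_lt_of_lt_mul hx
  obtain ⟨a, ha, b, hb, hab⟩ := exists_index₂ hxn
  refine ⟨a, ha, b, hb, x % n, Nat.mod_lt _ (Nat.pos_of_lt_mul_right hx), ?_⟩
  rw [← Nat.div_add_mod' x n, hab]
  simp only [Nat.mul_add_mod_self_right, Nat.mod_mod]
  ring

end Digits

section Annihilator

open Finset

variable {K : Type u} [Field K] {n : ℕ} {F : List ℕ → K} {σ τ : State K}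

theorem den_seq (p q : Cmd) (σ : State K) : (p ;; q).den σ = q.den (p.den σ) := rfl

theorem setField_add_zero (τ : State K) (r : Ref) : τ.setField r (τ.getField r + 0) = τ := by
  cases τ
  simp only [add_zero, State.setField, State.getField, State.mk.injEq, true_and, and_true]
  funext x l
  split_ifs with h
  · rw [h.1, h.2]
  · rfl

theorem den_ite_add {b : Cond} {r : Ref} {p q : Cmd} {x y : K}
    (hp : p.den τ = τ.setField r (τ.getField r + x))
    (hq : q.den τ = τ.setField r (τ.getField r + y)) [Decidable (b.Holds τ)] :
    (ite b p q).den τ = τ.setField r (τ.getField r + if b.Holds τ then x else y) := by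
  rw [den]
  split_ifs with h
  exacts [hp, hq]

theorem den_addIfEq (τ : State K) (v w : ℕ) (r s : Ref) :
    (addIfEq v w r s).den τ = τ.setField r
      (τ.getField r + if τ.nat v [] = τ.nat w [] then τ.getField s else 0) := by
  classical
  refine (den_ite_add (b := .natEq (var v) (var w)) (p := instr (.fieldAdd r r s)) (q := skip)
    rfl (setField_add_zero τ r).symm).trans ?_
  simp only [Cond.Holds, State.getNat, State.idx, List.map_nil]

theorem den_index₃ (hτ : Env n F τ) {a b c : ℕ} (hc : c ≠ indexVar) (ha : τ.nat a [] < n)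
    (hb : τ.nat b [] < n) :
    (index₃ a b c).den τ =
      τ.setNat (var indexVar) (τ.nat a [] * (n * n) + τ.nat b [] * n + τ.nat c []) := by
  simp only [index₃, den, Instr.exec, State.setNat, State.getNat, State.idx, List.map_nil,
    List.map_cons, hτ.mult _ hb, hτ.sqMult _ ha, hc, false_and, if_false, and_self, if_true]
  congr 1
  funext x l
  split_ifs <;> rfl

/-- The coefficient of `x_a x_b x_c` in a partial derivative, in terms of the coefficients of the
quartic form. -/
def derivCoeff (F : List ℕ → K) (i j a b c : ℕ) : K :=
  F [i, j, a, b, c] + (if a = j then F [i, j, a, b, c] else 0) +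
    (if b = j then F [i, j, a, b, c] else 0) + (if c = j then F [i, j, a, b, c] else 0)

/-- The coefficients of the partial derivative with the indices `t`, as a vector. -/
def derivVec (n : ℕ) (F : List ℕ → K) (t : List ℕ) (x : ℕ) : K :=
  derivCoeff F (t.getD 0 0) (t.getD 1 0) (x / (n * n)) (x / n % n) (x % n)

theorem den_derivativeEntry (hτ : Env n F τ) (ha : τ.nat aVar [] < n) (hb : τ.nat bVar [] < n)
    (x : ℕ) :
    vec (derivativeEntry.den τ) equationArr x =
      if x = τ.nat aVar [] * (n * n) + τ.nat bVar [] * n + τ.nat cVar [] then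
        derivCoeff F (τ.nat iVar []) (τ.nat jVar []) (τ.nat aVar []) (τ.nat bVar [])
          (τ.nat cVar [])
      else vec τ equationArr x := by
  simp only [derivativeEntry, den_seq, den_index₃ hτ (c := cVar) (by decide) ha hb, den_addIfEq]
  generalize τ.nat aVar [] * (n * n) + τ.nat bVar [] * n + τ.nat cVar [] = y
  by_cases h : x = y <;>
    simp [vec, copy, den, Instr.exec, State.setNat, State.setField, State.getField, State.idx, h,
      hτ.zero, hτ.input, derivCoeff]

theorem den_derivativeRow (hσ : Env n F σ) :
    ∀ a < n, ∀ b < n, ∀ c < n,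
      vec (derivativeRow.den σ) equationArr (a * (n * n) + b * n + c) =
        derivCoeff F (σ.nat iVar []) (σ.nat jVar []) a b c := by
  have main := den_reps_forall (σ := σ) (vs := [aVar, bVar, cVar]) (u := sizeVar)
    (p := derivativeEntry) (by decide) (fun _ _ => True)
    (fun t τ => ∀ a b c, t = [a, b, c] → b < n → c < n →
      vec τ equationArr (a * (n * n) + b * n + c) =
        derivCoeff F (σ.nat iVar []) (σ.nat jVar []) a b c)
    (fun _ _ _ _ _ => ⟨id, id⟩) (fun _ _ => trivial) ?_
  · exact fun a ha b hb c hc => main [a, b, c] (by simp [mem_box, hσ.size, ha, hb, hc]) a b c rfl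
      hb hc
  rintro _ ht τ rfl hF
  have hentry := den_derivativeEntry (hσ.of_frame hF (by decide))
  simp only [List.map_cons, List.map_nil, mem_box, List.mem_cons, List.not_mem_nil, or_false,
    forall_eq_or_imp, forall_eq, hσ.size] at ht
  obtain ⟨-, ha, hb, hc⟩ := ht
  refine ⟨fun _ a b c habc _ _ => ?_, fun t hne => ⟨id, fun h a b c habc hb' hc' => ?_⟩⟩
  · simp only [List.map_cons, List.map_nil, List.cons.injEq, and_true] at habc
    obtain ⟨rfl, rfl, rfl⟩ := habc
    rw [hentry ha hb, if_pos rfl, hF.nat iVar (by decide), hF.nat jVar (by decide)]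
  · rw [hentry ha hb, if_neg, h a b c habc hb' hc']
    intro heq
    have hdiv := index₃_div (a := a) hb' hc'
    rw [heq] at hdiv
    obtain ⟨ha₁, hb₁, hc₁⟩ := index₃_div (a := τ.nat aVar []) hb hc
    rw [ha₁, hb₁, hc₁] at hdiv
    exact hne (by simp [habc, hdiv])

theorem den_annihilator (hσ : Env n F σ) (hn : 0 < n) :
    ∃ S, KernelBasis (n * (n * n)) (mat (annihilator.den σ) annihilatorArr) S
      (derivVec n F '' (box n 2)) := by
  have henv : Env n F ((initBasis annihilatorArr sizeCubeVar).den σ) :=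
    hσ.of_frame (frame_den _ σ) (by decide)
  have hbasis := den_initBasis (A := annihilatorArr) (u := sizeCubeVar) (by decide) σ
  have loop := den_absorb_loop (A := annihilatorArr) (u := sizeCubeVar) (vs := [iVar, jVar])
    (fill := derivativeRow) henv (by decide) (by decide)
    (by rw [henv.cube]; positivity) (by decide) (by decide) (by decide) (derivVec n F)
  rw [henv.cube] at loop
  rw [hσ.cube] at hbasis
  refine (loop ?_ (.initial hbasis)).imp fun S hS => hS.1
  rintro _ - τ rfl hF c hc
  obtain ⟨a, ha, b, hb, c, hc', rfl⟩ := exists_index₃ hc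
  obtain ⟨ha₁, hb₁, hc₁⟩ := index₃_div (a := a) hb hc'
  rw [den_derivativeRow (henv.of_frame hF (by decide)) a ha b hb c hc']
  simp [derivVec, ha₁, hb₁, hc₁]

end Annihilator

section Quotient

open Finset

variable {K : Type u} [Field K] {n : ℕ} {F : List ℕ → K} {σ τ : State K}

theorem den_addFunctionalUnless (vs : List ℕ) (τ : State K) :
    (addFunctionalUnless vs).den τ = τ.setField ⟨equationArr, [pairVar]⟩
      (τ.getField ⟨equationArr, [pairVar]⟩ + if ∃ v ∈ vs, τ.nat v [] = τ.nat kVar [] then 0 else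
        τ.getField ⟨annihilatorArr, [functionalVar, indexVar]⟩) := by
  induction vs with
  | nil => simp [addFunctionalUnless, den, Instr.exec]
  | cons v vs ih =>
    classical
    refine (den_ite_add (b := .natEq (var v) (var kVar)) (p := skip) (q := addFunctionalUnless vs)
      (setField_add_zero τ _).symm ih).trans ?_
    simp only [Cond.Holds, State.getNat, State.idx, List.map_nil, List.exists_mem_cons_iff, ite_or]

/-- The value at the product of `x_k` and `x_a x_b` of a functional on tables of cubic forms. -/
def quotCoeff (n : ℕ) (y : ℕ → K) (k a b : ℕ) : K :=
  y (k * (n * n) + a * n + b) + (if a = k then 0 else y (a * (n * n) + k * n + b)) +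
    (if a = k ∨ b = k then 0 else y (a * (n * n) + b * n + k))

/-- The functional on quadratic forms that takes `q` to the value at `x_k q` of a functional on
cubic forms; the functional is a row of `N`, and `t` consists of the digits of its index and `k`. -/
def quotVec (n : ℕ) (N : ℕ → ℕ → K) (t : List ℕ) (x : ℕ) : K :=
  quotCoeff n (N (t.getD 0 0 * (n * n) + t.getD 1 0 * n + t.getD 2 0)) (t.getD 3 0) (x / n) (x % n)

theorem den_quotientEntry (hτ : Env n F τ) (hk : τ.nat kVar [] < n) (ha : τ.nat aVar [] < n)
    (hb : τ.nat bVar [] < n) (x : ℕ) :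
    vec (quotientEntry.den τ) equationArr x =
      if x = τ.nat aVar [] * n + τ.nat bVar [] then
        quotCoeff n (mat τ annihilatorArr (τ.nat functionalVar [])) (τ.nat kVar [])
          (τ.nat aVar []) (τ.nat bVar [])
      else vec τ equationArr x := by
  simp only [quotientEntry, den_seq, den_addFunctionalUnless]
  by_cases h : x = τ.nat aVar [] * n + τ.nat bVar [] <;>
    simp [vec, mat, index₃, copy, den, Instr.exec, State.setNat, State.setField, State.getNat,
      State.getField, State.idx, h, hτ.zero, hτ.mult _ ha, hτ.mult _ hb, hτ.mult _ hk,
      hτ.sqMult _ ha, hτ.sqMult _ hk, quotCoeff]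

theorem den_quotientRow (hσ : Env n F σ) (hk : σ.nat kVar [] < n) :
    ∀ a < n, ∀ b < n, vec (quotientRow.den σ) equationArr (a * n + b) =
      quotCoeff n (mat σ annihilatorArr (σ.nat functionalVar [])) (σ.nat kVar []) a b := by
  have main := den_reps_forall (σ := σ) (vs := [aVar, bVar]) (u := sizeVar) (p := quotientEntry)
    (by decide) (fun _ _ => True)
    (fun t τ => ∀ a b, t = [a, b] → b < n → vec τ equationArr (a * n + b) =
      quotCoeff n (mat σ annihilatorArr (σ.nat functionalVar [])) (σ.nat kVar []) a b)
    (fun _ _ _ _ _ => ⟨id, id⟩) (fun _ _ => trivial) ?_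
  · exact fun a ha b hb => main [a, b] (by simp [mem_box, hσ.size, ha, hb]) a b rfl hb
  rintro _ ht τ rfl hF
  have hkτ := congrFun (hF.nat kVar (by decide)) []
  have hentry := den_quotientEntry (hσ.of_frame hF (by decide)) (by rwa [hkτ])
  simp only [List.map_cons, List.map_nil, mem_box, List.mem_cons, List.not_mem_nil, or_false,
    forall_eq_or_imp, forall_eq, hσ.size] at ht
  obtain ⟨-, ha, hb⟩ := ht
  refine ⟨fun _ a b hab _ => ?_, fun t hne => ⟨id, fun h a b hab hb' => ?_⟩⟩
  · simp only [List.map_cons, List.map_nil, List.cons.injEq, and_true] at hab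
    obtain ⟨rfl, rfl⟩ := hab
    rw [hentry ha hb, if_pos rfl, hkτ, hF.nat functionalVar (by decide)]
    unfold mat
    rw [hF.field annihilatorArr (by decide)]
  · rw [hentry ha hb, if_neg, h a b hab hb']
    intro heq
    have hdiv := index₂_div (a := a) hb'
    have hmod := index₂_mod (a := a) hb'
    rw [heq] at hdiv hmod
    exact hne (by simp [hab, ← hdiv, ← hmod, index₂_div hb, index₂_mod hb])

theorem den_selectFunctional (hτ : Env n F τ) (hi : τ.nat iVar [] < n) (hj : τ.nat jVar [] < n) :
    (selectFunctional.den τ).nat functionalVar [] =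
      τ.nat iVar [] * (n * n) + τ.nat jVar [] * n + τ.nat lVar [] := by
  simp [selectFunctional, den_seq, den_index₃ hτ, hi, hj, den, Instr.exec, State.setNat,
    State.getNat, State.idx, hτ.zeroNat]

theorem den_quotient (hσ : Env n F σ) (hn : 0 < n) :
    ∃ S, KernelBasis (n * n) (mat (quotient.den σ) quotientFormArr) S
      (quotVec n (mat σ annihilatorArr) '' (box n 4)) := by
  have hinit : Frame (initBasis quotientFormArr sizeSqVar) σ _ := frame_den _ σ
  have henv := hσ.of_frame hinit (by decide)
  have hbasis := den_initBasis (A := quotientFormArr) (u := sizeSqVar) (by decide) σ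
  have loop := den_absorb_loop (A := quotientFormArr) (u := sizeSqVar)
    (vs := [iVar, jVar, lVar, kVar]) (fill := selectFunctional ;; quotientRow) henv (by decide)
    (by decide) (by rw [henv.square]; positivity) (by decide) (by decide) (by decide)
    (quotVec n (mat σ annihilatorArr))
  rw [henv.square] at loop
  rw [hσ.square] at hbasis
  refine (loop ?_ (.initial hbasis)).imp fun S hS => hS.1
  rintro _ ht τ rfl hF c hc
  simp only [List.map_cons, List.map_nil, mem_box, List.mem_cons, List.not_mem_nil, or_false,
    forall_eq_or_imp, forall_eq] at ht
  obtain ⟨-, hi, hj, -, hk⟩ := ht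
  obtain ⟨a, ha, b, hb, rfl⟩ := exists_index₂ hc
  have hτ : Env n F τ := henv.of_frame hF (by decide)
  have hsel : Frame selectFunctional τ _ := frame_den _ τ
  have hkeep : mat (selectFunctional.den τ) annihilatorArr = mat σ annihilatorArr := by
    unfold mat
    rw [hsel.field _ (by decide), hF.field _ (by decide), hinit.field _ (by decide)]
  have hkVar := congrFun (hsel.nat kVar (by decide)) []
  rw [den_seq, den_quotientRow (hτ.of_frame hsel (by decide)) (by rwa [hkVar]) a ha b hb,
    den_selectFunctional hτ hi hj, hkeep, hkVar]
  simp [quotVec, index₂_div hb, index₂_mod hb]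

end Quotient

section Extract

open Finset

variable {K : Type u} [Field K] {n : ℕ} {F : List ℕ → K} {σ τ : State K}

open Classical in
/-- The number of nonzero diagonal entries of `N` before the row `k`. -/
noncomputable def rankBefore (N : ℕ → ℕ → K) (k : ℕ) : ℕ := #{s ∈ range k | N s s ≠ 0}

theorem rankBefore_succ_of_eq {N : ℕ → ℕ → K} {k : ℕ} (h : N k k = 0) :
    rankBefore N (k + 1) = rankBefore N k := by
  simp [rankBefore, range_add_one, filter_insert, h]

theorem rankBefore_succ_of_ne {N : ℕ → ℕ → K} {k : ℕ} (h : N k k ≠ 0) :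
    rankBefore N (k + 1) = rankBefore N k + 1 := by
  rw [rankBefore, range_add_one, filter_insert, if_pos h, card_insert_of_notMem (by simp)]
  rfl

theorem rankBefore_mono (N : ℕ → ℕ → K) : Monotone (rankBefore N) := by
  classical
  exact fun _ _ h => card_le_card (filter_subset_filter _ (range_subset_range.2 h))

theorem den_copyForm (hσ : Env n F σ) :
    (∀ a < n, ∀ b < n, (copyForm.den σ).field rightArr [σ.nat countVar [], a, b] =
      mat σ quotientFormArr (σ.nat rowVar []) (a * n + b)) ∧
    ∀ m ≠ σ.nat countVar [], ∀ l,
      (copyForm.den σ).field rightArr (m :: l) = σ.field rightArr (m :: l) := by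
  have main := den_reps_induction (σ := σ) (vs := [aVar, bVar]) (u := sizeVar)
    (p := instr (.natAdd (var indexVar) ⟨multTable, [aVar]⟩ (var bVar)) ;;
      copy ⟨rightArr, [countVar, aVar, bVar]⟩ ⟨quotientFormArr, [rowVar, indexVar]⟩)
    (by decide)
    (fun P τ => (∀ a b, [a, b] ∈ P → τ.field rightArr [σ.nat countVar [], a, b] =
      mat σ quotientFormArr (σ.nat rowVar []) (a * n + b)) ∧
      ∀ m ≠ σ.nat countVar [], ∀ l, τ.field rightArr (m :: l) = σ.field rightArr (m :: l))
    (fun _ _ _ _ _ h => h) (by simp) ?_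
  · exact ⟨fun a ha b hb => main.1 a b (by simp [mem_box, hσ.size, ha, hb]), main.2⟩
  rintro _ ht P - - τ rfl hF ⟨hP, hother⟩
  have hτ : Env n F τ := hσ.of_frame hF (by decide)
  simp only [List.map_cons, List.map_nil, mem_box, List.mem_cons, List.not_mem_nil, or_false,
    forall_eq_or_imp, forall_eq, hσ.size] at ht
  have hwrite : ∀ l, ((instr (.natAdd (var indexVar) ⟨multTable, [aVar]⟩ (var bVar)) ;;
      copy ⟨rightArr, [countVar, aVar, bVar]⟩ ⟨quotientFormArr, [rowVar, indexVar]⟩).den τ).field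
        rightArr l = if l = [σ.nat countVar [], τ.nat aVar [], τ.nat bVar []] then
          mat σ quotientFormArr (σ.nat rowVar []) (τ.nat aVar [] * n + τ.nat bVar [])
        else τ.field rightArr l := by
    intro l
    simp [den, copy, Instr.exec, State.getNat, State.setNat, State.idx, State.setField,
      State.getField, mat, hτ.zero, hτ.mult _ ht.2.1, hF.nat countVar (by decide),
      hF.nat rowVar (by decide), hF.field quotientFormArr (by decide)]
  refine ⟨fun a b hab => ?_, fun m hm l => ?_⟩
  · rw [hwrite]
    rcases mem_insert.1 hab with h | h
    · simp only [List.map_cons, List.map_nil, List.cons.injEq, and_true] at h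
      rw [if_pos (by rw [h.1, h.2]), h.1, h.2]
    · split_ifs with heq
      · simp only [List.cons.injEq, true_and, and_true] at heq
        rw [heq.1, heq.2]
      · exact hP a b h
  · rw [hwrite, if_neg (by simp [hm]), hother m hm]

theorem den_appendForm_of_eq (hτ : τ.field zeroArr [] = 0)
    (h : mat τ quotientFormArr (τ.nat rowVar []) (τ.nat rowVar []) = 0) :
    appendForm.den τ = τ :=
  if_pos (Eq.trans h hτ.symm)

theorem den_appendForm_of_ne (hτ : τ.field zeroArr [] = 0)
    (h : mat τ quotientFormArr (τ.nat rowVar []) (τ.nat rowVar []) ≠ 0) :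
    (appendForm.den τ).nat countVar [] = τ.nat countVar [] + 1 ∧
      (appendForm.den τ).field = (copyForm.den τ).field := by
  have hden : appendForm.den τ = _ := if_neg fun h' => h (Eq.trans h' hτ)
  have hcount := congrFun ((frame_den copyForm τ).nat countVar (by decide)) []
  rw [hden]
  simp [den, Instr.exec, State.setNat, State.getNat, State.idx, hcount]

theorem den_extract (hσ : Env n F σ) :
    ∀ s < n * n, mat σ quotientFormArr s s ≠ 0 → ∀ a < n, ∀ b < n,
      (extract.den σ).field rightArr [rankBefore (mat σ quotientFormArr) s, a, b] =
        mat σ quotientFormArr s (a * n + b) := by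
  set N := mat σ quotientFormArr with hN
  set σ₀ := (instr (.natConst (var countVar) 0)).den σ with hσ₀
  have hσ₀F : Frame _ σ σ₀ := frame_den _ σ
  have hsq : σ₀.nat sizeSqVar [] = n * n := by rw [hσ₀F.nat _ (by decide), hσ.square]
  have main := den_rep_induction (v := rowVar) (u := sizeSqVar) (p := appendForm) (σ := σ₀)
    (fun k τ => τ.nat countVar [] = rankBefore N k ∧ ∀ s < k, N s s ≠ 0 → ∀ a < n, ∀ b < n,
      τ.field rightArr [rankBefore N s, a, b] = N s (a * n + b))
    (fun _ _ _ _ h => h) (fun _ h => h)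
    ⟨by simp [hσ₀, den, Instr.exec, State.setNat, State.idx, rankBefore], by simp⟩ ?_
  · rw [hsq] at main
    exact main.2
  rintro k τ - hk hF ⟨hcount, hprev⟩
  have hτ : Env n F τ := (hσ.of_frame hσ₀F (by decide)).of_frame hF (by decide)
  have hmat : mat τ quotientFormArr = N := by
    unfold mat at hN ⊢
    rw [hN, hF.field quotientFormArr (by decide), hσ₀F.field quotientFormArr (by decide)]
  obtain ⟨hnew, hold⟩ := den_copyForm hτ
  rw [hmat, hk, hcount] at hnew
  rw [hcount] at hold
  rcases eq_or_ne (N k k) 0 with hkk | hkk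
  · rw [den_appendForm_of_eq hτ.zero (by rwa [hmat, hk]), rankBefore_succ_of_eq hkk]
    refine ⟨hcount, fun s hs hss => hprev s ?_ hss⟩
    exact (Nat.le_of_lt_succ hs).lt_of_ne fun h => hss (h ▸ hkk)
  · obtain ⟨happend, hfield⟩ := den_appendForm_of_ne hτ.zero (by rwa [hmat, hk])
    rw [happend, hfield, hcount, rankBefore_succ_of_ne hkk]
    refine ⟨rfl, fun s hs hss a ha b hb => ?_⟩
    rcases Nat.lt_succ_iff_lt_or_eq.1 hs with hs | rfl
    · have hlt : rankBefore N s < rankBefore N k :=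
        (rankBefore_succ_of_ne hss).symm.trans_le (rankBefore_mono N (Nat.succ_le_of_lt hs))
      rw [hold _ hlt.ne, hprev s hs hss a ha b hb]
    · exact hnew a ha b hb

end Extract

section LeftFactor

open Finset

variable {K : Type u} [Field K] {n : ℕ} {F : List ℕ → K} {σ τ : State K}

/-- A number that determines the monomial `x_a x_b x_c x_d`. The base exceeds the degree, so there
are no carries. -/
def monKey (a b c d : ℕ) : ℕ := 5 ^ a + 5 ^ b + 5 ^ c + 5 ^ d

/-- The contribution of `x_a x_b` and `x_c x_d` to the coefficient with the key `κ` in the product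
of the quadratic forms `l` and `m` of the table `H`. -/
def prodTerm (H : List ℕ → K) (l m κ : ℕ) : List ℕ → K
  | [a, b, c, d] => if b < a ∨ d < c then 0 else
      if monKey a b c d = κ then H [l, a, b] * H [m, c, d] else 0
  | _ => 0

/-- The coefficient with the key `κ` in the product of the quadratic forms `l` and `m` of the table
`H`, or zero if `m < l`. -/
def prodCoeff (n : ℕ) (H : List ℕ → K) (l m κ : ℕ) : K :=
  if m < l then 0 else ∑ t ∈ box n 4, prodTerm H l m κ t

/-- The coefficients of the monomial `t` in the forms of `F` and in the negatives of the products of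
the quadratic forms of the table `H`, as a vector. -/
def compVec (n : ℕ) (F H : List ℕ → K) (t : List ℕ) (x : ℕ) : K :=
  if x < n then F (x :: t) else
    -prodCoeff n H ((x - n) / n) ((x - n) % n)
      (monKey (t.getD 0 0) (t.getD 1 0) (t.getD 2 0) (t.getD 3 0))

theorem den_monomialKey (hτ : Env n F τ) {v a b c d : ℕ} (hv : v ≠ powTable) (hcv : c ≠ v)
    (hdv : d ≠ v) (ha : τ.nat a [] < n) (hb : τ.nat b [] < n) (hc : τ.nat c [] < n)
    (hd : τ.nat d [] < n) :
    (monomialKey v a b c d).den τ = τ.setNat (var v)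
      (monKey (τ.nat a []) (τ.nat b []) (τ.nat c []) (τ.nat d [])) := by
  simp only [monomialKey, den, Instr.exec, State.setNat, State.getNat, State.idx, List.map_nil,
    List.map_cons, hcv, hdv, hv.symm, false_and, if_false, and_self, if_true, hτ.pow _ ha,
    hτ.pow _ hb, hτ.pow _ hc, hτ.pow _ hd, monKey]
  congr 1
  funext x l
  split_ifs <;> rfl

theorem den_productTerm (hτ : Env n F τ) (hp : τ.nat pVar [] < n) (hq : τ.nat qVar [] < n)
    (hr : τ.nat rVar [] < n) (hs : τ.nat sVar [] < n) :
    (productTerm.den τ).field sumArr [] = τ.field sumArr [] +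
      prodTerm (τ.field rightArr) (τ.nat lVar []) (τ.nat mVar []) (τ.nat keyVar [])
        [τ.nat pVar [], τ.nat qVar [], τ.nat rVar [], τ.nat sVar []] := by
  have hkey := den_monomialKey hτ (v := productKeyVar) (by decide) (by decide) (by decide)
    hp hq hr hs
  by_cases hqp : τ.nat qVar [] < τ.nat pVar []
  · simp [productTerm, prodTerm, den, Cond.Holds, State.getNat, State.idx, hqp]
  by_cases hsr : τ.nat sVar [] < τ.nat rVar []
  · simp [productTerm, prodTerm, den, Cond.Holds, State.getNat, State.idx, hsr]
  by_cases hκ : monKey (τ.nat pVar []) (τ.nat qVar []) (τ.nat rVar []) (τ.nat sVar []) =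
      τ.nat keyVar []
  all_goals
    simp [productTerm, prodTerm, den, hkey, Cond.Holds, Instr.exec, State.setNat, State.setField,
      State.getNat, State.getField, State.idx, hqp, hsr, hκ]

theorem den_productCoeff (hσ : Env n F σ) :
    (productCoeff.den σ).field sumArr [] =
      prodCoeff n (σ.field rightArr) (σ.nat lVar []) (σ.nat mVar []) (σ.nat keyVar []) := by
  set σ₀ := (instr (.fieldZero (var sumArr))).den σ with hσ₀
  have hzero : σ₀.field sumArr [] = 0 := by simp [hσ₀, den, Instr.exec, State.setField, State.idx]
  have hσ₀F : Frame (instr (.fieldZero (var sumArr))) σ σ₀ := frame_den _ σ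
  have henv : Env n F σ₀ := hσ.of_frame hσ₀F (by decide)
  have hsum := den_reps_sum (σ := σ₀) (vs := [pVar, qVar, rVar, sVar]) (u := sizeVar)
    (p := productTerm) (by decide) (fun τ => τ.field sumArr [])
    (prodTerm (σ.field rightArr) (σ.nat lVar []) (σ.nat mVar []) (σ.nat keyVar []))
    (fun _ _ _ _ => rfl) ?_
  · rw [henv.size, hzero, zero_add] at hsum
    rw [prodCoeff, productCoeff, den_seq, ← hσ₀, den]
    by_cases hml : σ.nat mVar [] < σ.nat lVar []
    · rwa [if_pos hml, if_pos (show Cond.Holds σ₀ (.natLt (var mVar) (var lVar)) from hml)]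
    · rwa [if_neg hml, if_neg (show ¬Cond.Holds σ₀ (.natLt (var mVar) (var lVar)) from hml)]
  rintro _ ht τ rfl hF
  simp only [List.map_cons, List.map_nil, mem_box, List.mem_cons, List.not_mem_nil, or_false,
    forall_eq_or_imp, forall_eq, henv.size] at ht
  obtain ⟨-, hp, hq, hr, hs⟩ := ht
  rw [den_productTerm (henv.of_frame hF (by decide)) hp hq hr hs, hF.nat lVar (by decide),
    hF.nat mVar (by decide), hF.nat keyVar (by decide), hF.field rightArr (by decide),
    hσ₀F.field rightArr (by decide)]
  rfl

theorem den_pairIndex (hτ : Env n F τ) (hl : τ.nat lVar [] < n) :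
    pairIndex.den τ = τ.setNat (var indexVar) (n + τ.nat lVar [] * n + τ.nat mVar []) := by
  simp only [pairIndex, den, Instr.exec, State.setNat, State.getNat, State.idx, List.map_nil,
    List.map_cons, hτ.mult _ hl, hτ.size, Nat.reduceEqDiff, false_and, if_false, and_self, if_true]
  congr 1
  funext x l
  split_ifs <;> rfl

theorem den_inputRow (hσ : Env n F σ) :
    ∀ i < n, vec (inputRow.den σ) equationArr i =
      F [i, σ.nat aVar [], σ.nat bVar [], σ.nat cVar [], σ.nat dVar []] := by
  have main := den_reps_forall (σ := σ) (vs := [iVar]) (u := sizeVar)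
    (p := copy ⟨equationArr, [iVar]⟩ ⟨inputArr, [iVar, aVar, bVar, cVar, dVar]⟩) (by decide)
    (fun _ _ => True)
    (fun t τ => τ.field equationArr t =
      F (t ++ [σ.nat aVar [], σ.nat bVar [], σ.nat cVar [], σ.nat dVar []]))
    (fun _ _ _ _ _ => ⟨id, id⟩) (fun _ _ => trivial) ?_
  · exact fun i hi => main [i] (by simp [mem_box, hσ.size, hi])
  rintro _ - τ rfl hF
  have hτ : Env n F τ := hσ.of_frame hF (by decide)
  refine ⟨fun _ => ?_, fun s hs => ⟨id, fun h => ?_⟩⟩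
  · simp [copy, den, Instr.exec, State.setField, State.getField, State.idx, hτ.zero, hτ.input,
      hF.nat aVar (by decide), hF.nat bVar (by decide), hF.nat cVar (by decide),
      hF.nat dVar (by decide)]
  · rw [← h]
    exact if_neg fun h' => hs h'.2

theorem den_productEntry (hτ : Env n F τ) (hl : τ.nat lVar [] < n) (x : ℕ) :
    vec (productEntry.den τ) equationArr x =
      if x = n + τ.nat lVar [] * n + τ.nat mVar [] then
        -prodCoeff n (τ.field rightArr) (τ.nat lVar []) (τ.nat mVar []) (τ.nat keyVar [])
      else vec τ equationArr x := by
  have hcoeff : Frame productCoeff τ _ := frame_den _ τ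
  have henv : Env n F (productCoeff.den τ) := hτ.of_frame hcoeff (by decide)
  rw [productEntry, den_seq, den_seq,
    den_pairIndex henv (by rwa [hcoeff.nat lVar (by decide)]), hcoeff.nat lVar (by decide),
    hcoeff.nat mVar (by decide), ← den_productCoeff hτ]
  simp [vec, den, Instr.exec, State.setField, State.setNat, State.getField, State.idx, henv.zero,
    hcoeff.field equationArr (by decide)]

theorem den_productEntries (hσ : Env n F σ) :
    (∀ i < n, vec ((reps [lVar, mVar] sizeVar productEntry).den σ) equationArr i =
      vec σ equationArr i) ∧
    ∀ l < n, ∀ m < n,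
      vec ((reps [lVar, mVar] sizeVar productEntry).den σ) equationArr (n + l * n + m) =
        -prodCoeff n (σ.field rightArr) l m (σ.nat keyVar []) := by
  have main := den_reps_induction (σ := σ) (vs := [lVar, mVar]) (u := sizeVar) (p := productEntry)
    (by decide) (fun P τ => (∀ i < n, vec τ equationArr i = vec σ equationArr i) ∧
      ∀ l m, m < n → [l, m] ∈ P → vec τ equationArr (n + l * n + m) =
        -prodCoeff n (σ.field rightArr) l m (σ.nat keyVar []))
    (fun _ _ _ _ _ h => h) (by simp) ?_
  · exact ⟨main.1, fun l hl m hm => main.2 l m hm (by simp [mem_box, hσ.size, hl, hm])⟩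
  rintro _ ht P - - τ rfl hF ⟨hinput, hprod⟩
  simp only [List.map_cons, List.map_nil, mem_box, List.mem_cons, List.not_mem_nil, or_false,
    forall_eq_or_imp, forall_eq, hσ.size] at ht
  obtain ⟨-, hl, hm⟩ := ht
  have hentry := den_productEntry (hσ.of_frame hF (by decide)) hl
  rw [hF.field rightArr (by decide), hF.nat keyVar (by decide)] at hentry
  refine ⟨fun i hi => ?_, fun l m hm' hlm => ?_⟩
  · rw [hentry, if_neg (by omega), hinput i hi]
  rw [hentry]
  rcases mem_insert.1 hlm with h | h
  · simp only [List.map_cons, List.map_nil, List.cons.injEq, and_true] at h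
    obtain ⟨rfl, rfl⟩ := h
    rw [if_pos rfl]
  · split_ifs with heq
    · have hidx : l * n + m = τ.nat lVar [] * n + τ.nat mVar [] := by omega
      have hl' := congrArg (· / n) hidx
      have hm'' := congrArg (· % n) hidx
      simp only [index₂_div hm', index₂_div hm] at hl'
      simp only [index₂_mod hm', index₂_mod hm] at hm''
      rw [hl', hm'']
    · exact hprod l m hm' h

theorem den_compositionRow (hσ : Env n F σ) (ha : σ.nat aVar [] < n) (hb : σ.nat bVar [] < n)
    (hc : σ.nat cVar [] < n) (hd : σ.nat dVar [] < n) :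
    ∀ x < n * n + n, vec (compositionRow.den σ) equationArr x =
      compVec n F (σ.field rightArr)
        [σ.nat aVar [], σ.nat bVar [], σ.nat cVar [], σ.nat dVar []] x := by
  set κ := monKey (σ.nat aVar []) (σ.nat bVar []) (σ.nat cVar []) (σ.nat dVar []) with hκ
  have hkey := den_monomialKey hσ (v := keyVar) (by decide) (by decide) (by decide) ha hb hc hd
  have hkeyF : Frame (monomialKey keyVar aVar bVar cVar dVar) σ _ := frame_den _ σ
  rw [hkey, ← hκ] at hkeyF
  set σ₁ := σ.setNat (var keyVar) κ with hσ₁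
  have henv₁ : Env n F σ₁ := hσ.of_frame hkeyF (by decide)
  have hinputF : Frame inputRow σ₁ _ := frame_den _ σ₁
  have hinput := den_inputRow henv₁
  obtain ⟨hkeep, hprod⟩ := den_productEntries (henv₁.of_frame hinputF (by decide))
  rw [hinputF.nat keyVar (by decide), hinputF.field rightArr (by decide)] at hprod
  intro x hx
  rw [compositionRow, den_seq, den_seq, hkey]
  by_cases hxn : x < n
  · rw [hkeep x hxn, hinput x hxn, compVec, if_pos hxn]
    simp [hσ₁, State.setNat]
  · obtain ⟨l, hl, m, hm, hlm⟩ := exists_index₂ (n := n) (x := x - n) (by omega)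
    rw [show x = n + l * n + m by omega, hprod l hl m hm, compVec, if_neg (by omega),
      show n + l * n + m - n = l * n + m by omega, index₂_div hm, index₂_mod hm]
    simp [hσ₁, State.setNat, State.idx, hκ]

theorem den_relations (hσ : Env n F σ) (hn : 0 < n) :
    ∃ S, KernelBasis (n * n + n) (mat (relations.den σ) relationArr) S
        (compVec n F (σ.field rightArr) '' (box n 4)) ∧
      ∀ y : ℕ → ℕ → K,
        (∀ i < n, ∀ t ∈ box n 4,
          dot (n * n + n) (compVec n F (σ.field rightArr) t) (y i) = 0) →
        (∀ i < n, ∀ j < n, y i j = if i = j then 1 else 0) → range n ⊆ S := by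
  have hinit : Frame (initBasis relationArr relationSizeVar) σ _ := frame_den _ σ
  have henv := hσ.of_frame hinit (by decide)
  have hbasis := den_initBasis (A := relationArr) (u := relationSizeVar) (by decide) σ
  have loop := den_absorb_loop (A := relationArr) (u := relationSizeVar)
    (vs := [aVar, bVar, cVar, dVar]) (fill := compositionRow) henv (by decide) (by decide)
    (by rw [henv.relationSize]; positivity) (by decide) (by decide) (by decide)
    (compVec n F (σ.field rightArr))
  rw [henv.relationSize] at loop
  rw [hσ.relationSize] at hbasis
  refine (loop ?_ (.initial hbasis)).imp fun S hS => ⟨hS.1, hS.2 n (Nat.le_add_left n _)⟩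
  rintro _ ht τ rfl hF c hc
  simp only [List.map_cons, List.map_nil, mem_box, List.mem_cons, List.not_mem_nil, or_false,
    forall_eq_or_imp, forall_eq] at ht
  obtain ⟨-, ha, hb, hc', hd⟩ := ht
  rw [den_compositionRow (henv.of_frame hF (by decide)) ha hb hc' hd c hc,
    hF.field rightArr (by decide), hinit.field rightArr (by decide)]
  rfl

theorem den_writeLeft (hσ : Env n F σ) :
    ∀ i < n, ∀ l < n, ∀ m < n,
      (writeLeft.den σ).field leftArr [i, l, m] = mat σ relationArr i (n + l * n + m) := by
  have main := den_reps_forall (σ := σ) (vs := [iVar, lVar, mVar]) (u := sizeVar)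
    (p := pairIndex ;; copy ⟨leftArr, [iVar, lVar, mVar]⟩ ⟨relationArr, [iVar, indexVar]⟩)
    (by decide) (fun _ _ => True)
    (fun t τ => τ.field leftArr t = mat σ relationArr (t.getD 0 0)
      (n + t.getD 1 0 * n + t.getD 2 0))
    (fun _ _ _ _ _ => ⟨id, id⟩) (fun _ _ => trivial) ?_
  · exact fun i hi l hl m hm => main [i, l, m] (by simp [mem_box, hσ.size, hi, hl, hm])
  rintro _ ht τ rfl hF
  have hτ : Env n F τ := hσ.of_frame hF (by decide)
  simp only [List.map_cons, List.map_nil, mem_box, List.mem_cons, List.not_mem_nil, or_false,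
    forall_eq_or_imp, forall_eq, hσ.size] at ht
  rw [den_seq, den_pairIndex hτ ht.2.2.1]
  refine ⟨fun _ => ?_, fun s hs => ⟨id, fun h => ?_⟩⟩
  · simp [copy, den, Instr.exec, State.setField, State.setNat, State.getField, State.idx, hτ.zero,
      mat, hF.field relationArr (by decide)]
  · rw [← h]
    exact if_neg fun h' => hs h'.2

theorem den_detectInput (hσ : Env n F σ) (hflag : σ.nat flagVar [] = 0) :
    (detectInput.den σ).nat flagVar [] = 1 ↔ ∃ t ∈ box n 5, F t ≠ 0 := by
  rw [← hσ.size]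
  refine den_reps_induction (σ := σ) (vs := [iVar, aVar, bVar, cVar, dVar]) (u := sizeVar)
    (by decide) (fun P τ => τ.nat flagVar [] = 1 ↔ ∃ t ∈ P, F t ≠ 0) ?_ (by simp [hflag]) ?_
  · intro P τ v x hv
    have hne : flagVar ≠ v := by rintro rfl; simp at hv
    simp [State.setNat, hne]
  rintro _ - P - - τ rfl hF h
  have hτ : Env n F τ := hσ.of_frame hF (by decide)
  by_cases h0 : F ([iVar, aVar, bVar, cVar, dVar].map fun v => τ.nat v []) = 0
  · rw [den, if_pos (by simpa [Cond.Holds, State.getField, State.idx, hτ.zero, hτ.input] using h0)]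
    exact h.trans (by simp only [exists_mem_insert, h0, ne_eq, not_true_eq_false, false_or])
  · rw [den, if_neg (by simpa [Cond.Holds, State.getField, State.idx, hτ.zero, hτ.input] using h0)]
    exact iff_of_true (by simp [den, Instr.exec, State.setNat, State.idx])
      ⟨_, mem_insert_self _ _, h0⟩

theorem den_checkRelations (hσ : Env n F σ) :
    (checkRelations.den σ).nat flagVar [] = 1 ↔
      σ.nat flagVar [] = 1 ∧ ∀ i < n, mat σ relationArr i i ≠ 0 := by
  have main := den_reps_induction (σ := σ) (vs := [iVar]) (u := sizeVar)
    (p := ite (.fieldEq ⟨relationArr, [iVar, iVar]⟩ zeroCell)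
      (instr (.natConst (var flagVar) 0)) skip) (by decide)
    (fun P τ => τ.nat flagVar [] = 1 ↔
      σ.nat flagVar [] = 1 ∧ ∀ i, [i] ∈ P → mat σ relationArr i i ≠ 0) ?_ (by simp) ?_
  · refine main.trans (and_congr_right fun _ => forall_congr' fun i => ?_)
    simp [mem_box, hσ.size]
  · intro P τ v x hv
    have hne : flagVar ≠ v := by rintro rfl; simp at hv
    simp [State.setNat, hne]
  rintro _ - P - - τ rfl hF h
  have hτ : Env n F τ := hσ.of_frame hF (by decide)
  have hdiag : τ.field relationArr [τ.nat iVar [], τ.nat iVar []] =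
      mat σ relationArr (τ.nat iVar []) (τ.nat iVar []) := by
    rw [hF.field relationArr (by decide)]; rfl
  by_cases h0 : mat σ relationArr (τ.nat iVar []) (τ.nat iVar []) = 0
  · rw [den, if_pos (by simpa [Cond.Holds, State.getField, State.idx, hτ.zero, hdiag] using h0)]
    refine iff_of_false (by simp [den, Instr.exec, State.setNat, State.idx]) fun h' => ?_
    exact h'.2 _ (mem_insert_self _ _) h0
  · rw [den, if_neg (by simpa [Cond.Holds, State.getField, State.idx, hτ.zero, hdiag] using h0)]
    refine h.trans (and_congr_right fun _ => ?_)
    simp [h0]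

theorem den_announce (hσ : Env n F σ) (hflag : σ.nat flagVar [] = 0) :
    (announce.den σ).nat flagVar [] = 1 ↔
      (∃ t ∈ box n 5, F t ≠ 0) ∧ ∀ i < n, mat σ relationArr i i ≠ 0 := by
  have hdetect : Frame detectInput σ _ := frame_den _ σ
  rw [announce, den_seq, den_checkRelations (hσ.of_frame hdetect (by decide)),
    den_detectInput hσ hflag]
  unfold mat
  rw [hdetect.field relationArr (by decide)]

end LeftFactor

end Cmd

/-! ### Quadratic forms and soundness -/

section QuadraticForms

open Finset MvPolynomial

variable {K : Type u} [Field K] {n : ℕ}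

theorem sum_sym2_eq_sum_sum {M : Type*} [AddCommMonoid M] (φ : Sym2 (Fin n) → M) :
    ∑ s, φ s = ∑ a, ∑ b, if a ≤ b then φ s(a, b) else 0 := by
  rw [← Equiv.sum_comp Sym2.sortEquiv.symm,
    ← Fintype.sum_prod_type' (fun a b => if a ≤ b then φ s(a, b) else 0), ← sum_filter]
  exact (sum_subtype _ (by simp) fun p : Fin n × Fin n => φ s(p.1, p.2)).symm

theorem bind₁_quadForm (h : Fin n → MvPolynomial (Fin n) K) (c : Sym2 (Fin n) → K) :
    bind₁ h (quadForm c) = ∑ a, ∑ b, if a ≤ b then C (c s(a, b)) * (h a * h b) else 0 := by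
  rw [quadForm, map_sum, sum_sym2_eq_sum_sum]
  refine sum_congr rfl fun a _ => sum_congr rfl fun b _ => ?_
  simp [Sym2.mul]

theorem quadForm_eq_sum_sum (c : Sym2 (Fin n) → K) :
    quadForm c = ∑ a, ∑ b, if a ≤ b then C (c s(a, b)) * (X a * X b) else 0 := by
  rw [← bind₁_quadForm, bind₁_X_left]
  rfl

theorem isHomogeneous_quadForm (c : Sym2 (Fin n) → K) : (quadForm c).IsHomogeneous 2 := by
  refine IsHomogeneous.sum _ _ _ fun s _ => ?_
  induction s with | _ a b
  simpa using (isHomogeneous_C (Fin n) (c s(a, b))).mul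
    ((isHomogeneous_X K a).mul (isHomogeneous_X K b))

theorem coeff_quadForm (c : Sym2 (Fin n) → K) (a b : Fin n) :
    coeff (Finsupp.single a 1 + Finsupp.single b 1) (quadForm c) = c s(a, b) := by
  rw [quadForm, coeff_sum, sum_eq_single s(a, b)]
  · simp [Sym2.mul, X, monomial_mul]
  · intro s _
    induction s with | _ p q
    intro hs
    have hne : Finsupp.single p 1 + Finsupp.single q 1 ≠
        Finsupp.single a 1 + Finsupp.single b 1 := by
      rw [Ne, Finsupp.single_add_single_eq_single_add_single one_ne_zero one_ne_zero]
      simpa using hs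
    simp [Sym2.mul, X, monomial_mul, hne, coeff_C_mul]
  · simp

/-- The exponent of the monomial `x_a x_b x_c x_d`. -/
noncomputable def quarticMon (a b c d : Fin n) : Fin n →₀ ℕ :=
  Finsupp.single a 1 + Finsupp.single b 1 + Finsupp.single c 1 + Finsupp.single d 1

theorem exists_eq_quarticMon {m : Fin n →₀ ℕ} (hm : m.degree = 4) :
    ∃ a b c d, m = quarticMon a b c d := by
  have hcard : (Finsupp.toMultiset m).card = 4 := by rwa [Finsupp.card_toMultiset]
  obtain ⟨a, b, c, d, habcd⟩ := Multiset.card_eq_four.1 hcard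
  refine ⟨a, b, c, d, ?_⟩
  rw [← Finsupp.toMultiset_toFinsupp m, habcd]
  simp [quarticMon, Multiset.insert_eq_cons, ← Multiset.singleton_add, add_assoc]

theorem eq_of_sum_mul_pow_eq {b : ℕ} {m m' : Fin n → ℕ} (hm : ∀ x, m x < b) (hm' : ∀ x, m' x < b)
    (h : ∑ x, m x * b ^ (x : ℕ) = ∑ x, m' x * b ^ (x : ℕ)) : m = m' := by
  have hdigits : (fun x => (⟨m x, hm x⟩ : Fin b)) = fun x => ⟨m' x, hm' x⟩ :=
    finFunctionFinEquiv.injective (Fin.ext h)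
  funext x
  exact congrArg Fin.val (congrFun hdigits x)

theorem monKey_eq_iff (a b c d a' b' c' d' : Fin n) :
    Cmd.monKey a b c d = Cmd.monKey a' b' c' d' ↔ quarticMon a b c d = quarticMon a' b' c' d' := by
  have hkey : ∀ a b c d : Fin n,
      Cmd.monKey a b c d = ∑ x, quarticMon a b c d x * 5 ^ (x : ℕ) := fun a b c d => by
    simp [quarticMon, add_mul, sum_add_distrib, Finsupp.single_apply, Cmd.monKey]
  have hdigit : ∀ (a b c d : Fin n) x, quarticMon a b c d x < 5 := fun a b c d x => by
    simp only [quarticMon, Finsupp.add_apply, Finsupp.single_apply]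
    split_ifs <;> decide
  rw [hkey, hkey]
  exact ⟨fun h => DFunLike.coe_injective
    (eq_of_sum_mul_pow_eq (hdigit _ _ _ _) (hdigit _ _ _ _) h), fun h => by rw [h]⟩

theorem eq_of_coeff_quarticMon_eq {φ ψ : MvPolynomial (Fin n) K} (hφ : φ.IsHomogeneous 4)
    (hψ : ψ.IsHomogeneous 4)
    (h : ∀ a b c d, coeff (quarticMon a b c d) φ = coeff (quarticMon a b c d) ψ) : φ = ψ := by
  ext m
  by_cases hm : m.degree = 4
  · obtain ⟨a, b, c, d, rfl⟩ := exists_eq_quarticMon hm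
    exact h a b c d
  · rw [hφ.coeff_eq_zero hm, hψ.coeff_eq_zero hm]

theorem quarticTable_apply (f : Fin n → MvPolynomial (Fin n) K) (i a b c d : Fin n) :
    quarticTable f [i, a, b, c, d] = coeff (quarticMon a b c d) (f i) := by
  simp [quarticTable, quarticMon]

/-- The quadratic form with the coefficients `H [l, a, b]`, `a ≤ b`, as in `readForms`. -/
noncomputable def tableForm (H : List ℕ → K) (l : ℕ) : MvPolynomial (Fin n) K :=
  quadForm fun s => H [l, s.inf, s.sup]

theorem tableForm_eq_sum_sum (H : List ℕ → K) (l : ℕ) :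
    (tableForm H l : MvPolynomial (Fin n) K) =
      ∑ a : Fin n, ∑ b : Fin n, if a ≤ b then C (H [l, a, b]) * (X a * X b) else 0 := by
  rw [tableForm, quadForm_eq_sum_sum]
  refine sum_congr rfl fun a _ => sum_congr rfl fun b _ => ?_
  split_ifs with h
  · simp [h]
  · rfl

theorem coeff_mul_mul_mul (α β : K) (p q r s a b c d : Fin n) :
    coeff (quarticMon a b c d) (C α * (X p * X q) * (C β * (X r * X s))) =
      if quarticMon p q r s = quarticMon a b c d then α * β else 0 := by
  have hmon : C α * (X p * X q) * (C β * (X r * X s)) =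
      monomial (quarticMon p q r s) (α * β) := by
    simp only [quarticMon, X, C_mul_monomial, monomial_mul, mul_one, add_assoc]
  rw [hmon, coeff_monomial]

theorem prodCoeff_monKey (H : List ℕ → K) {l m : ℕ} (hlm : l ≤ m) (a b c d : Fin n) :
    Cmd.prodCoeff n H l m (Cmd.monKey a b c d) =
      coeff (quarticMon a b c d) (tableForm H l * tableForm H m) := by
  rw [Cmd.prodCoeff, if_neg hlm.not_gt]
  simp only [Cmd.sum_box_succ, Cmd.sum_box_zero, sum_range, tableForm_eq_sum_sum, sum_mul_sum,
    coeff_sum]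
  refine sum_congr rfl fun p _ => ?_
  rw [sum_comm]
  refine sum_congr rfl fun r _ => sum_congr rfl fun q _ => sum_congr rfl fun s _ => ?_
  rw [Cmd.prodTerm]
  by_cases hpq : p ≤ q
  · by_cases hrs : r ≤ s
    · rw [if_neg (by simp [hpq, hrs]), if_pos hpq, if_pos hrs, coeff_mul_mul_mul]
      simp only [monKey_eq_iff]
    · simp [hrs]
  · simp [hpq]

theorem sum_range_mul {M : Type*} [AddCommMonoid M] (a b : ℕ) (φ : ℕ → M) :
    ∑ x ∈ range (a * b), φ x = ∑ i : Fin a, ∑ j : Fin b, φ (i * b + j) := by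
  rw [sum_range, ← finProdFinEquiv.sum_comp, Fintype.sum_prod_type]
  refine sum_congr rfl fun i _ => sum_congr rfl fun j _ => ?_
  rw [finProdFinEquiv_apply_val, add_comm, mul_comm]

theorem dot_compVec (f : Fin n → MvPolynomial (Fin n) K) (H : List ℕ → K) (a b c d : Fin n)
    (y : ℕ → K) :
    dot (n * n + n) (Cmd.compVec n (quarticTable f) H [a, b, c, d]) y =
      coeff (quarticMon a b c d) (∑ i : Fin n, C (y i) * f i - ∑ l : Fin n, ∑ m : Fin n,
        C (y (n + l * n + m)) * if l ≤ m then tableForm H l * tableForm H m else 0) := by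
  rw [dot, add_comm, sum_range_add, sum_range_mul, sum_range, coeff_sub, sub_eq_add_neg]
  congr 1
  · rw [coeff_sum]
    refine sum_congr rfl fun i _ => ?_
    rw [Cmd.compVec, if_pos i.2, coeff_C_mul, quarticTable_apply, mul_comm]
  · simp only [coeff_sum, ← sum_neg_distrib, coeff_C_mul]
    refine sum_congr rfl fun l _ => sum_congr rfl fun m _ => ?_
    rw [Cmd.compVec, if_neg (by omega), Nat.add_sub_cancel_left, Cmd.index₂_div m.2,
      Cmd.index₂_mod m.2, add_assoc, mul_comm, ← mul_neg]
    congr 2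
    split_ifs with h
    · exact prodCoeff_monKey H h a b c d
    · rw [Cmd.prodCoeff, if_pos (by simpa using h), coeff_zero]

end QuadraticForms

section Decompositions

open MvPolynomial

variable {K : Type u} [Field K] {n : ℕ}

theorem isHomogeneous_compose {g h : Fin n → MvPolynomial (Fin n) K}
    (hg : ∀ i, (g i).IsHomogeneous 2) (hh : ∀ i, (h i).IsHomogeneous 2) (i : Fin n) :
    (compose g h i).IsHomogeneous 4 :=
  (hg i).aeval h hh

theorem tupleDegree_eq_of_isHomogeneous {f : Fin n → MvPolynomial (Fin n) K} {d : ℕ}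
    (hf : ∀ i, (f i).IsHomogeneous d) (h0 : f ≠ 0) : tupleDegree f = d := by
  obtain ⟨i, hi⟩ := Function.ne_iff.1 h0
  refine le_antisymm (Finset.sup_le fun i _ => (hf i).totalDegree_le) ?_
  rw [← (hf i).totalDegree hi]
  exact Finset.le_sup (f := fun i => (f i).totalDegree) (Finset.mem_univ i)

theorem compose_zero_right {g : Fin n → MvPolynomial (Fin n) K}
    (hg : ∀ i, (g i).IsHomogeneous 2) : compose g 0 = 0 := by
  funext i
  have hconst : constantCoeff (g i) = 0 := (hg i).coeff_eq_zero (by simp)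
  change aeval (0 : Fin n → MvPolynomial (Fin n) K) (g i) = 0
  rw [aeval_zero, hconst, map_zero]

theorem isQuadraticDecomposition_compose {g h : Fin n → MvPolynomial (Fin n) K}
    (hg : ∀ i, (g i).IsHomogeneous 2) (hh : ∀ i, (h i).IsHomogeneous 2) (h0 : compose g h ≠ 0) :
    IsQuadraticDecomposition (compose g h) g h := by
  refine ⟨⟨rfl, ?_⟩, hg, hh⟩
  have hg0 : g ≠ 0 := by
    rintro rfl
    exact h0 (funext fun _ => map_zero _)
  have hh0 : h ≠ 0 := by
    rintro rfl
    exact h0 (compose_zero_right hg)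
  rw [tupleDegree_eq_of_isHomogeneous hg hg0, tupleDegree_eq_of_isHomogeneous hh hh0,
    tupleDegree_eq_of_isHomogeneous (isHomogeneous_compose hg hh) h0]

end Decompositions

section Soundness

open Finset MvPolynomial

variable {K : Type u} [Field K] {n : ℕ} {F : List ℕ → K} {σ : State K}

/-- The tables computed on the way to the final state `τ` of the program on the input table `F`:
`A` holds the functionals that vanish on all partial derivatives of the input, `Q` the forms whose
products with all variables are annihilated by `A`, and `R` the linear relations between the input
and the products of the forms in `rightArr`. -/
structure Computes (n : ℕ) (F : List ℕ → K) (τ : State K) (A Q R : ℕ → ℕ → K) : Prop where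
  annihilator : ∃ S, KernelBasis (n * (n * n)) A S (Cmd.derivVec n F '' Cmd.box n 2)
  quotient : ∃ S, KernelBasis (n * n) Q S (Cmd.quotVec n A '' Cmd.box n 4)
  right : ∀ s < n * n, Q s s ≠ 0 → ∀ a < n, ∀ b < n,
    τ.field rightArr [Cmd.rankBefore Q s, a, b] = Q s (a * n + b)
  relations : ∃ S, KernelBasis (n * n + n) R S
    (Cmd.compVec n F (τ.field rightArr) '' Cmd.box n 4)
  free : ∀ y : ℕ → ℕ → K,
    (∀ i < n, ∀ t ∈ Cmd.box n 4,
      dot (n * n + n) (Cmd.compVec n F (τ.field rightArr) t) (y i) = 0) →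
    (∀ i < n, ∀ j < n, y i j = if i = j then 1 else 0) → ∀ i < n, R i i ≠ 0
  left : ∀ i < n, ∀ l < n, ∀ m < n, τ.field leftArr [i, l, m] = R i (n + l * n + m)
  announces : Announces τ ↔ (∃ t ∈ Cmd.box n 5, F t ≠ 0) ∧ ∀ i < n, R i i ≠ 0

theorem computes_den_main (hn : 0 < n) (hσ : Cmd.Env n F σ) (hflag : σ.nat flagVar [] = 0) :
    ∃ A Q R, Computes n F (Cmd.main.den σ) A Q R := by
  set σ₁ := Cmd.annihilator.den σ
  set σ₂ := Cmd.quotient.den σ₁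
  set σ₃ := Cmd.extract.den σ₂
  set σ₄ := Cmd.relations.den σ₃
  set σ₅ := Cmd.writeLeft.den σ₄
  have h₁ : Cmd.Frame Cmd.annihilator σ σ₁ := Cmd.frame_den _ σ
  have h₂ : Cmd.Frame Cmd.quotient σ₁ σ₂ := Cmd.frame_den _ σ₁
  have h₃ : Cmd.Frame Cmd.extract σ₂ σ₃ := Cmd.frame_den _ σ₂
  have h₄ : Cmd.Frame Cmd.relations σ₃ σ₄ := Cmd.frame_den _ σ₃
  have h₅ : Cmd.Frame Cmd.writeLeft σ₄ σ₅ := Cmd.frame_den _ σ₄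
  have h₆ : Cmd.Frame Cmd.announce σ₅ (Cmd.main.den σ) := Cmd.frame_den _ σ₅
  have e₁ := hσ.of_frame h₁ (by decide)
  have e₂ := e₁.of_frame h₂ (by decide)
  have e₃ := e₂.of_frame h₃ (by decide)
  have e₄ := e₃.of_frame h₄ (by decide)
  have e₅ := e₄.of_frame h₅ (by decide)
  have hflag₅ : σ₅.nat flagVar [] = 0 := by
    rwa [h₅.nat flagVar (by decide), h₄.nat flagVar (by decide), h₃.nat flagVar (by decide),
      h₂.nat flagVar (by decide), h₁.nat flagVar (by decide)]
  have hright : (Cmd.main.den σ).field rightArr = σ₃.field rightArr := by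
    rw [h₆.field rightArr (by decide), h₅.field rightArr (by decide), h₄.field rightArr (by decide)]
  have hrelation : Cmd.mat σ₅ relationArr = Cmd.mat σ₄ relationArr := by
    unfold Cmd.mat
    rw [h₅.field relationArr (by decide)]
  obtain ⟨S, hS, hfree⟩ := Cmd.den_relations e₃ hn
  refine ⟨Cmd.mat σ₁ annihilatorArr, Cmd.mat σ₂ quotientFormArr, Cmd.mat σ₄ relationArr,
    Cmd.den_annihilator hσ hn, Cmd.den_quotient e₁ hn, ?_, ⟨S, ?_⟩, ?_, ?_, ?_⟩
  · rw [hright]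
    exact Cmd.den_extract e₂
  · rwa [hright]
  · rw [hright]
    exact fun y hy hy' i hi => (hS.mem_iff (Nat.lt_add_left _ hi)).1
      (hfree y hy hy' (mem_range.2 hi))
  · rw [h₆.field leftArr (by decide)]
    exact Cmd.den_writeLeft e₄
  · rw [← hrelation]
    exact Cmd.den_announce e₅ hflag₅

theorem exists_computes (hn : 0 < n) (f : Fin n → MvPolynomial (Fin n) K) (ρ : ℕ → K) :
    ∃ A Q R, Computes n (quarticTable f) (Cmd.main.den (Cmd.setup.den (initState f ρ))) A Q R := by
  refine computes_den_main hn (Cmd.env_setup f ρ) ?_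
  rw [(Cmd.frame_den Cmd.setup (initState f ρ)).nat flagVar (by decide)]
  rfl

theorem quarticTable_zero (t : List ℕ) :
    quarticTable (0 : Fin n → MvPolynomial (Fin n) K) t = 0 := by
  rw [quarticTable.eq_def]
  split
  · split_ifs <;> simp
  · rfl

theorem compose_output (τ : State K) (i : Fin n) :
    compose (outputLeft n τ) (outputRight n τ) i = ∑ l : Fin n, ∑ m : Fin n,
      C (τ.field leftArr [i, l, m]) * if l ≤ m then
        tableForm (τ.field rightArr) l * tableForm (τ.field rightArr) m else 0 := by
  rw [compose, outputLeft, readForms, bind₁_quadForm]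
  refine sum_congr rfl fun l _ => sum_congr rfl fun m _ => ?_
  split_ifs with hlm
  · simp only [Sym2.inf_mk, Sym2.sup_mk, inf_eq_left.2 hlm, sup_eq_right.2 hlm]
    rfl
  · rw [mul_zero]

theorem Computes.isQuadraticDecomposition {f : Fin n → MvPolynomial (Fin n) K}
    {τ : State K} {A Q R : ℕ → ℕ → K} (h : Computes n (quarticTable f) τ A Q R)
    (hf : ∀ i, (f i).IsHomogeneous 4) (hτ : Announces τ) :
    IsQuadraticDecomposition f (outputLeft n τ) (outputRight n τ) := by
  obtain ⟨⟨t, -, ht⟩, hdiag⟩ := h.announces.1 hτ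
  obtain ⟨S, hS⟩ := h.relations
  have hmem : ∀ i < n, i ∈ S := fun i hi => (hS.mem_iff (Nat.lt_add_left _ hi)).2 (hdiag i hi)
  have hleft : ∀ i, (outputLeft n τ i).IsHomogeneous 2 := fun i => isHomogeneous_quadForm _
  have hright : ∀ i, (outputRight n τ i).IsHomogeneous 2 := fun i => isHomogeneous_quadForm _
  have hf_eq : f = compose (outputLeft n τ) (outputRight n τ) := by
    funext i
    refine eq_of_coeff_quarticMon_eq (hf i) (isHomogeneous_compose hleft hright i)
      fun a b c d => ?_
    have hsolves := hS.solves _ ⟨[(a : ℕ), b, c, d], by simp [Cmd.mem_box], rfl⟩ i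
      (Nat.lt_add_left _ i.2)
    have hdual : ∑ j : Fin n, C (R i j) * f j = f i := by
      simp [hS.dual i (hmem i i.2) _ (hmem _ (Fin.is_lt _)), Fin.val_inj]
    rw [dot_compVec, coeff_sub, sub_eq_zero, hdual] at hsolves
    simpa only [compose_output, h.left i i.2 _ (Fin.is_lt _) _ (Fin.is_lt _)] using hsolves
  have hf_ne : f ≠ 0 := by
    rintro rfl
    exact ht (quarticTable_zero t)
  rw [hf_eq] at hf_ne
  nth_rewrite 1 [hf_eq]
  exact isQuadraticDecomposition_compose hleft hright hf_ne

end Soundness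

/-! ### Completeness -/

section Derivatives

open Finset MvPolynomial

variable {K : Type u} [Field K] {n : ℕ}

/-- The Hessian matrix of the quadratic form with coefficients `c`. -/
def hess {R : Type*} [Add R] (c : Sym2 (Fin n) → R) (a b : Fin n) : R :=
  if a = b then c s(a, b) + c s(a, b) else c s(a, b)

/-- The coefficients of the product of `x_k` and the quadratic form `q`. A form of degree `d` is
here the function that maps `d` indices to the coefficient of the product of their variables. -/
def xMul {R : Type*} [Zero R] (k : Fin n) (q : Fin n → Fin n → R) (a b c : Fin n) : R :=
  if a = k then q b c else if b = k then q a c else if c = k then q a b else 0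

/-- The coefficients of the `m`-th form of the right factor in the pair with coefficients `v`. -/
def rightTable {R : Type*} (v : CoeffIdx n → R) (m a b : Fin n) : R := v (1, m, s(a, b))

/-- The matrix that expresses the partial derivatives `∂_j (g ∘ h)_i` by the products `x_k h_m`;
the chain rule shows that its entries are bilinear in the coefficients of `g` and `h`. -/
def chainMatrix {R : Type*} [NonUnitalNonAssocSemiring R] (v : CoeffIdx n → R) :
    Matrix (Fin n × Fin n) (Fin n × Fin n) R := fun p q =>
  ∑ l, hess (fun s => v (0, p.1, s)) l q.1 * hess (fun s => v (1, l, s)) p.2 q.2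

/-- No nonzero quadratic form without squares has all its products with the variables in the span
of the products `x_k h_m`. The forms that do have this property are then determined by their
coefficients at the `n` squares, and hence lie in the span of the `h_m` if these are independent. -/
def TrivialQuotient (v : CoeffIdx n → K) : Prop :=
  ∀ q : Fin n → Fin n → K, (∀ a, q a a = 0) →
    (∀ k, ∃ L : Fin n → Fin n → K, ∀ a b c,
      xMul k q a b c = ∑ k', ∑ m, L k' m * xMul k' (rightTable v m) a b c) → q = 0

theorem hess_eq_add {R : Type*} [AddZeroClass R] (c : Sym2 (Fin n) → R) (l m : Fin n) :
    hess c l m = (if l ≤ m then c s(l, m) else 0) + if m ≤ l then c s(m, l) else 0 := by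
  rcases lt_trichotomy l m with h | rfl | h
  · rw [if_pos h.le, if_neg (not_le.2 h), hess, if_neg h.ne, add_zero]
  · simp [hess]
  · rw [if_pos h.le, if_neg (not_le.2 h), hess, if_neg h.ne', zero_add, Sym2.eq_swap]

theorem derivation_quadratic {R A : Type*} [CommRing R] [CommRing A] [Algebra R A]
    (D : Derivation R A A) (c : Sym2 (Fin n) → R) (u : Fin n → A) :
    D (∑ a, ∑ b, if a ≤ b then algebraMap R A (c s(a, b)) * (u a * u b) else 0) =
      ∑ l, ∑ m, algebraMap R A (hess c l m) * (D (u l) * u m) := by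
  simp only [hess_eq_add, map_add, apply_ite (algebraMap R A), map_zero, add_mul, ite_mul,
    zero_mul, sum_add_distrib]
  rw [sum_comm (f := fun l m => if m ≤ l then algebraMap R A (c s(m, l)) * (D (u l) * u m) else 0)]
  simp only [← sum_add_distrib, map_sum]
  refine sum_congr rfl fun a _ => sum_congr rfl fun b _ => ?_
  split_ifs
  · simp only [Derivation.leibniz, Derivation.map_algebraMap, smul_eq_mul]
    ring
  · simp only [map_zero, add_zero]

theorem pderiv_quadForm (c : Sym2 (Fin n) → K) (j : Fin n) :
    pderiv j (quadForm c) = ∑ k, C (hess c j k) * X k := by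
  rw [quadForm_eq_sum_sum]
  refine (derivation_quadratic (pderiv j) c X).trans ?_
  rw [sum_eq_single_of_mem j (mem_univ j)]
  · simp [algebraMap_eq]
  · intro l _ hl
    simp [Pi.single_eq_of_ne hl]

theorem pderiv_compose (v : CoeffIdx n → K) (i j : Fin n) :
    pderiv j (compose (leftFactor v) (rightFactor v) i) =
      ∑ m, ∑ k, C (chainMatrix v (i, j) (m, k)) * (X k * rightFactor v m) := by
  rw [compose, leftFactor, bind₁_quadForm]
  refine (derivation_quadratic (pderiv j) (fun s => v (0, i, s)) (rightFactor v)).trans ?_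
  rw [sum_comm]
  refine sum_congr rfl fun m _ => ?_
  simp only [chainMatrix, map_sum, sum_mul]
  rw [sum_comm]
  refine sum_congr rfl fun l _ => ?_
  rw [rightFactor, pderiv_quadForm, sum_mul, mul_sum]
  refine sum_congr rfl fun k _ => ?_
  rw [C_mul, algebraMap_eq]
  ring

/-- The exponent of the monomial `x_a x_b x_c`. -/
noncomputable def cubicMon (a b c : Fin n) : Fin n →₀ ℕ :=
  Finsupp.single a 1 + Finsupp.single b 1 + Finsupp.single c 1

theorem coeff_X_mul_quadForm (w : Sym2 (Fin n) → K) (k a b c : Fin n) :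
    coeff (cubicMon a b c) (X k * quadForm w) = xMul k (fun a b => w s(a, b)) a b c := by
  rw [cubicMon, xMul]
  split_ifs with h₁ h₂ h₃
  · subst h₁
    rw [add_assoc, add_comm, mul_comm, coeff_mul_X, coeff_quadForm]
  · subst h₂
    rw [add_right_comm, mul_comm, coeff_mul_X, coeff_quadForm]
  · subst h₃
    rw [mul_comm, coeff_mul_X, coeff_quadForm]
  · rw [coeff_X_mul', if_neg]
    simp [h₁, h₂, h₃]

theorem derivVec_eq_coeff_pderiv (f : Fin n → MvPolynomial (Fin n) K) (i j a b c : Fin n) :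
    Cmd.derivVec n (quarticTable f) [i, j] (a * (n * n) + b * n + c) =
      coeff (cubicMon a b c) (pderiv j (f i)) := by
  obtain ⟨ha, hb, hc⟩ := Cmd.index₃_div (a := a) b.2 c.2
  have hmon : cubicMon a b c + Finsupp.single j 1 = quarticMon j a b c := by
    rw [cubicMon, quarticMon]
    abel
  rw [Cmd.derivVec, ha, hb, hc, coeff_pderiv, hmon]
  simp only [List.getD_cons_zero, List.getD_cons_succ, Cmd.derivCoeff, quarticTable_apply, cubicMon,
    Finsupp.add_apply, Finsupp.single_apply, Fin.val_inj]
  push_cast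
  split_ifs <;> ring

theorem dot_cube (y z : ℕ → K) : dot (n * (n * n)) y z =
    ∑ a : Fin n, ∑ b : Fin n, ∑ c : Fin n,
      y (a * (n * n) + b * n + c) * z (a * (n * n) + b * n + c) := by
  rw [dot, sum_range_mul]
  refine sum_congr rfl fun a _ => ?_
  rw [← sum_range fun x => y (a * (n * n) + x) * z (a * (n * n) + x), sum_range_mul]
  simp only [add_assoc]

theorem xMul_eq_add {R : Type*} [AddZeroClass R] (k : Fin n) (q : Fin n → Fin n → R)
    (a b c : Fin n) : xMul k q a b c =
      (if a = k then q b c else 0) + (if b = k then if a = k then 0 else q a c else 0) +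
        if c = k then if a = k ∨ b = k then 0 else q a b else 0 := by
  rw [xMul]
  split_ifs <;> simp_all

theorem sum_mul_xMul {R : Type*} [NonUnitalNonAssocSemiring R] (k : Fin n)
    (z : Fin n → Fin n → Fin n → R) (q : Fin n → Fin n → R) :
    ∑ a, ∑ b, ∑ c, z a b c * xMul k q a b c =
      ∑ a, ∑ b, (z k a b * q a b + (if a = k then 0 else z a k b * q a b) +
        if a = k ∨ b = k then 0 else z a b k * q a b) := by
  simp only [xMul_eq_add, mul_add, sum_add_distrib, mul_ite, mul_zero, sum_ite_eq', mem_univ,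
    if_true]
  congr 2
  · rw [sum_eq_single_of_mem k (mem_univ k) fun a _ ha => by simp only [if_neg ha, sum_const_zero]]
    simp only [if_true]
  · refine sum_congr rfl fun a _ => ?_
    rw [sum_eq_single_of_mem k (mem_univ k) fun b _ hb => by simp only [if_neg hb, sum_const_zero]]
    simp only [if_true]

/-- The coefficient vector, in the numbering of `Cmd.derivVec`, of the product of `x_k` and the
quadratic form with the coefficient vector `y`. -/
def xMulVec (n k : ℕ) (y : ℕ → K) (x : ℕ) : K :=
  if x / (n * n) = k then y (x / n % n * n + x % n) else
    if x / n % n = k then y (x / (n * n) * n + x % n) else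
      if x % n = k then y (x / (n * n) * n + x / n % n) else 0

theorem xMulVec_eq_xMul (k a b c : Fin n) (y : ℕ → K) :
    xMulVec n k y (a * (n * n) + b * n + c) =
      xMul k (fun a b => y (a * n + b)) a b c := by
  obtain ⟨ha, hb, hc⟩ := Cmd.index₃_div (a := a) b.2 c.2
  simp only [xMulVec, ha, hb, hc, xMul, Fin.val_inj]

theorem dot_quotVec (N : ℕ → ℕ → K) (p q r k : Fin n) (y : ℕ → K) :
    dot (n * n) (Cmd.quotVec n N [p, q, r, k]) y =
      dot (n * (n * n)) (N (p * (n * n) + q * n + r)) (xMulVec n k y) := by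
  rw [dot_cube, dot, sum_range_mul]
  simp only [xMulVec_eq_xMul]
  rw [sum_mul_xMul k fun a b c : Fin n =>
    N (p * (n * n) + q * n + r) (a * (n * n) + b * n + c)]
  refine sum_congr rfl fun a _ => sum_congr rfl fun b _ => ?_
  simp only [Cmd.quotVec, Cmd.quotCoeff, Cmd.index₂_div (a := a) b.2, Cmd.index₂_mod (a := a) b.2,
    List.getD_cons_zero, List.getD_cons_succ, Fin.val_inj]
  split_ifs <;> simp_all <;> ring

end Derivatives

section Completeness

open Finset MvPolynomial

variable {K : Type u} [Field K] {n : ℕ}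

theorem exists_flatten {R : Type*} (hn : 0 < n) (q : Fin n → Fin n → R) :
    ∃ y : ℕ → R, ∀ a b : Fin n, y (a * n + b) = q a b := by
  refine ⟨fun x => q ⟨x / n % n, Nat.mod_lt _ hn⟩ ⟨x % n, Nat.mod_lt _ hn⟩, fun a b => ?_⟩
  simp only [Cmd.index₂_div b.2, Cmd.index₂_mod b.2, Nat.mod_eq_of_lt a.2]

theorem exists_fin_of_mem_box {t : List ℕ} (ht : t ∈ Cmd.box n 4) :
    ∃ a b c d : Fin n, t = [(a : ℕ), b, c, d] := by
  obtain ⟨hlen, hlt⟩ := Cmd.mem_box.1 ht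
  obtain ⟨a, b, c, d, rfl⟩ := List.length_eq_four.1 hlen
  simp only [List.mem_cons, List.not_mem_nil, or_false, forall_eq_or_imp, forall_eq] at hlt
  exact ⟨⟨a, hlt.1⟩, ⟨b, hlt.2.1⟩, ⟨c, hlt.2.2.1⟩, ⟨d, hlt.2.2.2⟩, rfl⟩

namespace KernelBasis

variable {C : ℕ} {N : ℕ → ℕ → K} {S : Finset ℕ} {rows : Set (ℕ → K)}

theorem card_le (h : KernelBasis C N S rows) (u : Fin n → ℕ)
    (hu : ∀ y : ℕ → K, (∀ x ∈ rows, dot C x y = 0) → (∀ a, y (u a) = 0) → ∀ t < C, y t = 0) :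
    #S ≤ n := by
  let Φ : (S → K) →ₗ[K] (Fin n → K) :=
    { toFun := fun c a => ∑ s, c s * N s (u a)
      map_add' := fun c d => by
        funext a
        simp only [Pi.add_apply, add_mul, sum_add_distrib]
      map_smul' := fun r c => by
        funext a
        simp only [Pi.smul_apply, smul_eq_mul, mul_sum, mul_assoc, RingHom.id_apply] }
  have hΦ : Function.Injective Φ := by
    refine (injective_iff_map_eq_zero _).2 fun c hc => funext fun s => ?_
    have hsolves : ∀ x ∈ rows, dot C x (fun t => ∑ s, c s * N s t) = 0 := fun x hx => by
      rw [dot_sum]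
      exact sum_eq_zero fun s _ => by rw [h.solves x hx s (h.lt_of_mem s.2), mul_zero]
    have hzero := hu _ hsolves (fun a => congrFun hc a) s (h.lt_of_mem s.2)
    simpa [h.dual _ (Subtype.prop _) s s.2, Subtype.coe_inj] using hzero
  simpa using LinearMap.finrank_le_finrank_of_injective hΦ

theorem rankBefore_lt_card (h : KernelBasis C N S rows) {s : ℕ} (hs : s ∈ S) :
    Cmd.rankBefore N s < #S := by
  have hcard : Cmd.rankBefore N C = #S := by
    rw [Cmd.rankBefore]
    congr 1
    ext t
    simp only [mem_filter, mem_range]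
    exact ⟨fun ht => (h.mem_iff ht.1).2 ht.2,
      fun ht => ⟨h.lt_of_mem ht, (h.mem_iff (h.lt_of_mem ht)).1 ht⟩⟩
  calc Cmd.rankBefore N s < Cmd.rankBefore N (s + 1) := by
        rw [Cmd.rankBefore_succ_of_ne ((h.mem_iff (h.lt_of_mem hs)).1 hs)]
        exact Nat.lt_succ_self _
    _ ≤ Cmd.rankBefore N C := Cmd.rankBefore_mono N (h.lt_of_mem hs)
    _ = #S := hcard

end KernelBasis

theorem bind₁_quadForm_mem_span {h t : Fin n → MvPolynomial (Fin n) K}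
    (ht : ∀ m, h m ∈ Submodule.span K (Set.range t)) (c : Sym2 (Fin n) → K) :
    bind₁ h (quadForm c) ∈ Submodule.span K
      (Set.range fun p : Fin n × Fin n => if p.1 ≤ p.2 then t p.1 * t p.2 else 0) := by
  rw [bind₁_quadForm]
  refine Submodule.sum_mem _ fun a _ => Submodule.sum_mem _ fun b _ => ?_
  split_ifs
  · rw [← smul_eq_C_mul]
    refine Submodule.smul_mem _ _ ?_
    have hmul := Submodule.mul_mem_mul (ht a) (ht b)
    rw [Submodule.span_mul_span] at hmul
    refine Submodule.span_le.2 ?_ hmul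
    rintro _ ⟨_, ⟨p, rfl⟩, _, ⟨q, rfl⟩, rfl⟩
    rcases le_total p q with hpq | hpq
    · exact Submodule.subset_span ⟨(p, q), if_pos hpq⟩
    · exact Submodule.subset_span ⟨(q, p), (if_pos hpq).trans (mul_comm _ _)⟩
  · exact Submodule.zero_mem _

theorem coeff_pderiv_compose (v : CoeffIdx n → K) (i j a b c : Fin n) :
    coeff (cubicMon a b c) (pderiv j (compose (leftFactor v) (rightFactor v) i)) =
      ∑ p : Fin n × Fin n, chainMatrix v (i, j) p * xMul p.2 (rightTable v p.1) a b c := by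
  simp only [pderiv_compose, coeff_sum, coeff_C_mul, rightFactor, coeff_X_mul_quadForm,
    Fintype.sum_prod_type]
  rfl

variable {v : CoeffIdx n → K} {B : Matrix (Fin n × Fin n) (Fin n × Fin n) K} {τ : State K}
  {A Q R : ℕ → ℕ → K}

theorem xMul_rightTable_eq_sum (hB : B * chainMatrix v = 1) (k m a b c : Fin n) :
    xMul k (rightTable v m) a b c = ∑ p : Fin n × Fin n, B (m, k) p *
      coeff (cubicMon a b c) (pderiv p.2 (compose (leftFactor v) (rightFactor v) p.1)) := by
  have hrow : ∀ q, ∑ p, B (m, k) p * chainMatrix v p q = if (m, k) = q then 1 else 0 := fun q => by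
    rw [← Matrix.mul_apply, hB, Matrix.one_apply]
  simp only [coeff_pderiv_compose, mul_sum]
  rw [sum_comm]
  simp only [← mul_assoc, ← sum_mul, hrow, ite_mul, one_mul, zero_mul, sum_ite_eq, mem_univ,
    if_true]

theorem exists_quarticTable_ne_zero (hn : 0 < n) (hB : B * chainMatrix v = 1) :
    ∃ t ∈ Cmd.box n 5, quarticTable (compose (leftFactor v) (rightFactor v)) t ≠ 0 := by
  by_contra! hzero
  have hright : ∀ m b c : Fin n, rightTable v m b c = 0 := fun m b c => by
    obtain ⟨hi, hj, hk⟩ := Cmd.index₃_div (a := b) b.2 c.2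
    calc rightTable v m b c = xMul b (rightTable v m) b b c := (if_pos rfl).symm
      _ = 0 := by
        rw [xMul_rightTable_eq_sum hB]
        refine sum_eq_zero fun p _ => ?_
        rw [← derivVec_eq_coeff_pderiv, Cmd.derivVec, hi, hj, hk, Cmd.derivCoeff]
        simp [hzero [p.1, p.2, b, b, c] (by simp [Cmd.mem_box])]
  have hchain : chainMatrix v = 0 := by
    ext p q
    refine sum_eq_zero fun l _ => ?_
    have hl : v (1, l, s(p.2, q.2)) = 0 := hright l p.2 q.2
    simp only [hess, hl, add_zero, ite_self, mul_zero]
  have : Nonempty (Fin n × Fin n) := ⟨(⟨0, hn⟩, ⟨0, hn⟩)⟩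
  rw [hchain, Matrix.mul_zero] at hB
  exact zero_ne_one hB

namespace Computes

theorem dot_eq_zero_of_rightTable
    (h : Computes n (quarticTable (compose (leftFactor v) (rightFactor v))) τ A Q R)
    (hB : B * chainMatrix v = 1) {m : Fin n} {y : ℕ → K}
    (hy : ∀ a b : Fin n, y (a * n + b) = rightTable v m a b) :
    ∀ x ∈ Cmd.quotVec n A '' Cmd.box n 4, dot (n * n) x y = 0 := by
  rintro _ ⟨t, ht, rfl⟩
  obtain ⟨p, q, r, k, rfl⟩ := exists_fin_of_mem_box ht
  obtain ⟨S, hS⟩ := h.annihilator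
  have hxMul : ∀ x < n * (n * n), xMulVec n k y x = ∑ w : Fin n × Fin n, B (m, k) w *
      Cmd.derivVec n (quarticTable (compose (leftFactor v) (rightFactor v))) [w.1, w.2] x := by
    intro x hx
    obtain ⟨a, ha, b, hb, c, hc, rfl⟩ := Cmd.exists_index₃ hx
    have hsum := xMul_rightTable_eq_sum hB k m ⟨a, ha⟩ ⟨b, hb⟩ ⟨c, hc⟩
    simp only [← derivVec_eq_coeff_pderiv] at hsum
    rw [← hsum, ← funext₂ hy]
    exact xMulVec_eq_xMul k ⟨a, ha⟩ ⟨b, hb⟩ ⟨c, hc⟩ y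
  rw [dot_quotVec, dot_congr (fun _ _ => rfl) hxMul, dot_sum]
  refine sum_eq_zero fun w _ => ?_
  rw [dot_comm, hS.solves _ ⟨_, by simp [Cmd.mem_box], rfl⟩ _ (Cmd.index₃_lt p.2 q.2 r.2),
    mul_zero]

theorem exists_eq_sum_xMul
    (h : Computes n (quarticTable (compose (leftFactor v) (rightFactor v))) τ A Q R)
    {z : ℕ → K} (hz : ∀ s < n * (n * n), dot (n * (n * n)) (A s) z = 0) :
    ∃ L : Fin n → Fin n → K, ∀ a b c : Fin n,
      z (a * (n * n) + b * n + c) = ∑ k, ∑ m, L k m * xMul k (rightTable v m) a b c := by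
  obtain ⟨S, hS⟩ := h.annihilator
  suffices hspan : ∀ w ∈ Submodule.span K ((fun (x : ℕ → K) (c : Fin (n * (n * n))) => x c) ''
      (Cmd.derivVec n (quarticTable (compose (leftFactor v) (rightFactor v))) '' Cmd.box n 2)),
      ∃ L : Fin n → Fin n → K, ∀ a b c : Fin n,
        w ⟨a * (n * n) + b * n + c, Cmd.index₃_lt a.2 b.2 c.2⟩ =
          ∑ k, ∑ m, L k m * xMul k (rightTable v m) a b c from
    hspan _ (hS.mem_span z hz)
  intro w hw
  induction hw using Submodule.span_induction with
  | mem w hw =>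
    obtain ⟨_, ⟨t, ht, rfl⟩, rfl⟩ := hw
    obtain ⟨hlen, hlt⟩ := Cmd.mem_box.1 ht
    obtain ⟨i, j, rfl⟩ := List.length_eq_two.1 hlen
    simp only [List.mem_cons, List.not_mem_nil, or_false, forall_eq_or_imp, forall_eq] at hlt
    refine ⟨fun k m => chainMatrix v (⟨i, hlt.1⟩, ⟨j, hlt.2⟩) (m, k), fun a b c => ?_⟩
    refine (derivVec_eq_coeff_pderiv _ ⟨i, hlt.1⟩ ⟨j, hlt.2⟩ a b c).trans ?_
    rw [coeff_pderiv_compose, Fintype.sum_prod_type, sum_comm]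
  | zero => exact ⟨0, by simp⟩
  | add w w' _ _ ih ih' =>
    obtain ⟨L, hL⟩ := ih
    obtain ⟨L', hL'⟩ := ih'
    exact ⟨L + L', fun a b c => by simp [hL, hL', add_mul, sum_add_distrib]⟩
  | smul r w _ ih =>
    obtain ⟨L, hL⟩ := ih
    exact ⟨r • L, fun a b c => by simp [hL, mul_sum, mul_assoc]⟩

theorem card_quotient_le
    (h : Computes n (quarticTable (compose (leftFactor v) (rightFactor v))) τ A Q R)
    (hv : TrivialQuotient v) {S : Finset ℕ}
    (hS : KernelBasis (n * n) Q S (Cmd.quotVec n A '' Cmd.box n 4)) : #S ≤ n := by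
  refine hS.card_le (fun a => a * n + a) fun y hy hdiag t ht => ?_
  have hzero : (fun a b : Fin n => y (a * n + b)) = 0 := by
    refine hv _ hdiag fun k => ?_
    obtain ⟨L, hL⟩ := h.exists_eq_sum_xMul (z := xMulVec n k y) fun s hs => by
      obtain ⟨p, hp, q, hq, r, hr, rfl⟩ := Cmd.exists_index₃ hs
      rw [← dot_quotVec A ⟨p, hp⟩ ⟨q, hq⟩ ⟨r, hr⟩ k y]
      exact hy _ ⟨_, by simp [Cmd.mem_box, hp, hq, hr], rfl⟩
    exact ⟨L, fun a b c => by rw [← hL, xMulVec_eq_xMul]⟩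
  obtain ⟨a, ha, b, hb, rfl⟩ := Cmd.exists_index₂ ht
  exact congrFun₂ hzero ⟨a, ha⟩ ⟨b, hb⟩

theorem rightFactor_mem_span (hn : 0 < n)
    (h : Computes n (quarticTable (compose (leftFactor v) (rightFactor v))) τ A Q R)
    (hB : B * chainMatrix v = 1) (hv : TrivialQuotient v) (m : Fin n) :
    rightFactor v m ∈ Submodule.span K
      (Set.range fun r : Fin n => tableForm (τ.field rightArr) r) := by
  obtain ⟨S, hS⟩ := h.quotient
  obtain ⟨y, hy⟩ := exists_flatten hn (rightTable v m)
  have hsum : rightFactor v m =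
      ∑ s ∈ S, y s • tableForm (τ.field rightArr) (Cmd.rankBefore Q s) := by
    simp only [rightFactor, quadForm_eq_sum_sum, tableForm_eq_sum_sum, smul_sum]
    rw [sum_comm (s := S)]
    refine sum_congr rfl fun a _ => ?_
    rw [sum_comm (s := S)]
    refine sum_congr rfl fun b _ => ?_
    split_ifs
    · have hab := hS.spans y (h.dot_eq_zero_of_rightTable hB hy) (a * n + b)
        (by nlinarith [a.2, b.2])
      rw [hy, rightTable] at hab
      rw [hab, map_sum, sum_mul]
      refine sum_congr rfl fun s hs => ?_
      have hsn := hS.lt_of_mem hs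
      rw [h.right s hsn ((hS.mem_iff hsn).1 hs) a a.2 b b.2, smul_eq_C_mul, C_mul, mul_assoc]
    · simp only [smul_zero, sum_const_zero]
  rw [hsum]
  refine Submodule.sum_mem _ fun s hs => Submodule.smul_mem _ _ (Submodule.subset_span ?_)
  exact ⟨⟨Cmd.rankBefore Q s, (hS.rankBefore_lt_card hs).trans_le (h.card_quotient_le hv hS)⟩, rfl⟩

theorem announces_of_trivialQuotient (hn : 0 < n)
    (h : Computes n (quarticTable (compose (leftFactor v) (rightFactor v))) τ A Q R)
    (hB : B * chainMatrix v = 1) (hv : TrivialQuotient v) : Announces τ := by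
  have hrelation : ∀ i : Fin n, ∃ y : ℕ → K, (∀ j < n, y j = if (i : ℕ) = j then 1 else 0) ∧
      ∀ t ∈ Cmd.box n 4, dot (n * n + n) (Cmd.compVec n
        (quarticTable (compose (leftFactor v) (rightFactor v))) (τ.field rightArr) t) y = 0 := by
    intro i
    obtain ⟨c, hc⟩ := (Submodule.mem_span_range_iff_exists_fun K).1
      (bind₁_quadForm_mem_span (h.rightFactor_mem_span hn hB hv) fun s => v (0, i, s))
    obtain ⟨z, hz⟩ := exists_flatten hn fun a b => c (a, b)
    refine ⟨fun x => if x < n then (if (i : ℕ) = x then 1 else 0) else z (x - n),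
      fun j hj => if_pos hj, fun t ht => ?_⟩
    obtain ⟨a, b, c', d, rfl⟩ := exists_fin_of_mem_box ht
    rw [dot_compVec, sub_eq_zero.2, coeff_zero]
    have hright : ∀ l m : Fin n, (if n + l * n + m < n then if (i : ℕ) = n + l * n + m then 1 else 0
        else z (n + l * n + m - n)) = c (l, m) := fun l m => by
      rw [if_neg (by omega), ← hz l m]
      congr 1
      omega
    simp only [hright, Fin.is_lt, if_true, Fin.val_inj]
    simp only [Fintype.sum_prod_type, smul_eq_C_mul] at hc
    rw [hc]
    simp [compose, leftFactor]
  choose y hy hysolves using hrelation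
  refine h.announces.2 ⟨exists_quarticTable_ne_zero hn hB, h.free
    (fun i => if hi : i < n then y ⟨i, hi⟩ else 0) (fun i hi t ht => ?_) (fun i hi j hj => ?_)⟩
  · simpa only [dif_pos hi] using hysolves ⟨i, hi⟩ t ht
  · simpa only [dif_pos hi] using hy ⟨i, hi⟩ j hj

end Computes

end Completeness

/-! ### Generic pairs -/

section CyclicPair

open Finset

open scoped Fin.CommRing

variable {K : Type u} [Field K] {n : ℕ}

theorem hess_indicator_edgeSet {R : Type*} [AddZeroClass R] [One R] (G : SimpleGraph (Fin n))
    (a b : Fin n) [Decidable (G.Adj a b)] :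
    hess (G.edgeSet.indicator (1 : Sym2 (Fin n) → R)) a b = if G.Adj a b then 1 else 0 := by
  classical
  simp only [hess, Set.indicator_apply, SimpleGraph.mem_edgeSet, Pi.one_apply]
  split_ifs with hab hG
  · exact absurd hab hG.ne
  · exact add_zero 0
  · rfl
  · rfl

/-- The pair of `g_i = y_i y_{i + 1}` and `h_m = ∑ x_{a + m} x_{b + m}`, where `{a, b}` runs through
the edges of `G` and indices are read modulo `n`. -/
noncomputable def cyclicPair (K : Type u) [Field K] (n : ℕ) [NeZero n] (G : SimpleGraph ℕ)
    (p : CoeffIdx n) : K :=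
  if p.1 = 0 then (SimpleGraph.edge p.2.1 (p.2.1 + 1)).edgeSet.indicator 1 p.2.2
  else (G.comap fun j => (j - p.2.1 : Fin n).val).edgeSet.indicator 1 p.2.2

theorem chainMatrix_mulVec (v : CoeffIdx n → K) (x : Fin n × Fin n → K) (i j : Fin n) :
    (chainMatrix v).mulVec x (i, j) = ∑ l, ∑ m, hess (fun s => v (0, i, s)) l m *
      ∑ k, hess (fun s => v (1, l, s)) j k * x (m, k) := by
  simp only [Matrix.mulVec, dotProduct, chainMatrix, sum_mul, mul_sum, Fintype.sum_prod_type]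
  rw [sum_congr rfl fun m _ => sum_comm, sum_comm]
  exact sum_congr rfl fun l _ => sum_congr rfl fun m _ => sum_congr rfl fun k _ => mul_assoc _ _ _

theorem sum_edge_adj {M : Type*} [AddCommMonoid M] {i j : Fin n} (hij : i ≠ j)
    (F : Fin n → Fin n → M) :
    ∑ l, ∑ m, (if (SimpleGraph.edge i j).Adj l m then F l m else 0) = F i j + F j i := by
  have hsplit : ∀ l m, (if (SimpleGraph.edge i j).Adj l m then F l m else 0) =
      (if l = i then if m = j then F l m else 0 else 0) +
        if l = j then if m = i then F l m else 0 else 0 := fun l m => by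
    simp only [SimpleGraph.edge_adj]
    split_ifs <;> simp_all
  simp only [hsplit, sum_add_distrib, sum_ite_irrel, sum_const_zero, sum_ite_eq', mem_univ, if_true]

theorem chainMatrix_cyclicPair_mulVec [NeZero n] (hn : 2 ≤ n) (G : SimpleGraph ℕ)
    [DecidableRel G.Adj] (x : Fin n × Fin n → K) (i s : Fin n) :
    (chainMatrix (cyclicPair K n G)).mulVec x (i, i + s) =
      ∑ c : Fin n, (if G.Adj s c then x (i + 1, i + c) else 0) +
        ∑ c : Fin n, if G.Adj (s - 1 : Fin n) c then x (i, i + 1 + c) else 0 := by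
  have hi : i ≠ i + 1 := by
    have : Nontrivial (Fin n) := Fin.nontrivial_iff_two_le.2 hn
    simp
  rw [chainMatrix_mulVec]
  simp only [cyclicPair, if_true, one_ne_zero, if_false, hess_indicator_edgeSet,
    SimpleGraph.comap_adj, ite_mul, one_mul, zero_mul, sum_edge_adj hi]
  rw [← Equiv.sum_comp (Equiv.addLeft i), ← Equiv.sum_comp (Equiv.addLeft (i + 1))
    fun k => if G.Adj (i + s - (i + 1) : Fin n) (k - (i + 1) : Fin n) then x (i, k) else 0]
  simp only [Equiv.coe_addLeft, add_sub_cancel_left, add_sub_add_left_eq_sub]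

/-- The graph with the edges `{a, a + 1}` for all `a ≥ 4` of the parity of `n`, and `{0, 2}`,
`{0, 3}` if `n` is even, `{0, 2}`, `{2, 4}`, `{3, 4}` if `n` is odd. It is chosen so that the linear
equations which `cyclicPair` turns it into can be solved one unknown at a time over every field. -/
def chainGraph (n : ℕ) : SimpleGraph ℕ := SimpleGraph.fromRel fun a b =>
  (4 ≤ a ∧ a % 2 = n % 2 ∧ b = a + 1) ∨ (a = 0 ∧ b = 2) ∨ (n % 2 = 0 ∧ a = 0 ∧ b = 3) ∨
    (n % 2 = 1 ∧ (a = 2 ∨ a = 3) ∧ b = 4)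

instance (n : ℕ) : DecidableRel (chainGraph n).Adj :=
  inferInstanceAs (DecidableRel (SimpleGraph.fromRel _).Adj)

/-- The neighbors of the vertex `a` of `chainGraph n` among the vertices below `n`. -/
def neighbors (n a : ℕ) : Finset ℕ := {b ∈ range n | (chainGraph n).Adj a b}

theorem neighbors_of_even (hn : n % 2 = 0) (h4 : 4 ≤ n) :
    neighbors n 0 = {2, 3} ∧ neighbors n 1 = ∅ ∧ neighbors n 2 = {0} ∧ neighbors n 3 = {0} := by
  refine ⟨?_, ?_, ?_, ?_⟩ <;> ext b <;> simp [neighbors, chainGraph, hn] <;> omega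

theorem neighbors_of_odd (hn : n % 2 = 1) (h5 : 5 ≤ n) :
    neighbors n 0 = {2} ∧ neighbors n 1 = ∅ ∧ neighbors n 2 = {0, 4} ∧ neighbors n 3 = {4} ∧
      neighbors n 4 = {2, 3} := by
  refine ⟨?_, ?_, ?_, ?_, ?_⟩ <;> ext b <;> simp [neighbors, chainGraph, hn] <;> omega

theorem neighbors_of_parity {a : ℕ} (ha : 4 ≤ a) (hpar : a % 2 = n % 2) (han : a + 1 < n) :
    neighbors n a = {a + 1} ∧ neighbors n (a + 1) = {a} := by
  constructor <;> ext b <;> simp [neighbors, chainGraph] <;> grind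

/-- The equations that `chainMatrix` imposes for `cyclicPair K n (chainGraph n)`. The vector `W c`,
with `c` modulo `n`, stands for `i ↦ x (i, i + c - 1)`, and `σ` for the shift `i ↦ i + 1`. -/
structure SolvesChain {M : Type*} [AddCommMonoid M] (n : ℕ) (σ : M →+ M) (W : ℕ → M) : Prop where
  period : ∀ c, W (c + n) = W c
  row : ∀ r < n, ∀ s < n, r + 1 ≡ s [MOD n] →
    ∑ c ∈ neighbors n s, σ (W c) + ∑ c ∈ neighbors n r, W (c + 2) = 0

namespace SolvesChain

variable {M : Type*} [AddCommMonoid M] {σ : M →+ M} {W : ℕ → M}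

theorem row_succ (h : SolvesChain n σ W) (r : ℕ) (hr : r + 1 < n) :
    ∑ c ∈ neighbors n (r + 1), σ (W c) + ∑ c ∈ neighbors n r, W (c + 2) = 0 :=
  h.row r (by omega) (r + 1) hr rfl

theorem row_last (h : SolvesChain n σ W) (hn : 0 < n) :
    ∑ c ∈ neighbors n 0, σ (W c) + ∑ c ∈ neighbors n (n - 1), W (c + 2) = 0 :=
  h.row (n - 1) (by omega) 0 hn (by rw [Nat.sub_add_cancel hn, Nat.ModEq, Nat.mod_self,
    Nat.zero_mod])

theorem sum_neighbors_last (h : SolvesChain n σ W) (h₀ : W 0 = 0) (h6 : 6 ≤ n) :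
    ∑ c ∈ neighbors n (n - 1), W (c + 2) = 0 := by
  have hN := (neighbors_of_parity (n := n) (a := n - 2) (by omega) (by omega) (by omega)).2
  rw [show n - 2 + 1 = n - 1 by omega] at hN
  rw [hN, sum_singleton, show n - 2 + 2 = 0 + n by omega, h.period, h₀]

theorem initial_eq_zero_of_even (h : SolvesChain n σ W) (hσ : Function.Injective σ) (hn : n % 2 = 0)
    (h4 : 4 ≤ n) : W 0 = 0 ∧ W 2 = 0 ∧ W 3 = 0 ∧ W 4 = 0 ∧ W 5 = 0 := by
  obtain ⟨N₀, N₁, N₂, N₃⟩ := neighbors_of_even hn h4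
  have h₀ : W 0 = 0 := by
    simpa [N₁, N₂, map_eq_zero_iff σ hσ] using h.row_succ 1 (by omega)
  have h₂ : W 2 = 0 := by
    simpa [N₂, N₃, h₀] using h.row_succ 2 (by omega)
  have h₄₅ : W 4 + W 5 = 0 := by
    simpa [N₀, N₁] using h.row_succ 0 (by omega)
  rcases (show n = 4 ∨ 6 ≤ n by omega) with rfl | h6
  · have h₄ : W 4 = 0 := (h.period 0).trans h₀
    have h₃ : W 3 = 0 := by
      simpa [N₀, N₃, h₂, map_eq_zero_iff σ hσ] using h.row_last (by omega)
    exact ⟨h₀, h₂, h₃, h₄, by simpa [h₄] using h₄₅⟩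
  · have h₃ : W 3 = 0 := by
      simpa [N₀, h₂, h.sum_neighbors_last h₀ h6, map_eq_zero_iff σ hσ] using h.row_last (by omega)
    have h₅ : W 5 = 0 := by
      simpa [N₃, (neighbors_of_parity le_rfl hn.symm (by omega)).1, h₂,
        map_eq_zero_iff σ hσ] using h.row_succ 3 (by omega)
    exact ⟨h₀, h₂, h₃, by simpa [h₅] using h₄₅, h₅⟩

theorem initial_eq_zero_of_odd (h : SolvesChain n σ W) (hσ : Function.Injective σ) (hn : n % 2 = 1)
    (h5 : 5 ≤ n) : W 0 = 0 ∧ W 2 = 0 ∧ W 3 = 0 ∧ W 4 = 0 ∧ W 5 = 0 ∧ W 6 = 0 := by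
  obtain ⟨N₀, N₁, N₂, N₃, N₄⟩ := neighbors_of_odd hn h5
  have h₄ : W 4 = 0 := by
    simpa [N₀, N₁] using h.row_succ 0 (by omega)
  have h₀ : W 0 = 0 := by
    simpa [N₁, N₂, h₄, map_eq_zero_iff σ hσ] using h.row_succ 1 (by omega)
  have hlast : ∑ c ∈ neighbors n (n - 1), W (c + 2) = 0 := by
    rcases (show n = 5 ∨ 6 ≤ n by omega) with rfl | h6
    · simp [N₄, h₄, h.period 0, h₀]
    · exact h.sum_neighbors_last h₀ h6
  have h₂ : W 2 = 0 := by
    simpa [N₀, hlast, map_eq_zero_iff σ hσ] using h.row_last (by omega)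
  have h₆ : W 6 = 0 := by
    simpa [N₂, N₃, h₂, h₄] using h.row_succ 2 (by omega)
  have h₃ : W 3 = 0 := by
    simpa [N₃, N₄, h₂, h₆, map_eq_zero_iff σ hσ] using h.row_succ 3 (by omega)
  have h₅ : W 5 = 0 := by
    rcases (show n = 5 ∨ 6 < n by omega) with rfl | h6
    · exact (h.period 0).trans h₀
    · simpa [N₄, (neighbors_of_parity (n := n) (a := 5) (by omega) (by omega) h6).1, h₄, h₆,
        map_eq_zero_iff σ hσ] using h.row_succ 4 (by omega)
  exact ⟨h₀, h₂, h₃, h₄, h₅, h₆⟩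

theorem eq_zero_of_consecutive (h : SolvesChain n σ W) (h₀ : W 0 = 0) {a : ℕ} (ha : 4 ≤ a)
    (hpar : a % 2 = n % 2) (hW : W a = 0 ∧ W (a + 1) = 0) :
    ∀ d, a + 2 * d ≤ n → W (a + 2 * d) = 0 ∧ W (a + 2 * d + 1) = 0
  | 0, _ => hW
  | d + 1, hd => by
    obtain ⟨hb, -⟩ := eq_zero_of_consecutive h h₀ ha hpar hW d (by omega)
    obtain ⟨N, N'⟩ := neighbors_of_parity (n := n) (a := a + 2 * d) (by omega) (by omega) (by omega)
    have hodd : W (a + 2 * d + 3) = 0 := by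
      simpa [N, N', hb] using h.row_succ (a + 2 * d) (by omega)
    refine ⟨?_, hodd⟩
    change W (a + 2 * d + 2) = 0
    rcases hd.eq_or_lt with hd | hd
    · rw [show a + 2 * d + 2 = 0 + n by omega, h.period, h₀]
    · have N₂ := (neighbors_of_parity (n := n) (a := a + 2 * d + 2) (by omega) (by omega)
        (by omega)).1
      simpa only [N', N₂, hodd, sum_singleton, map_zero, zero_add] using
        h.row_succ (a + 2 * d + 1) hd

theorem eq_zero (h : SolvesChain n σ W) (hσ : Function.Injective σ) (hn : 4 ≤ n) (c : ℕ)
    (hc : c ≤ n) : W c = 0 := by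
  obtain ⟨a, ha, hpar, h₀, h₂, h₃, h₄, hW⟩ : ∃ a, (a = 4 ∨ a = 5) ∧ a % 2 = n % 2 ∧
      W 0 = 0 ∧ W 2 = 0 ∧ W 3 = 0 ∧ W 4 = 0 ∧ W a = 0 ∧ W (a + 1) = 0 := by
    rcases n.mod_two_eq_zero_or_one with h2 | h2
    · obtain ⟨h₀, h₂, h₃, h₄, h₅⟩ := h.initial_eq_zero_of_even hσ h2 hn
      exact ⟨4, .inl rfl, h2.symm, h₀, h₂, h₃, h₄, h₄, h₅⟩
    · obtain ⟨h₀, h₂, h₃, h₄, h₅, h₆⟩ := h.initial_eq_zero_of_odd hσ h2 (by omega)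
      exact ⟨5, .inr rfl, h2.symm, h₀, h₂, h₃, h₄, h₅, h₆⟩
  have hchain : ∀ c, a ≤ c → c ≤ n + 1 → W c = 0 := fun c hac hcn => by
    have hzero := h.eq_zero_of_consecutive h₀ (by omega) hpar hW ((c - a) / 2) (by omega)
    obtain hc | hc : c = a + 2 * ((c - a) / 2) ∨ c = a + 2 * ((c - a) / 2) + 1 := by omega
    · exact hc ▸ hzero.1
    · exact hc ▸ hzero.2
  have h₁ : W 1 = 0 := by
    rw [← h.period, add_comm]
    exact hchain _ (by omega) le_rfl
  match c with
  | 0 => exact h₀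
  | 1 => exact h₁
  | 2 => exact h₂
  | 3 => exact h₃
  | 4 => exact h₄
  | c + 5 => exact hchain _ (by omega) (by omega)

end SolvesChain

theorem sum_adj_eq_sum_neighbors {M : Type*} [AddCommMonoid M] {a : ℕ} (F : ℕ → M) :
    ∑ c : Fin n, (if (chainGraph n).Adj a c then F c else 0) = ∑ c ∈ neighbors n a, F c := by
  rw [neighbors, sum_filter, sum_range]

theorem solvesChain_of_chainMatrix_mulVec_eq_zero [NeZero n] (hn : 2 ≤ n)
    {x : Fin n × Fin n → K} (hx : (chainMatrix (cyclicPair K n (chainGraph n))).mulVec x = 0) :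
    SolvesChain n (LinearMap.funLeft K K (· + 1)).toAddMonoidHom
      fun (c : ℕ) i => x (i, i + (c : Fin n) - 1) where
  period c := by simp
  row r hr s hs hrs := by
    have hrs' : ((s : Fin n) - 1 : Fin n) = (r : Fin n) := by
      rw [sub_eq_iff_eq_add, ← Nat.cast_one, ← Nat.cast_add]
      exact ((CharP.natCast_eq_natCast (Fin n) n).2 hrs).symm
    funext i
    have hrow := congrFun hx (i, i + s)
    rw [chainMatrix_cyclicPair_mulVec hn, hrs', Fin.val_cast_of_lt hr,
      Fin.val_cast_of_lt hs] at hrow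
    have hleft (c : Fin n) : i + 1 + c - 1 = i + c := by ring
    have hright (c : Fin n) : i + (c + 2) - 1 = i + 1 + c := by ring
    simpa only [← sum_adj_eq_sum_neighbors, Pi.add_apply, Finset.sum_apply, ite_apply,
      Pi.zero_apply, LinearMap.toAddMonoidHom_coe, LinearMap.funLeft_apply, Nat.cast_add,
      Nat.cast_ofNat, Fin.cast_val_eq_self, hleft, hright] using hrow

theorem exists_chainMatrix_injective (hn : 4 ≤ n) : ∃ v : CoeffIdx n → K,
    ∀ x : Fin n × Fin n → K, (chainMatrix v).mulVec x = 0 → x = 0 := by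
  have : NeZero n := ⟨by omega⟩
  refine ⟨cyclicPair K n (chainGraph n), fun x hx => ?_⟩
  have hW := solvesChain_of_chainMatrix_mulVec_eq_zero (by omega) hx
  funext ⟨i, j⟩
  have hshift : Function.Injective (LinearMap.funLeft K K fun i : Fin n => i + 1) :=
    LinearMap.funLeft_injective_of_surjective K K _ (add_right_surjective 1)
  have hindex : i + (j - i + 1) - 1 = j := by ring
  simpa only [Fin.cast_val_eq_self, hindex, Pi.zero_apply] using
    congrFun (hW.eq_zero hshift hn (j - i + 1 : Fin n) Fin.is_le') i

end CyclicPair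

section Generic

open Finset MvPolynomial

variable {K : Type u} [Field K] {n : ℕ}

theorem totalDegree_det_le {R σ κ : Type*} [CommRing R] [Fintype κ] [DecidableEq κ]
    (A : Matrix κ κ (MvPolynomial σ R)) {d : ℕ} (h : ∀ i j, (A i j).totalDegree ≤ d) :
    A.det.totalDegree ≤ Fintype.card κ * d := by
  rw [Matrix.det_apply']
  refine totalDegree_finsetSum_le fun π _ => ?_
  rw [← map_intCast (C : R →+* MvPolynomial σ R), ← smul_eq_C_mul]
  refine (totalDegree_smul_le _ _).trans ((totalDegree_finsetProd _ _).trans ?_)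
  exact (sum_le_card_nsmul _ _ d fun i _ => h _ _).trans_eq (by rw [card_univ, smul_eq_mul])

theorem exists_mul_eq_one_of_mulVec {ι κ : Type*} [Fintype ι] [Fintype κ] [DecidableEq κ]
    (A : Matrix ι κ K) (hA : ∀ x, A.mulVec x = 0 → x = 0) :
    ∃ B : Matrix κ ι K, B * A = 1 := by
  classical
  obtain ⟨g, hg⟩ := LinearMap.exists_leftInverse_of_injective (Matrix.toLin' A)
    (LinearMap.ker_eq_bot'.2 fun x hx => hA x hx)
  refine ⟨LinearMap.toMatrix' g, ?_⟩
  rw [← LinearMap.toMatrix'_toLin' A, ← LinearMap.toMatrix'_comp, hg, LinearMap.toMatrix'_id]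

theorem exists_generic_mul_eq_one {σ ι κ : Type*} [Fintype ι] [Fintype κ] [DecidableEq κ]
    (A : Matrix ι κ (MvPolynomial σ K)) {d : ℕ} (hd : ∀ i j, (A i j).totalDegree ≤ d) (v₀ : σ → K)
    (hA : ∀ x, (A.map (eval v₀)).mulVec x = 0 → x = 0) :
    ∃ D : MvPolynomial σ K, D ≠ 0 ∧ D.totalDegree ≤ Fintype.card κ * d ∧
      ∀ v, eval v D ≠ 0 → ∃ B : Matrix κ ι K, B * A.map (eval v) = 1 := by
  obtain ⟨B, hB⟩ := exists_mul_eq_one_of_mulVec _ hA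
  have heval (v : σ → K) : eval v (B.map (C (σ := σ)) * A).det = (B * A.map (eval v)).det := by
    rw [RingHom.map_det, RingHom.mapMatrix_apply, Matrix.map_mul, Matrix.map_map]
    congr 2
    ext i j
    exact eval_C _
  refine ⟨(B.map (C (σ := σ)) * A).det, fun h0 => ?_, totalDegree_det_le _ fun i j => ?_,
    fun v hv => ?_⟩
  · have hdet := heval v₀
    rw [h0, hB, map_zero, Matrix.det_one] at hdet
    exact zero_ne_one hdet
  · rw [Matrix.mul_apply]
    refine totalDegree_finsetSum_le fun k _ => ?_
    rw [Matrix.map_apply, ← smul_eq_C_mul]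
    exact (totalDegree_smul_le _ _).trans (hd k j)
  · rw [heval] at hv
    exact ⟨(B * A.map (eval v))⁻¹ * B, by
      rw [Matrix.mul_assoc, Matrix.nonsing_inv_mul _ (isUnit_iff_ne_zero.2 hv)]⟩

theorem totalDegree_hess_le {R σ : Type*} [CommSemiring R] (c : Sym2 (Fin n) → MvPolynomial σ R)
    {d : ℕ} (hd : ∀ s, (c s).totalDegree ≤ d) (a b : Fin n) : (hess c a b).totalDegree ≤ d := by
  rw [hess]
  split_ifs
  · exact (totalDegree_add _ _).trans (max_le (hd _) (hd _))
  · exact hd _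

theorem totalDegree_chainMatrix_le (p q) :
    (chainMatrix (X : CoeffIdx n → MvPolynomial (CoeffIdx n) K) p q).totalDegree ≤ 2 :=
  totalDegree_finsetSum_le fun _ _ => (totalDegree_mul _ _).trans <| add_le_add
    (totalDegree_hess_le (d := 1) _ (fun _ => (totalDegree_X _).le) _ _)
    (totalDegree_hess_le (d := 1) _ (fun _ => (totalDegree_X _).le) _ _)

theorem chainMatrix_map_eval (v : CoeffIdx n → K) :
    (chainMatrix (X : CoeffIdx n → MvPolynomial (CoeffIdx n) K)).map (eval v) = chainMatrix v := by
  ext p q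
  simp only [Matrix.map_apply, chainMatrix, map_sum, map_mul, hess, apply_ite (eval v), map_add,
    eval_X]

/-- The matrix of the homogeneous linear equations that `TrivialQuotient` imposes on the entries of
`q` and on the multipliers `L` of all variables. -/
def quotMatrix {R : Type*} [CommRing R] (v : CoeffIdx n → R) :
    Matrix (Fin n ⊕ Fin n × Fin n × Fin n × Fin n) (Fin n × Fin n ⊕ Fin n × Fin n × Fin n) R
  | .inl a, .inl p => if p = (a, a) then 1 else 0
  | .inl _, .inr _ => 0
  | .inr (k, a, b, c), .inl p => xMul k (fun a b => if p = (a, b) then 1 else 0) a b c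
  | .inr (k, a, b, c), .inr (k₀, k', m) =>
    if k₀ = k then -xMul k' (rightTable v m) a b c else 0

theorem quotMatrix_mulVec_inl (v : CoeffIdx n → K) (q : Fin n × Fin n → K)
    (L : Fin n × Fin n × Fin n → K) (a : Fin n) :
    (quotMatrix v).mulVec (Sum.elim q L) (.inl a) = q (a, a) := by
  simp [quotMatrix, Matrix.mulVec, dotProduct]

theorem quotMatrix_mulVec_inr (v : CoeffIdx n → K) (q : Fin n × Fin n → K)
    (L : Fin n × Fin n × Fin n → K) (k a b c : Fin n) :
    (quotMatrix v).mulVec (Sum.elim q L) (.inr (k, a, b, c)) =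
      xMul k (fun a b => q (a, b)) a b c -
        ∑ k', ∑ m, L (k, k', m) * xMul k' (rightTable v m) a b c := by
  have hq : ∑ p, xMul k (fun a b => if p = (a, b) then (1 : K) else 0) a b c * q p =
      xMul k (fun a b => q (a, b)) a b c := by
    simp only [xMul]
    split_ifs <;> simp
  have hL : ∑ p : Fin n × Fin n × Fin n, (if p.1 = k then
      -xMul p.2.1 (rightTable v p.2.2) a b c else 0) * L p =
        -∑ k', ∑ m, L (k, k', m) * xMul k' (rightTable v m) a b c := by
    simp only [Fintype.sum_prod_type, ite_mul, zero_mul, sum_ite_irrel, sum_const_zero,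
      sum_ite_eq', mem_univ, if_true, neg_mul, sum_neg_distrib, mul_comm]
  rw [sub_eq_add_neg, ← hq, ← hL]
  exact Fintype.sum_sum_type _

theorem quotMatrix_mulVec_eq_zero_iff (v : CoeffIdx n → K) (q : Fin n × Fin n → K)
    (L : Fin n × Fin n × Fin n → K) : (quotMatrix v).mulVec (Sum.elim q L) = 0 ↔
      (∀ a, q (a, a) = 0) ∧ ∀ k a b c, xMul k (fun a b => q (a, b)) a b c =
        ∑ k', ∑ m, L (k, k', m) * xMul k' (rightTable v m) a b c := by
  simp only [funext_iff, Sum.forall, Prod.forall, quotMatrix_mulVec_inl, quotMatrix_mulVec_inr,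
    Pi.zero_apply, sub_eq_zero]

theorem quotMatrix_map_eval (v : CoeffIdx n → K) :
    (quotMatrix (X : CoeffIdx n → MvPolynomial (CoeffIdx n) K)).map (eval v) = quotMatrix v := by
  ext (a | t) (p | p)
  · simp [quotMatrix, apply_ite (eval v)]
  · simp [quotMatrix]
  · simp [quotMatrix, xMul, apply_ite (eval v)]
  · simp [quotMatrix, xMul, rightTable, apply_ite (eval v)]

theorem totalDegree_quotMatrix_le (i j) :
    (quotMatrix (X : CoeffIdx n → MvPolynomial (CoeffIdx n) K) i j).totalDegree ≤ 1 := by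
  rcases i with a | t <;> rcases j with p | p <;> simp only [quotMatrix, xMul, rightTable] <;>
    (try split_ifs) <;> simp [totalDegree_neg]

theorem trivialQuotient_of_quotMatrix (v : CoeffIdx n → K)
    (hv : ∀ x, (quotMatrix v).mulVec x = 0 → x = 0) : TrivialQuotient v := by
  intro q hq hL
  choose L hL using hL
  have hx := hv (Sum.elim (fun p => q p.1 p.2) fun p => L p.1 p.2.1 p.2.2)
    ((quotMatrix_mulVec_eq_zero_iff _ _ _).2 ⟨hq, hL⟩)
  funext a b
  exact congrFun hx (.inl (a, b))

/-- The pair of `g_i = y_i ^ 2` and `h_m = x_m ^ 2`, for which `quotMatrix` is injective. -/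
def squarePair (K : Type u) [Field K] (n : ℕ) (p : CoeffIdx n) : K :=
  if p.2.2 = s(p.2.1, p.2.1) then 1 else 0

theorem rightTable_squarePair (m a b : Fin n) :
    rightTable (squarePair K n) m a b = if a = m ∧ b = m then 1 else 0 := by
  simp [rightTable, squarePair]

theorem xMul_rightTable_squarePair_of_ne {k m a b c : Fin n} (hab : a ≠ b) (hac : a ≠ c)
    (hbc : b ≠ c) : xMul k (rightTable (squarePair K n) m) a b c = 0 := by
  simp only [xMul, rightTable_squarePair]
  split_ifs <;> grind

theorem xMul_rightTable_squarePair_self (k m a b : Fin n) :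
    xMul k (rightTable (squarePair K n) m) a b b = if k = a ∧ m = b then 1 else 0 := by
  simp only [xMul, rightTable_squarePair]
  split_ifs <;> grind

theorem quotMatrix_squarePair_injective (hn : 3 ≤ n) (x)
    (hx : (quotMatrix (squarePair K n)).mulVec x = 0) : x = 0 := by
  obtain ⟨q, L, rfl⟩ : ∃ q L, x = Sum.elim q L := ⟨_, _, (Sum.elim_comp_inl_inr x).symm⟩
  obtain ⟨hdiag, hmul⟩ := (quotMatrix_mulVec_eq_zero_iff _ _ _).1 hx
  have hq (a b : Fin n) : q (a, b) = 0 := by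
    rcases eq_or_ne a b with rfl | hab
    · exact hdiag a
    · obtain ⟨k, hka, hkb⟩ : ∃ k, k ≠ a ∧ k ≠ b := Fin.exists_ne_and_ne_of_two_lt a b hn
      have hkab := hmul k k a b
      rw [xMul, if_pos rfl] at hkab
      simpa only [xMul_rightTable_squarePair_of_ne hka hkb hab, mul_zero, sum_const_zero] using hkab
  have hL (k k' m : Fin n) : L (k, k', m) = 0 := by
    have hkm := hmul k k' m m
    rw [show xMul k (fun a b => q (a, b)) k' m m = 0 by simp [xMul, hq]] at hkm
    simpa [xMul_rightTable_squarePair_self, ite_and] using hkm.symm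
  funext i
  rcases i with ⟨a, b⟩ | ⟨k, k', m⟩
  · exact hq a b
  · exact hL k k' m

theorem exists_generic (hn : 4 ≤ n) :
    ∃ D : MvPolynomial (CoeffIdx n) K, D ≠ 0 ∧ D.totalDegree ≤ n ^ 3 + 3 * n ^ 2 ∧
      ∀ v, eval v D ≠ 0 → (∃ B : Matrix (Fin n × Fin n) (Fin n × Fin n) K,
        B * chainMatrix v = 1) ∧ TrivialQuotient v := by
  obtain ⟨v₁, hv₁⟩ := exists_chainMatrix_injective (K := K) hn
  obtain ⟨D₁, hD₁, hdeg₁, hinv₁⟩ := exists_generic_mul_eq_one _ totalDegree_chainMatrix_le v₁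
    (by rwa [chainMatrix_map_eval])
  obtain ⟨D₂, hD₂, hdeg₂, hinv₂⟩ := exists_generic_mul_eq_one _ totalDegree_quotMatrix_le
    (squarePair K n) (by
      rw [quotMatrix_map_eval]
      exact quotMatrix_squarePair_injective (by omega))
  refine ⟨D₁ * D₂, mul_ne_zero hD₁ hD₂, (totalDegree_mul _ _).trans ?_, fun v hv => ?_⟩
  · simp only [Fintype.card_sum, Fintype.card_prod, Fintype.card_fin] at hdeg₁ hdeg₂
    nlinarith
  · rw [map_mul] at hv
    obtain ⟨B, hB⟩ := hinv₁ v (left_ne_zero_of_mul hv)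
    obtain ⟨B', hB'⟩ := hinv₂ v (right_ne_zero_of_mul hv)
    rw [chainMatrix_map_eval] at hB
    rw [quotMatrix_map_eval] at hB'
    refine ⟨⟨B, hB⟩, trivialQuotient_of_quotMatrix v fun x hx => ?_⟩
    rw [← Matrix.one_mulVec x, ← hB', ← Matrix.mulVec_mulVec, hx, Matrix.mulVec_zero]

end Generic

section Program

open MvPolynomial

variable {K : Type u} [Field K] {n : ℕ}

/-- The program that decomposes quartic forms. -/
def program : Prog := .seq Cmd.setup.compile Cmd.main.compile

/-- A bound for the running time of `program`; all loops of `Cmd.main` are bounded by one of `n`,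
`n * n`, `n * (n * n)` and `n * n + n`. -/
noncomputable def runningTime : Polynomial ℕ :=
  Cmd.setup.costPoly + Cmd.main.costPoly.comp (.X ^ 3 + .X ^ 2 + .X)

theorem setup_den_nat_bounds_le (f : Fin n → MvPolynomial (Fin n) K) (ρ : ℕ → K) :
    ∀ u ∈ Cmd.main.bounds,
      (Cmd.setup.den (initState f ρ)).nat u [] ≤ n ^ 3 + n ^ 2 + n := fun u hu => by
  have henv := Cmd.env_setup f ρ
  have hbounds : ∀ u ∈ Cmd.main.bounds,
      u ∈ [sizeVar, sizeSqVar, sizeCubeVar, relationSizeVar] := by decide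
  have hu := hbounds u hu
  simp only [List.mem_cons, List.not_mem_nil, or_false] at hu
  rcases hu with rfl | rfl | rfl | rfl
  · rw [henv.size]; omega
  · rw [henv.square, ← sq]; omega
  · rw [henv.cube, show n * (n * n) = n ^ 3 by ring]; omega
  · rw [henv.relationSize, ← sq]; omega

theorem exec_program (f : Fin n → MvPolynomial (Fin n) K) (ρ : ℕ → K) :
    ∃ t ≤ runningTime.eval n,
      Exec program (initState f ρ) t (Cmd.main.den (Cmd.setup.den (initState f ρ))) := by
  obtain ⟨s, hs, hsetup⟩ := Cmd.exec_compile Cmd.setup Cmd.countersSafe_setup Cmd.bounds_setup n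
    (initState f ρ) fun u _ => by simp only [initState]; split_ifs <;> omega
  obtain ⟨t, ht, hmain⟩ := Cmd.exec_compile Cmd.main Cmd.countersSafe_main Cmd.bounds_main
    (n ^ 3 + n ^ 2 + n) (Cmd.setup.den (initState f ρ)) (setup_den_nat_bounds_le f ρ)
  refine ⟨s + t, ?_, .seq hsetup hmain⟩
  simp only [runningTime, Polynomial.eval_add, Polynomial.eval_comp, Polynomial.eval_pow,
    Polynomial.eval_X]
  exact add_le_add hs ht

theorem exec_program_sound (hn : 0 < n) {f : Fin n → MvPolynomial (Fin n) K}
    (hf : ∀ i, (f i).IsHomogeneous 4) (ρ : ℕ → K) :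
    ∃ (t : ℕ) (τ : State K), Exec program (initState f ρ) t τ ∧ t ≤ runningTime.eval n ∧
      (Announces τ → IsQuadraticDecomposition f (outputLeft n τ) (outputRight n τ)) := by
  obtain ⟨t, ht, hexec⟩ := exec_program f ρ
  obtain ⟨A, Q, R, hcomp⟩ := exists_computes hn f ρ
  exact ⟨t, _, hexec, ht, hcomp.isQuadraticDecomposition hf⟩

theorem succeeds_program (hn : 0 < n) {v : CoeffIdx n → K}
    (hB : ∃ B : Matrix (Fin n × Fin n) (Fin n × Fin n) K, B * chainMatrix v = 1)
    (hv : TrivialQuotient v) {m : ℕ} (r : Fin m → K) :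
    Succeeds program (compose (leftFactor v) (rightFactor v)) r := by
  obtain ⟨B, hB⟩ := hB
  obtain ⟨t, -, hexec⟩ := exec_program (compose (leftFactor v) (rightFactor v)) (extendTape r)
  obtain ⟨A, Q, R, hcomp⟩ :=
    exists_computes hn (compose (leftFactor v) (rightFactor v)) (extendTape r)
  have hannounces := hcomp.announces_of_trivialQuotient hn hB hv
  exact ⟨t, _, hexec, hannounces, hcomp.isQuadraticDecomposition
    (isHomogeneous_compose (fun _ => isHomogeneous_quadForm _) fun _ => isHomogeneous_quadForm _)
    hannounces⟩

theorem exists_generic_succeeds (K : Type u) [Field K] (hn : 4 ≤ n) :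
    ∃ D : MvPolynomial (CoeffIdx n) K, D ≠ 0 ∧ D.totalDegree ≤ n ^ 3 + 3 * n ^ 2 ∧
      ∀ v, eval v D ≠ 0 → ∀ (m : ℕ) (r : Fin m → K),
        Succeeds program (compose (leftFactor v) (rightFactor v)) r := by
  obtain ⟨D, hD, hdeg, hgeneric⟩ := exists_generic (K := K) hn
  exact ⟨D, hD, hdeg, fun v hv _ r =>
    succeeds_program (by omega) (hgeneric v hv).1 (hgeneric v hv).2 r⟩

end Program

section Probability

open Finset MvPolynomial

variable {K : Type u} [Field K] [Finite K]

theorem card_zeros_div_le {σ : Type*} [Finite σ] {D : MvPolynomial σ K} (hD : D ≠ 0) :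
    (Nat.card {v : σ → K // eval v D = 0} : ℝ) / Nat.card (σ → K) ≤
      D.totalDegree / Nat.card K := by
  classical
  have := Fintype.ofFinite K
  have := Fintype.ofFinite σ
  let e := Fintype.equivFin σ
  have hrename : rename e D ≠ 0 := (map_ne_zero_iff _ (rename_injective _ e.injective)).2 hD
  have hcard : #{w ∈ Fintype.piFinset fun _ : Fin (Fintype.card σ) => (univ : Finset K) |
      eval w (rename e D) = 0} = Nat.card {v : σ → K // eval v D = 0} := by
    rw [Fintype.piFinset_univ, ← Fintype.card_subtype, ← Nat.card_eq_fintype_card]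
    refine Nat.card_congr ((e.arrowCongr (Equiv.refl K)).symm.subtypeEquiv fun w => ?_)
    rw [eval_rename]
    rfl
  have hzeros := schwartz_zippel_totalDegree hrename (univ : Finset K)
  rw [hcard, card_univ] at hzeros
  have hdeg := div_le_div_of_nonneg_right (Nat.cast_le (α := ℚ≥0).2 (totalDegree_rename_le e D))
    (Nat.cast_nonneg (Fintype.card K))
  simpa using (NNRat.cast_le (K := ℝ)).2 (hzeros.trans hdeg)

theorem one_sub_le_card_nonzeros_div {σ : Type*} [Finite σ] {D : MvPolynomial σ K} (hD : D ≠ 0) :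
    1 - (D.totalDegree : ℝ) / Nat.card K ≤
      Nat.card {v : σ → K // eval v D ≠ 0} / Nat.card (σ → K) := by
  classical
  have hpos : (0 : ℝ) < Nat.card (σ → K) := by exact_mod_cast Nat.card_pos
  have hsum : (Nat.card {v : σ → K // eval v D = 0} : ℝ) + Nat.card {v : σ → K // eval v D ≠ 0} =
      Nat.card (σ → K) := by
    rw [← Nat.cast_add, ← Nat.card_sum]
    exact congrArg _ (Nat.card_congr (Equiv.sumCompl _))
  have hone := div_self hpos.ne'
  rw [← hsum, add_div, hsum] at hone
  linarith [card_zeros_div_le hD]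

theorem le_successProb {n m : ℕ} {A : Prog} {D : MvPolynomial (CoeffIdx n) K} (hD : D ≠ 0)
    (h : ∀ v, eval v D ≠ 0 → ∀ r : Fin m → K,
      Succeeds A (compose (leftFactor v) (rightFactor v)) r) :
    1 - (D.totalDegree : ℝ) / Nat.card K ≤ successProb K n m A := by
  have hle : Nat.card ({v : CoeffIdx n → K // eval v D ≠ 0} × (Fin m → K)) ≤
      Nat.card {ω : (CoeffIdx n → K) × (Fin m → K) //
        Succeeds A (compose (leftFactor ω.1) (rightFactor ω.1)) ω.2} :=
    Nat.card_le_card_of_injective (fun p => ⟨(p.1.1, p.2), h _ p.1.2 _⟩) fun p q hpq => by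
      simp only [Subtype.mk.injEq, Prod.mk.injEq] at hpq
      exact Prod.ext (Subtype.ext hpq.1) hpq.2
  have hpos : (Nat.card (Fin m → K) : ℝ) ≠ 0 := by exact_mod_cast Nat.card_pos.ne'
  refine (one_sub_le_card_nonzeros_div hD).trans ?_
  rw [← mul_div_mul_right _ _ hpos, successProb, ← Nat.cast_mul, ← Nat.cast_mul,
    ← Nat.card_prod, ← Nat.card_prod]
  gcongr

end Probability

end FDP

theorem mainTheorem1_general :
    ∃ (A : FDP.Prog) (T Q : Polynomial ℕ),
      (∀ (K : Type u) [Field K] (n : ℕ), 0 < n →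
        ∀ f : Fin n → MvPolynomial (Fin n) K, (∀ i, (f i).IsHomogeneous 4) →
        ∀ ρ : ℕ → K, ∃ (t : ℕ) (τ : FDP.State K),
          FDP.Exec A (FDP.initState f ρ) t τ ∧ t ≤ T.eval n ∧
          (FDP.Announces τ →
            FDP.IsQuadraticDecomposition f (FDP.outputLeft n τ) (FDP.outputRight n τ))) ∧
      (∀ (K : Type u) [Field K] (n : ℕ), 4 ≤ n →
        ∃ D : MvPolynomial (FDP.CoeffIdx n) K, D ≠ 0 ∧ D.totalDegree ≤ Q.eval n ∧
          ∀ v : FDP.CoeffIdx n → K, MvPolynomial.eval v D ≠ 0 → ∀ (m : ℕ) (r : Fin m → K),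
            FDP.Succeeds A (FDP.compose (FDP.leftFactor v) (FDP.rightFactor v)) r) ∧
      (∀ (K : Type u) [Field K] [Finite K] (n : ℕ), 4 ≤ n → ∀ m : ℕ,
        1 - ((Q.eval n : ℕ) : ℝ) / (Nat.card K : ℝ) ≤ FDP.successProb K n m A) := by
  have hQ (n : ℕ) : (.X ^ 3 + 3 * .X ^ 2 : Polynomial ℕ).eval n = n ^ 3 + 3 * n ^ 2 := by simp
  refine ⟨FDP.program, FDP.runningTime, .X ^ 3 + 3 * .X ^ 2,
    fun K _ n hn f hf ρ => FDP.exec_program_sound hn hf ρ,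
    fun K _ n hn => hQ n ▸ FDP.exists_generic_succeeds K hn, fun K _ _ n hn m => ?_⟩
  obtain ⟨D, hD, hdeg, hsucc⟩ := FDP.exists_generic_succeeds K hn
  refine le_trans ?_ (FDP.le_successProb hD fun v hv r => hsucc v hv m r)
  rw [hQ]
  gcongr

theorem mainTheorem1 :
    ∃ (A : FDP.Prog) (T Q : Polynomial ℕ),
      -- over every field, polynomial running time, and no wrong output
      (∀ (K : Type u) [Field K] (n : ℕ), 5 ≤ n →
        ∀ f : Fin n → MvPolynomial (Fin n) K, (∀ i, (f i).IsHomogeneous 4) →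
        ∀ ρ : ℕ → K, ∃ (t : ℕ) (τ : FDP.State K),
          FDP.Exec A (FDP.initState f ρ) t τ ∧ t ≤ T.eval n ∧
          (FDP.Announces τ →
            FDP.IsQuadraticDecomposition f (FDP.outputLeft n τ) (FDP.outputRight n τ))) ∧
      -- characteristic zero: success off a proper algebraic subset of the coefficient space,
      -- for all random choices off a proper algebraic subset
      (∀ (K : Type u) [Field K] [CharZero K] (n : ℕ), 5 ≤ n →
        ∃ D : MvPolynomial (FDP.CoeffIdx n) K, D ≠ 0 ∧
          ∀ v : FDP.CoeffIdx n → K, MvPolynomial.eval v D ≠ 0 →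
            ∃ E : MvPolynomial (Fin (T.eval n)) K, E ≠ 0 ∧
              ∀ r : Fin (T.eval n) → K, MvPolynomial.eval r E ≠ 0 →
                FDP.Succeeds A (FDP.compose (FDP.leftFactor v) (FDP.rightFactor v)) r) ∧
      -- finite fields
      (∀ (K : Type u) [Field K] [Finite K] (n : ℕ), 5 ≤ n →
        1 - ((Q.eval n : ℕ) : ℝ) / (Nat.card K : ℝ) ≤ FDP.successProb K n (T.eval n) A) := by
  obtain ⟨A, T, Q, hsound, hgeneric, hprob⟩ := mainTheorem1_general
  exact ⟨A, T, Q, fun K _ n hn => hsound K n (by omega), fun K _ _ n hn =>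
    (hgeneric K n (by omega)).imp fun D ⟨hD, _, hsucc⟩ => ⟨hD, fun v hv =>
      ⟨1, one_ne_zero, fun r _ => hsucc v hv _ r⟩⟩, fun K _ _ n hn => hprob K n (by omega) _⟩
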